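/- Let $g,n\ge 0$ be integers, let $\boldsymbol\vartheta=(\vartheta_1,\dots,\vartheta_n)\in\mathbb R_{>0}^n$, and let $k$ be the number of integral entries of $\boldsymbol\vartheta$. Let $$\Pi_{g,n}=\langle \mu_1,\nu_1,\dots,\mu_g,\nu_g,\beta_1,\dots,\beta_n \mid [\mu_1,\nu_1]\cdots[\mu_g,\nu_g]\,\beta_1\cdots\beta_n=e\rangle$$ be the fundamental group of the oriented surface of genus $g$ with $n$ punctures. Let $\bar\delta_i\in[0,1]$ be the distance of $\vartheta_i$ from the set of odd integers and let $\mathcal C_{\bar\delta_i}\subset\mathrm{SU}_2$ be the conjugacy class of matrices with eigenvalues $e^{\pm i\pi\bar\delta_i}$. Let $\mathrm{Hom}_{\boldsymbol\vartheta}(\Pi_{g,n},\mathrm{SU}_2)$ be the space of homomorphisms $\rho:\Pi_{g,n}\to\mathrm{SU}_2$ that send the conjugacy class of $\beta_i$ into $\mathcal C_{\bar\delta_i}$ for all $i$; it is regarded as a real algebraic set through the entries of the matrices $\rho(\mu_j),\rho(\nu_j),\rho(\beta_i)$. Let $\mathrm{Rep}_{\boldsymbol\vartheta}(\Pi_{g,n},\mathrm{SU}_2)$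 be its image in the topological quotient $\mathrm{Rep}(\Pi_{g,n},\mathrm{SU}_2)$ of $\mathrm{Hom}(\Pi_{g,n},\mathrm{SU}_2)$ by conjugation, regarded as a semi-algebraic set through the conjugation-invariant polynomial functions. A homomorphism is coaxial if its image lies in a $1$-parameter subgroup of $\mathrm{SU}_2$. The coaxial locus in $\mathrm{Rep}_{\boldsymbol\vartheta}$ is the image of the coaxial locus of $\mathrm{Hom}_{\boldsymbol\vartheta}$, and the non-coaxial locus in $\mathrm{Rep}_{\boldsymbol\vartheta}$ is its complement. Pure dimension $d$ means that every irreducible component has dimension $d$; manifolds are (possibly empty) analytic manifolds, embedded in affine space by the polynomial functions above, and the empty set counts as a manifold of every integral dimension. Then inside $\mathrm{Hom}_{\boldsymbol\vartheta}(\Pi_{g,n},\mathrm{SU}_2)$ (i) the coaxial locus is non-empty if and only if $\sum_i \varepsilon_i(\vartheta_i-1)\in 2\mathbb Z$ for some signs $\varepsilon_i\in\{\pm1\}$; it has pure dimension $2g+2$ if $g>0$ or $k<n$, and pure dimension $0$ if $g=0$ and $k=n$; (ii) the non-coaxial locus is an oriented manifold of real dimension $6g-3+2(n-k)$. Inside $\mathrm{Rep}_{\boldsymbol\vartheta}(\Pi_{g,n},\mathrm{SU}_2)$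 (iii) the coaxial locus has pure dimension $2g$; (iv) the non-coaxial locus is an oriented manifold of real dimension $6g-6+2(n-k)$. The same claims hold with $\mathrm{SU}_2$ replaced by $\mathrm{SL}_2(\mathbb C)$, real algebraic and real analytic replaced by complex algebraic and complex analytic, and real dimensions replaced by complex dimensions. Here $\mathrm{Hom}_{\boldsymbol\vartheta}(\Pi_{g,n},\mathrm{SL}_2(\mathbb C))$ consists of the homomorphisms for which each $\rho(\beta_i)$ is conjugate in $\mathrm{SL}_2(\mathbb C)$ to an element of $\mathcal C_{\bar\delta_i}$; a homomorphism is coaxial if its image in $\mathrm{PSL}_2(\mathbb C)$ lies in a complex $1$-parameter subgroup; $\mathrm{Rep}(\Pi_{g,n},\mathrm{SL}_2(\mathbb C))$ is the largest Hausdorff quotient of $\mathrm{Hom}(\Pi_{g,n},\mathrm{SL}_2(\mathbb C))$ by conjugation, $\mathrm{Rep}_{\boldsymbol\vartheta}$ is the image of $\mathrm{Hom}_{\boldsymbol\vartheta}$ in it, its coaxial locus is the image of the coaxial locus of $\mathrm{Hom}_{\boldsymbol\vartheta}$, and its non-coaxial locus is the complement of the coaxial locus in $\mathrm{Rep}_{\boldsymbol\vartheta}$.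 -/

import Mathlib

open scoped Manifold ContDiff Polynomial

noncomputable section

namespace SurfaceRep

/-! ### Spaces with an algebra of regular functions

A (semi-)algebraic set over `K` is handled as a type `X` together with the `K`-algebra
`A ⊆ (X → K)` of its regular (polynomial) functions. -/

section Regular

variable {K : Type*} [Field K] {X Y : Type*}

/-- Pull-back of functions along a map. -/
def pullback (K : Type*) [Field K] (f : X → Y) : (Y → K) →ₐ[K] (X → K) :=
  AlgHom.pi fun x => Pi.evalAlgHom K (fun _ => K) (f x)

/-- The restrictions to the subset `Z` of the regular functions. -/
def restrict (A : Subalgebra K (X → K)) (Z : Set X) : Subalgebra K (Z → K) :=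
  A.map (pullback K (Subtype.val : Z → X))

/-- The functions on the target of `π` whose pull-back is regular. If `π` is a quotient map
by a group action, these are the invariant regular functions. -/
def pushforward (A : Subalgebra K (X → K)) (π : X → Y) : Subalgebra K (Y → K) :=
  A.comap (pullback K π)

/-- The Zariski topology: the sets `{x | f x ≠ 0}`, for `f` regular, form a basis. -/
@[reducible]
def zariski (A : Subalgebra K (X → K)) : TopologicalSpace X :=
  TopologicalSpace.generateFrom {U | ∃ f ∈ A, U = {x | f x ≠ 0}}

/-- Every irreducible component of `X` has dimension `d`, the dimension of a set being the
Krull dimension of its ring of regular functions. -/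
def HasPureDim (A : Subalgebra K (X → K)) (d : ℕ) : Prop :=
  ∀ C ∈ @irreducibleComponents X (zariski A), ringKrullDim (restrict A C) = (d : WithBot ℕ∞)

end Regular

section Manifold

variable {K : Type*} [RCLike K] {X : Type*} [TopologicalSpace X]

/-- The transition maps of the chosen atlas preserve the orientation of the underlying real
vector space. -/
def OrientedAtlas (K : Type*) [RCLike K] (X : Type*) [TopologicalSpace X] (m : ℕ)
    [ChartedSpace (EuclideanSpace K (Fin m)) X] : Prop :=
  ∀ e ∈ atlas (EuclideanSpace K (Fin m)) X, ∀ e' ∈ atlas (EuclideanSpace K (Fin m)) X,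
    ∀ x ∈ (e.symm.trans e').source, 0 < (fderiv ℝ (e.symm.trans e') x).det

/-- `X`, with its topology and its algebra `A` of regular functions, is an oriented `K`-analytic
manifold of dimension `d` over `K`: it is Hausdorff and second countable, and it has an oriented
`K`-analytic atlas with values in `K ^ d` such that regular functions are analytic and their
differentials span every cotangent space (that is, a finite set of generators of `A` gives an
immersion into an affine space). The empty space is a manifold of every dimension `d`. -/
def IsOrientedManifold (A : Subalgebra K (X → K)) (d : ℤ) : Prop :=
  T2Space X ∧ SecondCountableTopology X ∧
    (IsEmpty X ∨ ∃ m : ℕ, (m : ℤ) = d ∧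
      ∃ _ : ChartedSpace (EuclideanSpace K (Fin m)) X,
        IsManifold 𝓘(K, EuclideanSpace K (Fin m)) ω X ∧
        OrientedAtlas K X m ∧
        (∀ f ∈ A, ContMDiff 𝓘(K, EuclideanSpace K (Fin m)) 𝓘(K, K) ω f) ∧
        ∀ (x : X) (v : TangentSpace 𝓘(K, EuclideanSpace K (Fin m)) x),
          (∀ f ∈ A, mfderiv 𝓘(K, EuclideanSpace K (Fin m)) 𝓘(K, K) f x v = 0) → v = 0)

end Manifold

/-! ### The group of the punctured surface and its homomorphisms -/

/-- The standard generators `μ_j`, `ν_j`, `β_i`. -/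
inductive SurfaceGen (g n : ℕ) : Type
  | mu (j : Fin g) : SurfaceGen g n
  | nu (j : Fin g) : SurfaceGen g n
  | beta (i : Fin n) : SurfaceGen g n

/-- `[μ_1, ν_1] ⋯ [μ_g, ν_g] β_1 ⋯ β_n`. -/
def surfaceRelator (g n : ℕ) : FreeGroup (SurfaceGen g n) :=
  (List.ofFn fun j : Fin g =>
      FreeGroup.of (SurfaceGen.mu (n := n) j) * FreeGroup.of (SurfaceGen.nu j) *
        (FreeGroup.of (SurfaceGen.mu j))⁻¹ * (FreeGroup.of (SurfaceGen.nu j))⁻¹).prod *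
    (List.ofFn fun i : Fin n => FreeGroup.of (SurfaceGen.beta (g := g) i)).prod

/-- The fundamental group of a surface of genus `g` with `n` punctures. -/
abbrev SurfaceGroup (g n : ℕ) : Type := PresentedGroup {surfaceRelator g n}

/-- A standard generator, as an element of the surface group. -/
def gen {g n : ℕ} (s : SurfaceGen g n) : SurfaceGroup g n :=
  PresentedGroup.of s

/-- The space of homomorphisms from the surface group to `G`. -/
def HomSpace (g n : ℕ) (G : Type*) [Group G] : Type _ := SurfaceGroup g n →* G

/-- The topology inherited from the space of tuples of values at the generators. -/
instance (g n : ℕ) (G : Type*) [Group G] [TopologicalSpace G] :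
    TopologicalSpace (HomSpace g n G) :=
  TopologicalSpace.induced
    (fun (ρ : SurfaceGroup g n →* G) (s : SurfaceGen g n) => ρ (gen s)) inferInstance

/-- Conjugacy of homomorphisms (the centre of `G` acts trivially). -/
def conjSetoid (g n : ℕ) (G : Type*) [Group G] : Setoid (HomSpace g n G) where
  r (ρ σ : SurfaceGroup g n →* G) := ∃ a : G, ∀ γ, σ γ = a * ρ γ * a⁻¹
  iseqv :=
    { refl := fun (ρ : SurfaceGroup g n →* G) => ⟨1, fun γ => by simp⟩
      symm := by
        rintro ρ σ ⟨a, h⟩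
        exact ⟨a⁻¹, fun γ => by rw [h]; group⟩
      trans := by
        rintro ρ σ τ ⟨a, h⟩ ⟨b, k⟩
        exact ⟨b * a, fun γ => by rw [k, h]; group⟩ }

/-- The topological quotient of the homomorphism space by conjugation. -/
def OrbitSpace (g n : ℕ) (G : Type*) [Group G] : Type _ := Quotient (conjSetoid g n G)

instance (g n : ℕ) (G : Type*) [Group G] [TopologicalSpace G] :
    TopologicalSpace (OrbitSpace g n G) :=
  inferInstanceAs (TopologicalSpace (Quotient (conjSetoid g n G)))

/-- The projection to the topological quotient. -/
def toOrbit {g n : ℕ} {G : Type*} [Group G] (ρ : HomSpace g n G) : OrbitSpace g n G :=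
  Quotient.mk (conjSetoid g n G) ρ

/-! ### Angles -/

/-- The distance from `t` to the set of odd integers. -/
def oddDist (t : ℝ) : ℝ := Metric.infDist t {x | ∃ m : ℤ, x = 2 * m + 1}

/-- The number of integral entries. -/
def numIntegral {n : ℕ} (θ : Fin n → ℝ) : ℕ := Nat.card {i : Fin n // ∃ m : ℤ, θ i = m}

/-! ### The group `SU₂` -/

abbrev SU2 : Type := Matrix.specialUnitaryGroup (Fin 2) ℂ

/-- The matrices in `SU₂` with eigenvalues `exp (± i π δ)`. -/
def conjClassSU2 (δ : ℝ) : Set SU2 :=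
  {B | (B : Matrix (Fin 2) (Fin 2) ℂ).charpoly =
    (Polynomial.X - Polynomial.C (Complex.exp (Real.pi * δ * Complex.I))) *
      (Polynomial.X - Polynomial.C (Complex.exp (-(Real.pi * δ * Complex.I))))}

/-- The real polynomial functions in the real and imaginary parts of the entries of the matrices
associated to the generators. -/
def regularSU2 (g n : ℕ) : Subalgebra ℝ (HomSpace g n SU2 → ℝ) :=
  Algebra.adjoin ℝ
    ({f | ∃ (s : SurfaceGen g n) (i j : Fin 2), f = fun (ρ : SurfaceGroup g n →* SU2) =>
        ((ρ (gen s) : Matrix (Fin 2) (Fin 2) ℂ) i j).re} ∪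
      {f | ∃ (s : SurfaceGen g n) (i j : Fin 2), f = fun (ρ : SurfaceGroup g n →* SU2) =>
        ((ρ (gen s) : Matrix (Fin 2) (Fin 2) ℂ) i j).im})

/-- The relative homomorphism space. -/
def relHomSU2 (g : ℕ) {n : ℕ} (θ : Fin n → ℝ) : Set (HomSpace g n SU2) :=
  {ρ : SurfaceGroup g n →* SU2 | ∀ (i : Fin n) (γ : SurfaceGroup g n),
    IsConj (gen (SurfaceGen.beta i)) γ → ρ γ ∈ conjClassSU2 (oddDist (θ i))}

/-- The image is contained in a `1`-parameter subgroup `{exp (t X) | t ∈ ℝ}`, `X ∈ 𝔰𝔲₂`. -/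
def IsCoaxialSU2 {g n : ℕ} (ρ : SurfaceGroup g n →* SU2) : Prop :=
  ∃ X : Matrix (Fin 2) (Fin 2) ℂ, X.conjTranspose = -X ∧ X.trace = 0 ∧ X ≠ 0 ∧
    ∀ γ, ∃ t : ℝ, (ρ γ : Matrix (Fin 2) (Fin 2) ℂ) = NormedSpace.exp (t • X)

/-- The coaxial locus in the relative homomorphism space. -/
def coaxHomSU2 (g : ℕ) {n : ℕ} (θ : Fin n → ℝ) : Set (HomSpace g n SU2) :=
  {ρ | ρ ∈ relHomSU2 g θ ∧ IsCoaxialSU2 ρ}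

/-- The non-coaxial locus in the relative homomorphism space. -/
def noncoaxHomSU2 (g : ℕ) {n : ℕ} (θ : Fin n → ℝ) : Set (HomSpace g n SU2) :=
  {ρ | ρ ∈ relHomSU2 g θ ∧ ¬ IsCoaxialSU2 ρ}

/-- The representation space: the topological quotient by conjugation. -/
abbrev RepSU2 (g n : ℕ) : Type := OrbitSpace g n SU2

/-- The projection from the homomorphism space. -/
def projSU2 {g n : ℕ} (ρ : HomSpace g n SU2) : RepSU2 g n := toOrbit ρ

/-- The relative representation space. -/
def relRepSU2 (g : ℕ) {n : ℕ} (θ : Fin n → ℝ) : Set (RepSU2 g n) := projSU2 '' relHomSU2 g θ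

/-- The coaxial locus in the relative representation space. -/
def coaxRepSU2 (g : ℕ) {n : ℕ} (θ : Fin n → ℝ) : Set (RepSU2 g n) := projSU2 '' coaxHomSU2 g θ

/-- The non-coaxial locus in the relative representation space. -/
def noncoaxRepSU2 (g : ℕ) {n : ℕ} (θ : Fin n → ℝ) : Set (RepSU2 g n) :=
  relRepSU2 g θ \ coaxRepSU2 g θ

/-! ### The group `SL₂(ℂ)` -/

abbrev SL2C : Type := Matrix.SpecialLinearGroup (Fin 2) ℂ

/-- The complex polynomial functions in the entries of the matrices associated to the
generators. -/
def regularSL2 (g n : ℕ) : Subalgebra ℂ (HomSpace g n SL2C → ℂ) :=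
  Algebra.adjoin ℂ
    {f | ∃ (s : SurfaceGen g n) (i j : Fin 2), f = fun (ρ : SurfaceGroup g n →* SL2C) =>
      (ρ (gen s) : Matrix (Fin 2) (Fin 2) ℂ) i j}

/-- The relative homomorphism space: each `ρ(β_i)` is conjugate in `SL₂(ℂ)` to an element of the
conjugacy class in `SU₂`. -/
def relHomSL2 (g : ℕ) {n : ℕ} (θ : Fin n → ℝ) : Set (HomSpace g n SL2C) :=
  {ρ : SurfaceGroup g n →* SL2C | ∀ i : Fin n, ∃ B ∈ conjClassSU2 (oddDist (θ i)), ∃ a : SL2C,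
    (ρ (gen (SurfaceGen.beta i)) : Matrix (Fin 2) (Fin 2) ℂ) =
      (a : Matrix (Fin 2) (Fin 2) ℂ) * (B : Matrix (Fin 2) (Fin 2) ℂ) *
        ((a⁻¹ : SL2C) : Matrix (Fin 2) (Fin 2) ℂ)}

/-- The image in `PSL₂(ℂ)` is contained in a complex `1`-parameter subgroup
`{± exp (t X) | t ∈ ℂ}`, `X ∈ 𝔰𝔩₂(ℂ)`. -/
def IsCoaxialSL2 {g n : ℕ} (ρ : SurfaceGroup g n →* SL2C) : Prop :=
  ∃ X : Matrix (Fin 2) (Fin 2) ℂ, X.trace = 0 ∧ X ≠ 0 ∧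
    ∀ γ, ∃ t : ℂ, (ρ γ : Matrix (Fin 2) (Fin 2) ℂ) = NormedSpace.exp (t • X) ∨
      (ρ γ : Matrix (Fin 2) (Fin 2) ℂ) = -NormedSpace.exp (t • X)

/-- The coaxial locus in the relative homomorphism space. -/
def coaxHomSL2 (g : ℕ) {n : ℕ} (θ : Fin n → ℝ) : Set (HomSpace g n SL2C) :=
  {ρ | ρ ∈ relHomSL2 g θ ∧ IsCoaxialSL2 ρ}

/-- The non-coaxial locus in the relative homomorphism space. -/
def noncoaxHomSL2 (g : ℕ) {n : ℕ} (θ : Fin n → ℝ) : Set (HomSpace g n SL2C) :=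
  {ρ | ρ ∈ relHomSL2 g θ ∧ ¬ IsCoaxialSL2 ρ}

/-- The representation space: the largest Hausdorff quotient of the space of conjugacy classes. -/
abbrev RepSL2 (g n : ℕ) : Type := T2Quotient (OrbitSpace g n SL2C)

/-- The projection from the homomorphism space. -/
def projSL2 {g n : ℕ} (ρ : HomSpace g n SL2C) : RepSL2 g n := T2Quotient.mk (toOrbit ρ)

/-- The relative representation space. -/
def relRepSL2 (g : ℕ) {n : ℕ} (θ : Fin n → ℝ) : Set (RepSL2 g n) := projSL2 '' relHomSL2 g θ

/-- The coaxial locus in the relative representation space. -/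
def coaxRepSL2 (g : ℕ) {n : ℕ} (θ : Fin n → ℝ) : Set (RepSL2 g n) := projSL2 '' coaxHomSL2 g θ

/-- The non-coaxial locus in the relative representation space. A point of `RepSL2` is the class
of a unique closed orbit; the point lies in this locus if and only if that orbit is not coaxial. -/
def noncoaxRepSL2 (g : ℕ) {n : ℕ} (θ : Fin n → ℝ) : Set (RepSL2 g n) :=
  relRepSL2 g θ \ coaxRepSL2 g θ

/-- `∑ ± (θ_i - 1)` is an even integer for some choice of the signs. -/
def SignCondition {n : ℕ} (θ : Fin n → ℝ) : Prop :=
  ∃ ε : Fin n → ℤˣ, ∃ m : ℤ, ∑ i, ((ε i : ℤ) : ℝ) * (θ i - 1) = 2 * m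

end SurfaceRep

end

open scoped Manifold ContDiff Polynomial
noncomputable section
set_option linter.unusedSectionVars false
namespace SurfaceRep

/-! ### Krull dimension -/

section KrullDim

/-! Both groups are treated at once. `SU2` and `SL2C` are the groups of elements of reduced norm one
in the quaternion algebra over `ℝ` and over `ℂ` (`QuatModel`), so a homomorphism is a tuple of
quaternions with prescribed norms and half traces (or prescribed central values, when the angle is
integral) on which the relator takes the value one. Coaxial means that the entries commute:
commuting elements share an axis, a nonzero pure quaternion which can be taken of norm one or
isotropic, and they lie in the torus or, up to sign, in the unipotent group of that axis.

Non-coaxial homomorphisms. A linear functional that kills the image of the differential of the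
relator corresponds, through the trace form, to a pure quaternion commuting with all generators
(`comm_of_re_mul_fderiv`). If it is nonzero, the tuple is commutative. So the equations are regular
at every non-coaxial point, and the dimension is `4(2g+n)` minus the number `2g+2n+2k+3` of
equations.

Non-coaxial representations. They are the classes of irreducible tuples, those generating the
quaternion algebra. Over `ℝ` non-commuting already implies irreducible. Over `ℂ` a reducible tuple
is triangular, and conjugation by a diagonal one-parameter family contracts it to a commuting one,
so the two have the same image in a Hausdorff quotient
(`QuatModel.exists_isAbelian_of_not_isIrred`). A first order deformation of an irreducible tuple
that preserves all traces defines a derivation of the quaternion algebra. Derivations are inner, so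
the deformation is tangent to the orbit (`IsIrred.exists_pure`). Hence traces provide local
coordinates transverse to the three-dimensional orbits, and slices give charts
(`LocalQuotient.exists_chart`). Complex charts are oriented. Over `ℝ` the sign of a Jacobian
determinant orients the charts; it is well defined because orbits are connected
(`LocalQuotient.isOrientedManifold_real`).

Coaxial loci. A homomorphism to a torus is given by an axis, `2g` angles, and signs for the
rotations at the `β_i` whose signed angles sum to a full number of turns; this gives the criterion
for non-emptiness. Unipotent cases are limits of these. Thus the locus is covered by the Zariski
closures of finitely many images of angle spaces. Pulled back to angles, regular functions become
trigonometric polynomials. These form a domain, integral over the polynomial ring in the cosines, so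
the Krull dimension counts angles: `2g`, and two more for the axis if some value is not central. In
the quotient the axis can be moved to a standard one, and `2g` remains. -/

/-- Incomparability bounds the dimension of `S` from above; lying over and going up bound it from
below. -/
theorem ringKrullDim_eq_of_isIntegral {R S : Type*} [CommRing R] [CommRing S] [Algebra R S]
    [Algebra.IsIntegral R S] (hinj : Function.Injective (algebraMap R S)) :
    ringKrullDim S = ringKrullDim R := by
  apply le_antisymm
  · refine Order.krullDim_le_of_strictMono (PrimeSpectrum.comap (algebraMap R S)) ?_
    intro p q hpq
    exact Ideal.IsIntegral.comap_lt_comap (R := R) (I := p.asIdeal) (J := q.asIdeal) hpq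
  -- A prime of `S` over the bottom of a chain exists by injectivity; going up lifts the rest of the
  -- chain above it.
  · refine iSup_le fun l => ?_
    obtain ⟨P, -, hP, hPl⟩ := Ideal.exists_ideal_over_prime_of_isIntegral
      (S := S) (l.head.asIdeal) (⊥ : Ideal S)
      (by rw [← RingHom.ker_eq_comap_bot, (RingHom.injective_iff_ker_eq_bot _).1 hinj]
          exact bot_le)
    have : P.LiesOver l.head.asIdeal := ⟨hPl.symm⟩
    obtain ⟨L, hL, -, -⟩ := Ideal.exists_ltSeries_of_hasGoingUp (S := S) l P
    rw [← hL]
    exact le_iSup (fun p : LTSeries (PrimeSpectrum S) => (p.length : WithBot ℕ∞)) L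

theorem ringKrullDim_eq_card_of_isIntegral {K R : Type*} [Field K] [CommRing R] {N : ℕ}
    (g : MvPolynomial (Fin N) K →+* R) (hinj : Function.Injective g) (hint : g.IsIntegral) :
    ringKrullDim R = (N : WithBot ℕ∞) := by
  let := g.toAlgebra
  have : Algebra.IsIntegral (MvPolynomial (Fin N) K) R := ⟨hint⟩
  rw [ringKrullDim_eq_of_isIntegral (R := MvPolynomial (Fin N) K) hinj,
    MvPolynomial.ringKrullDim_of_isNoetherianRing]
  simp

variable {K : Type*} [Field K] {T : Type*} [CommRing T] [IsDomain T] [Algebra K T]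

/-- The dimension of a finitely generated subalgebra `A` of a domain `T` algebraic over `A`. -/
theorem ringKrullDim_eq_of_fg {N : ℕ} {c : Fin N → T} (hc : IsTranscendenceBasis K c)
    (A : Subalgebra K T) (hA : A.FG) (halg : ∀ t : T, IsAlgebraic A t) :
    ringKrullDim A = (N : WithBot ℕ∞) := by
  have : Algebra.FiniteType K A := A.fg_iff_finiteType.1 hA
  -- Noether normalisation of `A`. The normalising variables form a second transcendence basis of
  -- `T`, so their number is `N`.
  obtain ⟨s, g, hinj, hint⟩ := exists_integral_inj_algHom_of_fg K A
  have hdim := ringKrullDim_eq_card_of_isIntegral (N := s) (g : MvPolynomial (Fin s) K →+* A)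
    hinj hint
  let y : Fin s → T := fun i => (g (MvPolynomial.X i) : T)
  have hy : MvPolynomial.aeval y = A.val.comp g := by
    ext i; simp [y]
  have hind : AlgebraicIndependent K y := by
    rw [AlgebraicIndependent, hy]
    exact Subtype.val_injective.comp hinj
  have hbas : IsTranscendenceBasis K y := by
    rw [hind.isTranscendenceBasis_iff_isAlgebraic]
    let := (g : MvPolynomial (Fin s) K →+* A).toAlgebra
    have : Algebra.IsIntegral (MvPolynomial (Fin s) K) A := ⟨hint⟩
    let : Algebra (MvPolynomial (Fin s) K) T :=
      ((A.val.comp g : MvPolynomial (Fin s) K →ₐ[K] T) : MvPolynomial (Fin s) K →+* T).toAlgebra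
    have : IsScalarTower (MvPolynomial (Fin s) K) A T := IsScalarTower.of_algebraMap_eq fun _ => rfl
    have : Algebra.IsAlgebraic A T := ⟨halg⟩
    have : Algebra.IsAlgebraic (MvPolynomial (Fin s) K) T :=
      Algebra.IsAlgebraic.trans _ A _
    refine ⟨fun t => ?_⟩
    obtain ⟨p, hp0, hp⟩ := Algebra.IsAlgebraic.isAlgebraic (R := MvPolynomial (Fin s) K) t
    have hmem : ∀ q : MvPolynomial (Fin s) K, ((g q : A) : T) ∈ Algebra.adjoin K (Set.range y) := by
      intro q
      rw [Algebra.adjoin_range_eq_range_aeval, hy]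
      exact ⟨q, rfl⟩
    -- The algebraic equation has coefficients in the polynomial ring; `φ` moves them to the
    -- subalgebra generated by `y`.
    let φ : MvPolynomial (Fin s) K →+* Algebra.adjoin K (Set.range y) :=
      ((A.val.comp g : MvPolynomial (Fin s) K →ₐ[K] T) :
        MvPolynomial (Fin s) K →+* T).codRestrict _ hmem
    refine ⟨p.map φ, ?_, ?_⟩
    · rw [Ne, Polynomial.map_eq_zero_iff]
      · exact hp0
      · intro a b hab
        exact hinj (Subtype.ext (congrArg (fun z : Algebra.adjoin K (Set.range y) => (z : T)) hab))
    · rw [Polynomial.aeval_def, Polynomial.eval₂_map]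
      exact hp
  have h1 := hc.lift_cardinalMk_eq_trdeg
  have h2 := hbas.lift_cardinalMk_eq_trdeg
  rw [← h2] at h1
  have : N = s := by simpa using h1
  rw [hdim, this]

variable {N : ℕ} {c s : Fin N → T}

/-- Each `s i` is a square root of `1 - c i ^ 2`, hence integral over the subalgebra generated by
the `c i`. -/
theorem isIntegral_adjoin_of_sq_add_sq (hcs : ∀ i, c i ^ 2 + s i ^ 2 = 1)
    (htop : Algebra.adjoin K (Set.range c ∪ Set.range s) = ⊤) (t : T) :
    IsIntegral (Algebra.adjoin K (Set.range c)) t := by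
  have hmem : ∀ i, c i ∈ Algebra.adjoin K (Set.range c) := fun i =>
    Algebra.subset_adjoin ⟨i, rfl⟩
  have hle : Algebra.adjoin K (Set.range c ∪ Set.range s) ≤
      (integralClosure (Algebra.adjoin K (Set.range c)) T).restrictScalars K := by
    rw [Algebra.adjoin_le_iff]
    rintro _ (⟨i, rfl⟩ | ⟨i, rfl⟩)
    · exact isIntegral_algebraMap (x := (⟨c i, hmem i⟩ : Algebra.adjoin K (Set.range c)))
    · refine IsIntegral.of_pow (n := 2) two_pos ?_
      rw [show s i ^ 2 = 1 - c i ^ 2 by rw [← hcs i]; ring]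
      exact isIntegral_one.sub
        ((isIntegral_algebraMap (x := (⟨c i, hmem i⟩ : Algebra.adjoin K (Set.range c)))).pow 2)
  rw [htop] at hle
  exact hle (Algebra.mem_top (R := K))

theorem isTranscendenceBasis_of_sq_add_sq (hind : AlgebraicIndependent K c)
    (hcs : ∀ i, c i ^ 2 + s i ^ 2 = 1)
    (htop : Algebra.adjoin K (Set.range c ∪ Set.range s) = ⊤) : IsTranscendenceBasis K c := by
  rw [hind.isTranscendenceBasis_iff_isAlgebraic]
  exact ⟨fun t => (isIntegral_adjoin_of_sq_add_sq hcs htop t).isAlgebraic⟩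

/-- Here `A` lies between `K[c]` and a ring integral over `K[c]`, so it is integral over a
polynomial ring. No finite generation of `A` is needed, which matters for algebras of invariants. -/
theorem ringKrullDim_eq_of_cos_mem (hind : AlgebraicIndependent K c)
    (hcs : ∀ i, c i ^ 2 + s i ^ 2 = 1)
    (htop : Algebra.adjoin K (Set.range c ∪ Set.range s) = ⊤)
    (A : Subalgebra K T) (hA : ∀ i, c i ∈ A) : ringKrullDim A = (N : WithBot ℕ∞) := by
  let x : Fin N → A := fun i => ⟨c i, hA i⟩
  have hx : A.val.comp (MvPolynomial.aeval x) = MvPolynomial.aeval c := by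
    ext i; simp [x]
  refine ringKrullDim_eq_card_of_isIntegral
    (g := ((MvPolynomial.aeval x : MvPolynomial (Fin N) K →ₐ[K] A) : MvPolynomial (Fin N) K →+* A))
    ?_ ?_
  · intro a b hab
    apply hind
    rw [← hx]
    exact congrArg Subtype.val hab
  · intro a
    have hle : Algebra.adjoin K (Set.range c) ≤ A := by
      rw [Algebra.adjoin_le_iff]; rintro _ ⟨i, rfl⟩; exact hA i
    obtain ⟨p, hp, hpa⟩ := isIntegral_adjoin_of_sq_add_sq hcs htop (a : T)
    have hsurj : Function.Surjective (AlgHom.codRestrict (MvPolynomial.aeval c)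
        (Algebra.adjoin K (Set.range c)) (fun q => by
          rw [Algebra.adjoin_range_eq_range_aeval]; exact ⟨q, rfl⟩)) := by
      rintro ⟨b, hb⟩
      rw [Algebra.adjoin_range_eq_range_aeval] at hb
      obtain ⟨q, hq⟩ := hb
      exact ⟨q, Subtype.ext hq⟩
    -- The monic equation over `K[c]` lifts to a monic one over the polynomial ring that maps onto
    -- it.
    obtain ⟨P, hP, -, hPm⟩ := Polynomial.lifts_and_degree_eq_and_monic
      (f := ((AlgHom.codRestrict (MvPolynomial.aeval c)
        (Algebra.adjoin K (Set.range c)) (fun q => by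
          rw [Algebra.adjoin_range_eq_range_aeval]; exact ⟨q, rfl⟩) :
            MvPolynomial (Fin N) K →ₐ[K] Algebra.adjoin K (Set.range c)) :
            MvPolynomial (Fin N) K →+* Algebra.adjoin K (Set.range c)))
      ((Polynomial.mem_lifts _).2 (Polynomial.map_surjective _ hsurj p)) hp
    refine ⟨P, hPm, ?_⟩
    apply Subtype.val_injective
    change A.val _ = _
    rw [← hP, Polynomial.eval₂_map] at hpa
    rw [Polynomial.eval₂_eq_sum_range] at hpa ⊢
    simp only [map_sum, map_mul, map_pow]
    refine Eq.trans ?_ hpa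
    refine Finset.sum_congr rfl fun i _ => ?_
    congr 1
    exact DFunLike.congr_fun hx _

end KrullDim

/-! ### Irreducible components -/

section PureDim

variable {K : Type*} [Field K] {X : Type*}

theorem isClosed_zariski_zeros (A : Subalgebra K (X → K)) {f : X → K} (hf : f ∈ A) :
    @IsClosed X (zariski A) {x | f x = 0} := by
  let := zariski A
  rw [← isOpen_compl_iff]
  exact TopologicalSpace.isOpen_generateFrom_of_mem ⟨f, hf, rfl⟩

/-- Products of regular functions are regular, so the non-vanishing sets are stable under
intersection and form a basis; closures are therefore common zero sets. -/
theorem mem_closure_zariski_iff (A : Subalgebra K (X → K)) (Z : Set X) (x : X) :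
    x ∈ @closure X (zariski A) Z ↔ ∀ f ∈ A, (∀ z ∈ Z, f z = 0) → f x = 0 := by
  let := zariski A
  constructor
  · intro hx f hf hZ
    exact closure_minimal (t := {x | f x = 0}) hZ (isClosed_zariski_zeros A hf) hx
  · intro h
    have hbasis : TopologicalSpace.IsTopologicalBasis
        {U : Set X | ∃ f ∈ A, U = {x | f x ≠ 0}} := by
      refine ⟨?_, ?_, rfl⟩
      · rintro _ ⟨f, hf, rfl⟩ _ ⟨g, hg, rfl⟩ x hx
        refine ⟨_, ⟨f * g, A.mul_mem hf hg, rfl⟩, mul_ne_zero hx.1 hx.2, ?_⟩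
        intro y hy
        exact ⟨left_ne_zero_of_mul hy, right_ne_zero_of_mul hy⟩
      · refine Set.eq_univ_of_forall fun x => ?_
        exact ⟨_, ⟨1, A.one_mem, rfl⟩, one_ne_zero⟩
    rw [hbasis.mem_closure_iff]
    rintro _ ⟨f, hf, rfl⟩ hx
    by_contra hne
    refine hx (h f hf fun z hz => ?_)
    by_contra hfz
    exact hne ⟨z, hfz, hz⟩

/-- The hypothesis says that the vanishing ideal of `Z` is prime: two disjoint nonempty open subsets
of `Z` would contain the non-vanishing sets of two functions with product zero on `Z`. -/
theorem isIrreducible_zariski (A : Subalgebra K (X → K)) {Z : Set X} (hne : Z.Nonempty)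
    (h : ∀ f ∈ A, ∀ g ∈ A, (∀ z ∈ Z, f z * g z = 0) → (∀ z ∈ Z, f z = 0) ∨ ∀ z ∈ Z, g z = 0) :
    @IsIrreducible X (zariski A) Z := by
  let := zariski A
  refine ⟨hne, ?_⟩
  have key : ∀ U : Set X, IsOpen U → ∀ x ∈ Z, x ∈ U → ∃ f ∈ A, f x ≠ 0 ∧ ∀ y ∈ Z, f y ≠ 0 → y ∈ U := by
    intro U hU x hxZ hx
    have : x ∉ closure Uᶜ := by
      rw [hU.isClosed_compl.closure_eq]; exact fun h => h hx
    rw [mem_closure_zariski_iff] at this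
    push Not at this
    obtain ⟨f, hf, hfU, hfx⟩ := this
    refine ⟨f, hf, hfx, fun y _ hy => ?_⟩
    by_contra hyU
    exact hy (hfU y hyU)
  rintro U V hU hV ⟨x, hxZ, hxU⟩ ⟨y, hyZ, hyV⟩
  obtain ⟨f, hf, hfx, hfU⟩ := key U hU x hxZ hxU
  obtain ⟨g, hg, hgy, hgV⟩ := key V hV y hyZ hyV
  by_contra hcon
  rcases h f hf g hg (fun z hz => by
    by_contra hfg
    exact hcon ⟨z, hz, hfU z hz (left_ne_zero_of_mul hfg),
      hgV z hz (right_ne_zero_of_mul hfg)⟩) with h1 | h1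
  · exact hfx (h1 x hxZ)
  · exact hgy (h1 y hyZ)

/-- Both images are the quotient of `A` by the same ideal. This replaces the coordinate ring of a
component by the algebra of pull-backs along a parametrization. -/
theorem ringKrullDim_map_eq_of_ker_eq {B C D : Type*} [CommRing B] [CommRing C] [CommRing D]
    [Algebra K B] [Algebra K C] [Algebra K D] (A : Subalgebra K B) (φ : B →ₐ[K] C)
    (ψ : B →ₐ[K] D) (h : ∀ a ∈ A, φ a = 0 ↔ ψ a = 0) :
    ringKrullDim (A.map φ) = ringKrullDim (A.map ψ) := by
  let φ' : A →+* A.map φ := (φ : B →+* C).restrict A (A.map φ) fun a ha => ⟨a, ha, rfl⟩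
  let ψ' : A →+* A.map ψ := (ψ : B →+* D).restrict A (A.map ψ) fun a ha => ⟨a, ha, rfl⟩
  have hφ : Function.Surjective φ' := by
    rintro ⟨_, a, ha, rfl⟩; exact ⟨⟨a, ha⟩, rfl⟩
  have hψ : Function.Surjective ψ' := by
    rintro ⟨_, a, ha, rfl⟩; exact ⟨⟨a, ha⟩, rfl⟩
  have hker : RingHom.ker φ' = RingHom.ker ψ' := by
    ext ⟨a, ha⟩
    rw [RingHom.mem_ker, RingHom.mem_ker]
    exact ⟨fun h0 => Subtype.ext ((h a ha).1 (congrArg Subtype.val h0)),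
      fun h0 => Subtype.ext ((h a ha).2 (congrArg Subtype.val h0))⟩
  exact ringKrullDim_eq_of_ringEquiv
    ((RingHom.quotientKerEquivOfSurjective hφ).symm.trans
      ((Ideal.quotEquivOfEq hker).trans (RingHom.quotientKerEquivOfSurjective hψ)))

/-- A set covered by the Zariski closures of finitely many irreducible sets given by
parametrizations, all of the same dimension, has pure dimension. -/
theorem hasPureDim_of_cover (A : Subalgebra K (X → K)) (d : ℕ) {J : Type*} [Finite J]
    {M : Type*} [Nonempty M] (Φ : J → M → X)
    (hirr : ∀ j, ∀ f ∈ A, ∀ g ∈ A, (∀ m, f (Φ j m) * g (Φ j m) = 0) →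
      (∀ m, f (Φ j m) = 0) ∨ ∀ m, g (Φ j m) = 0)
    (hcover : ∀ x, ∃ j, ∀ f ∈ A, (∀ m, f (Φ j m) = 0) → f x = 0)
    (hdim : ∀ j, ringKrullDim (A.map (pullback K (Φ j))) = (d : WithBot ℕ∞)) :
    HasPureDim A d := by
  let := zariski A
  intro C hC
  have hC' : Maximal IsIrreducible C := hC
  have hirr' : ∀ j, IsIrreducible (closure (Set.range (Φ j))) := fun j => by
    refine (isIrreducible_zariski A (Set.range_nonempty _) ?_).closure
    simpa only [Set.forall_mem_range] using hirr j
  have hsub : C ⊆ ⋃₀ (Set.range fun j => closure (Set.range (Φ j))) := by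
    intro x _
    obtain ⟨j, hj⟩ := hcover x
    refine ⟨_, ⟨j, rfl⟩, ?_⟩
    change x ∈ closure _
    rw [mem_closure_zariski_iff]
    simpa only [Set.forall_mem_range] using hj
  obtain ⟨_, hz, hCz⟩ := (isIrreducible_iff_sUnion_isClosed.1 hC'.1)
    (Set.finite_range fun j => closure (Set.range (Φ j))).toFinset
    (by simp) (by simpa using hsub)
  simp only [Set.Finite.mem_toFinset, Set.mem_range] at hz
  obtain ⟨j, rfl⟩ := hz
  -- Components are maximal irreducible sets, so a component contained in one of the closures equals
  -- it.
  have hCe : C = closure (Set.range (Φ j)) := hC'.eq_of_subset (hirr' j) hCz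
  rw [← hdim j]
  refine ringKrullDim_map_eq_of_ker_eq A _ _ fun f hf => ?_
  constructor
  · intro h0
    funext m
    exact congrFun h0 ⟨Φ j m, by rw [hCe]; exact subset_closure ⟨m, rfl⟩⟩
  · intro h0
    funext ⟨x, hx⟩
    rw [hCe] at hx
    refine (mem_closure_zariski_iff A _ x).1 hx f hf ?_
    rintro _ ⟨m, rfl⟩
    exact congrFun h0 m

end PureDim

/-! ### Trigonometric polynomials -/

section Trig

/-- A pair of entire functions with the properties of the cosine and the sine that are needed to
parametrize the circle `x ^ 2 + y ^ 2 = 1` over `K`. -/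
structure CircleParam (K : Type*) [RCLike K] where
  cos : K → K
  sin : K → K
  analytic_cos : AnalyticOnNhd K cos Set.univ
  analytic_sin : AnalyticOnNhd K sin Set.univ
  cos_sq_add_sin_sq : ∀ t, cos t ^ 2 + sin t ^ 2 = 1
  surj : ∀ x y : K, x ^ 2 + y ^ 2 = 1 → ∃ t, cos t = x ∧ sin t = y
  infinite_range : (Set.range cos).Infinite

variable {K : Type*} [RCLike K] (P : CircleParam K) {τ : Type*}

/-- The trigonometric polynomials. -/
def trigPoly (τ : Type*) : Subalgebra K ((τ → K) → K) :=
  Algebra.adjoin K ((Set.range fun i t => P.cos (t i)) ∪ Set.range fun i t => P.sin (t i))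

theorem cos_mem_trigPoly (i : τ) : (fun t : τ → K => P.cos (t i)) ∈ trigPoly P τ :=
  Algebra.subset_adjoin (Or.inl ⟨i, rfl⟩)

theorem sin_mem_trigPoly (i : τ) : (fun t : τ → K => P.sin (t i)) ∈ trigPoly P τ :=
  Algebra.subset_adjoin (Or.inr ⟨i, rfl⟩)

/-- If the sine vanished identically, the cosine would only take the values `1` and `-1`, against
`infinite_range`. -/
theorem CircleParam.exists_sin_ne_zero : ∃ t, P.sin t ≠ 0 := by
  by_contra! h
  refine P.infinite_range (((Set.finite_singleton (-1 : K)).insert 1).subset ?_)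
  rintro _ ⟨t, rfl⟩
  have := P.cos_sq_add_sin_sq t
  rw [h t] at this
  have h2 : (P.cos t - 1) * (P.cos t + 1) = 0 := by linear_combination this
  rcases mul_eq_zero.1 h2 with h | h
  · left; linear_combination h
  · right; change _ = _; linear_combination h

variable [Fintype τ]

theorem analytic_of_mem_trigPoly {f : (τ → K) → K} (hf : f ∈ trigPoly P τ) :
    AnalyticOnNhd K f Set.univ := by
  refine Algebra.adjoin_induction ?_ ?_ ?_ ?_ hf
  · rintro _ (⟨i, rfl⟩ | ⟨i, rfl⟩) t _
    · exact AnalyticAt.comp (g := P.cos) (f := ContinuousLinearMap.proj (R := K) (φ := fun _ : τ => K) i)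
        (P.analytic_cos _ trivial) (ContinuousLinearMap.analyticAt _ t)
    · exact AnalyticAt.comp (g := P.sin) (f := ContinuousLinearMap.proj (R := K) (φ := fun _ : τ => K) i)
        (P.analytic_sin _ trivial) (ContinuousLinearMap.analyticAt _ t)
  · intro r t _
    exact analyticAt_const (v := r)
  · exact fun _ _ _ _ h1 h2 => h1.add h2
  · exact fun _ _ _ _ h1 h2 => h1.mul h2

/-- Where `f` does not vanish, it does not vanish nearby, so `g` is zero on an open set and then
everywhere by the identity theorem. -/
theorem eq_zero_or_eq_zero_of_analytic {E : Type*} [NormedAddCommGroup E] [NormedSpace K E]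
    {f g : E → K} (hf : AnalyticOnNhd K f Set.univ)
    (hg : AnalyticOnNhd K g Set.univ) (h : ∀ t, f t * g t = 0) :
    (∀ t, f t = 0) ∨ ∀ t, g t = 0 := by
  by_contra! hcon
  obtain ⟨⟨a, ha⟩, b, hb⟩ := hcon
  have h0 : g =ᶠ[nhds a] fun _ => 0 := by
    filter_upwards [(hf a trivial).continuousAt.eventually_ne ha] with t ht
    exact (mul_eq_zero.1 (h t)).resolve_left ht
  let _ : NormedSpace ℝ E := NormedSpace.restrictScalars ℝ K E
  exact hb (hg.eqOn_of_preconnected_of_eventuallyEq (fun _ _ => analyticAt_const)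
    isPreconnected_univ (Set.mem_univ a) h0 (Set.mem_univ b))

theorem trigPoly_eq_zero_or {f g : (τ → K) → K} (hf : f ∈ trigPoly P τ)
    (hg : g ∈ trigPoly P τ) (h : ∀ t, f t * g t = 0) : (∀ t, f t = 0) ∨ ∀ t, g t = 0 :=
  eq_zero_or_eq_zero_of_analytic (analytic_of_mem_trigPoly P hf) (analytic_of_mem_trigPoly P hg) h

instance : IsDomain (trigPoly P τ) := by
  have : NoZeroDivisors (trigPoly P τ) := ⟨fun {a b} h => by
    rcases trigPoly_eq_zero_or P a.2 b.2 (fun t => congrFun (congrArg Subtype.val h) t) with h | h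
    · exact Or.inl (Subtype.ext (funext h))
    · exact Or.inr (Subtype.ext (funext h))⟩
  exact NoZeroDivisors.to_isDomain _

/-- The angles are independent, so the cosines fill a product of infinite sets; a polynomial is
determined by its values there. -/
theorem algebraicIndependent_cos :
    AlgebraicIndependent K (fun i : τ => (⟨_, cos_mem_trigPoly P i⟩ : trigPoly P τ)) := by
  rw [algebraicIndependent_iff_injective_aeval]
  intro p q hpq
  refine MvPolynomial.funext_set (fun _ => Set.range P.cos) (fun _ => P.infinite_range) ?_
  intro x hx
  choose t ht using fun i => hx i (Set.mem_univ i)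
  have key : ∀ p : MvPolynomial τ K, ((MvPolynomial.aeval
      (fun i : τ => (⟨_, cos_mem_trigPoly P i⟩ : trigPoly P τ)) p : trigPoly P τ) :
        (τ → K) → K) t = MvPolynomial.eval x p := by
    intro p
    have : ((Pi.evalAlgHom K (fun _ : τ → K => K) t).comp (trigPoly P τ).val).comp
        (MvPolynomial.aeval (fun i : τ => (⟨_, cos_mem_trigPoly P i⟩ : trigPoly P τ))) =
        MvPolynomial.aeval x := by
      ext i
      simp [ht]
    rw [← MvPolynomial.aeval_eq_eval]
    exact DFunLike.congr_fun this p
  rw [← key, ← key, hpq]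

theorem adjoin_cos_sin_eq_top :
    Algebra.adjoin K ((Set.range fun i : τ => (⟨_, cos_mem_trigPoly P i⟩ : trigPoly P τ)) ∪
      Set.range fun i : τ => (⟨_, sin_mem_trigPoly P i⟩ : trigPoly P τ)) = ⊤ := by
  apply Subalgebra.map_injective (f := (trigPoly P τ).val) Subtype.val_injective
  rw [AlgHom.map_adjoin, Algebra.map_top, Subalgebra.range_val, Set.image_union,
    ← Set.range_comp, ← Set.range_comp]
  rfl

/-- `f` is algebraic over the subalgebra `A`. -/
def AlgOver (A : Subalgebra K ((τ → K) → K)) (f : (τ → K) → K) : Prop :=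
  ∃ hf : f ∈ trigPoly P τ, IsAlgebraic (A.comap (trigPoly P τ).val) (⟨f, hf⟩ : trigPoly P τ)

variable {P} {A : Subalgebra K ((τ → K) → K)} {f g : (τ → K) → K}

theorem AlgOver.of_mem (hA : A ≤ trigPoly P τ) (hf : f ∈ A) : AlgOver P A f :=
  ⟨hA hf, isAlgebraic_algebraMap (⟨⟨f, hA hf⟩, hf⟩ : A.comap (trigPoly P τ).val)⟩

/-- Division in a domain. It is used to strip a sine from a coordinate of an element of a torus and
so recover a coordinate of the axis. -/
theorem AlgOver.of_mul (hf : AlgOver P A f) (hf0 : ∃ t, f t ≠ 0) (hg : g ∈ trigPoly P τ)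
    (h : AlgOver P A (f * g)) : AlgOver P A g := by
  obtain ⟨hfT, hf⟩ := hf
  obtain ⟨_, h⟩ := h
  refine ⟨hg, IsAlgebraic.of_mul (y := (⟨f, hfT⟩ : trigPoly P τ)) ?_ hf h⟩
  rw [mem_nonZeroDivisors_iff_ne_zero]
  intro h0
  obtain ⟨t, ht⟩ := hf0
  exact ht (congrFun (congrArg Subtype.val h0) t)

theorem AlgOver.sin_of_cos {i : τ} (h : AlgOver P A fun t => P.cos (t i)) :
    AlgOver P A fun t => P.sin (t i) := by
  obtain ⟨hT, h⟩ := h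
  refine ⟨sin_mem_trigPoly P i, IsAlgebraic.of_pow (n := 2) two_pos ?_⟩
  have : (⟨_, sin_mem_trigPoly P i⟩ : trigPoly P τ) ^ 2 = 1 - ⟨_, hT⟩ ^ 2 := by
    apply Subtype.ext
    funext t
    change P.sin (t i) ^ 2 = 1 - P.cos (t i) ^ 2
    rw [← P.cos_sq_add_sin_sq (t i)]; ring
  rw [this]
  exact isAlgebraic_one.sub (h.pow 2)

/-- The restriction of a subalgebra to the trigonometric polynomials does not change it. -/
theorem ringKrullDim_comap_trigPoly (hA : A ≤ trigPoly P τ) :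
    ringKrullDim (A.comap (trigPoly P τ).val) = ringKrullDim A := by
  refine ringKrullDim_eq_of_ringEquiv
    { toFun := fun a => ⟨a.1.1, a.2⟩
      invFun := fun a => ⟨⟨a.1, hA a.2⟩, a.2⟩
      left_inv := fun _ => rfl
      right_inv := fun _ => rfl
      map_mul' := fun _ _ => rfl
      map_add' := fun _ _ => rfl }

theorem ringKrullDim_eq_card_of_cos_mem (hA : A ≤ trigPoly P τ)
    (h : ∀ i, (fun t : τ → K => P.cos (t i)) ∈ A) :
    ringKrullDim A = (Fintype.card τ : WithBot ℕ∞) := by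
  rw [← ringKrullDim_comap_trigPoly hA]
  let e := (Fintype.equivFin τ).symm
  refine ringKrullDim_eq_of_cos_mem
    (c := (fun i : τ => (⟨_, cos_mem_trigPoly P i⟩ : trigPoly P τ)) ∘ e)
    (s := (fun i : τ => (⟨_, sin_mem_trigPoly P i⟩ : trigPoly P τ)) ∘ e)
    ((algebraicIndependent_cos P).comp _ e.injective)
    (fun i => Subtype.ext (funext fun t => P.cos_sq_add_sin_sq _)) ?_ _ (fun i => h (e i))
  rw [e.surjective.range_comp, e.surjective.range_comp]
  exact adjoin_cos_sin_eq_top P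

/-- The cosines need not belong to `A`; it suffices that they are algebraic over it, since then all
trigonometric polynomials are. The price is finite generation. -/
theorem ringKrullDim_eq_card_of_algOver (hA : A ≤ trigPoly P τ) (hfg : A.FG)
    (h : ∀ i, AlgOver P A (fun t : τ → K => P.cos (t i))) :
    ringKrullDim A = (Fintype.card τ : WithBot ℕ∞) := by
  rw [← ringKrullDim_comap_trigPoly hA]
  let e := (Fintype.equivFin τ).symm
  have hb : IsTranscendenceBasis K
      ((fun i : τ => (⟨_, cos_mem_trigPoly P i⟩ : trigPoly P τ)) ∘ e) := by
    refine isTranscendenceBasis_of_sq_add_sq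
      (s := (fun i : τ => (⟨_, sin_mem_trigPoly P i⟩ : trigPoly P τ)) ∘ e)
      ((algebraicIndependent_cos P).comp _ e.injective)
      (fun i => Subtype.ext (funext fun t => P.cos_sq_add_sin_sq _)) ?_
    rw [e.surjective.range_comp, e.surjective.range_comp]
    exact adjoin_cos_sin_eq_top P
  refine ringKrullDim_eq_of_fg hb _ ?_ ?_
  · refine Subalgebra.fg_of_fg_map _ (trigPoly P τ).val Subtype.val_injective ?_
    rw [Subalgebra.map_comap_eq, Subalgebra.range_val]
    rwa [inf_eq_left.2 hA]
  · intro t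
    have ht : t ∈ Algebra.adjoin K
        ((Set.range fun i : τ => (⟨_, cos_mem_trigPoly P i⟩ : trigPoly P τ)) ∪
          Set.range fun i : τ => (⟨_, sin_mem_trigPoly P i⟩ : trigPoly P τ)) := by
      rw [adjoin_cos_sin_eq_top]; trivial
    refine Algebra.adjoin_induction ?_ ?_ ?_ ?_ ht
    · rintro _ (⟨i, rfl⟩ | ⟨i, rfl⟩)
      · exact (h i).2
      · exact (h i).sin_of_cos.2
    · intro r
      exact isAlgebraic_algebraMap (algebraMap K (A.comap (trigPoly P τ).val) r)
    · exact fun _ _ _ _ => IsAlgebraic.add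
    · exact fun _ _ _ _ => IsAlgebraic.mul

/-- The real cosine and sine. -/
def realCircleParam : CircleParam ℝ where
  cos := Real.cos
  sin := Real.sin
  analytic_cos := fun _ _ => Real.analyticAt_cos
  analytic_sin := fun _ _ => Real.analyticAt_sin
  cos_sq_add_sin_sq := Real.cos_sq_add_sin_sq
  surj := fun x y h => by
    have hn : ‖(⟨x, y⟩ : ℂ)‖ = 1 := by
      rw [Complex.norm_def, Complex.normSq_mk, show x * x + y * y = 1 by linear_combination h,
        Real.sqrt_one]
    refine ⟨Complex.arg ⟨x, y⟩, ?_, ?_⟩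
    · have := Complex.norm_mul_cos_arg ⟨x, y⟩
      rw [hn] at this
      simpa using this
    · have := Complex.norm_mul_sin_arg ⟨x, y⟩
      rw [hn] at this
      simpa using this
  infinite_range := by
    rw [Real.range_cos]
    exact Set.Icc_infinite (by norm_num)

/-- The complex cosine and sine. -/
def complexCircleParam : CircleParam ℂ where
  cos := Complex.cos
  sin := Complex.sin
  analytic_cos := fun _ _ => Complex.analyticAt_cos
  analytic_sin := fun _ _ => Complex.analyticAt_sin
  cos_sq_add_sin_sq := Complex.cos_sq_add_sin_sq
  surj := fun x y h => by
    have h1 : (x + y * Complex.I) * (x - y * Complex.I) = 1 := by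
      linear_combination h - y ^ 2 * Complex.I_sq
    have h0 : x + y * Complex.I ≠ 0 := left_ne_zero_of_mul_eq_one h1
    -- By the equation of the circle `x + iy` is invertible with inverse `x - iy`, so it is an
    -- exponential `exp z`, and the angle is `-iz`.
    obtain ⟨z, hz⟩ : ∃ z, Complex.exp z = x + y * Complex.I := ⟨_, Complex.exp_log h0⟩
    have e1 : Complex.exp (-z) = x - y * Complex.I := by
      rw [Complex.exp_neg, hz]
      exact inv_eq_of_mul_eq_one_right h1
    refine ⟨-(z * Complex.I), ?_, ?_⟩
    · have ea : -(z * Complex.I) * Complex.I = z := by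
        linear_combination -z * Complex.I_sq
      have eb : -(-(z * Complex.I)) * Complex.I = -z := by
        linear_combination z * Complex.I_sq
      rw [Complex.cos, ea, eb, hz, e1]; ring
    · have ea : -(z * Complex.I) * Complex.I = z := by
        linear_combination -z * Complex.I_sq
      have eb : -(-(z * Complex.I)) * Complex.I = -z := by
        linear_combination z * Complex.I_sq
      rw [Complex.sin, ea, eb, hz, e1]
      linear_combination -y * Complex.I_sq
  infinite_range := by
    have : Set.range Complex.cos = Set.univ := Complex.cos_surjective.range_eq
    rw [this]
    exact Set.infinite_univ

end Trig

/-! ### Manifolds charted by regular functions -/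

section Charts

variable {K : Type*} [RCLike K] {Y : Type*} [TopologicalSpace Y]

/-- A chart whose coordinates are regular functions and in which all regular functions are
analytic. -/
structure IsRegularChart (A : Subalgebra K (Y → K)) {m : ℕ}
    (e : OpenPartialHomeomorph Y (EuclideanSpace K (Fin m))) : Prop where
  coord : ∀ i, ∃ h ∈ A, ∀ y ∈ e.source, e y i = h y
  analytic : ∀ h ∈ A, ContDiffOn K ω (h ∘ e.symm) e.target

variable {A : Subalgebra K (Y → K)} {m : ℕ}
  {e e' : OpenPartialHomeomorph Y (EuclideanSpace K (Fin m))}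

/-- The coordinates of `e'` are regular functions, and these are analytic when written in the chart
`e`. -/
theorem IsRegularChart.contDiffOn_trans (he : IsRegularChart A e) (he' : IsRegularChart A e') :
    ContDiffOn K ω (e.symm.trans e') (e.symm.trans e').source := by
  rw [contDiffOn_euclidean]
  intro i
  obtain ⟨h, hA, hh⟩ := he'.coord i
  refine ((he.analytic h hA).mono ?_).congr ?_
  · rw [OpenPartialHomeomorph.trans_source]
    exact Set.inter_subset_left
  · intro x hx
    rw [OpenPartialHomeomorph.trans_source] at hx
    exact hh _ hx.2

/-- A space covered by regular charts with positive transition determinants is an oriented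
manifold. -/
theorem isOrientedManifold_of_charts [T2Space Y] [SecondCountableTopology Y]
    (e : Y → OpenPartialHomeomorph Y (EuclideanSpace K (Fin m)))
    (hmem : ∀ y, y ∈ (e y).source) (he : ∀ y, IsRegularChart A (e y))
    (hor : ∀ y y', ∀ x ∈ ((e y).symm.trans (e y')).source,
      0 < (fderiv ℝ ((e y).symm.trans (e y')) x).det) :
    IsOrientedManifold A m := by
  refine ⟨inferInstance, inferInstance, Or.inr ⟨m, rfl, ?_⟩⟩
  let cs : ChartedSpace (EuclideanSpace K (Fin m)) Y :=
    { atlas := Set.range e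
      chartAt := e
      mem_chart_source := hmem
      chart_mem_atlas := fun y => ⟨y, rfl⟩ }
  have hman : IsManifold 𝓘(K, EuclideanSpace K (Fin m)) ω Y := by
    refine isManifold_of_contDiffOn _ _ _ ?_
    rintro _ _ ⟨y, rfl⟩ ⟨y', rfl⟩
    simpa using (he y).contDiffOn_trans (he y')
  have hA : ∀ f ∈ A, ContMDiff 𝓘(K, EuclideanSpace K (Fin m)) 𝓘(K, K) ω f := by
    intro f hf y
    rw [contMDiffAt_iff]
    have h1 := (he y).analytic f hf
    have hy : e y y ∈ (e y).target := (e y).map_source (hmem y)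
    have h2 : ContDiffAt K ω (f ∘ (e y).symm) (e y y) :=
      (h1 _ hy).contDiffAt ((e y).open_target.mem_nhds hy)
    refine ⟨?_, ?_⟩
    · have h3 : ContinuousAt ((f ∘ (e y).symm) ∘ e y) y :=
        h2.continuousAt.comp ((e y).continuousAt (hmem y))
      refine h3.congr ?_
      filter_upwards [(e y).open_source.mem_nhds (hmem y)] with z hz
      simp [(e y).left_inv hz]
    · exact h2.contDiffWithinAt
  refine ⟨cs, hman, ?_, hA, ?_⟩
  · rintro _ ⟨y, rfl⟩ _ ⟨y', rfl⟩
    exact hor y y'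
  · intro y v hv
    have hy : e y y ∈ (e y).target := (e y).map_source (hmem y)
    -- The coordinates of the chart are themselves regular functions, so their differentials read
    -- off the coordinates of `v`.
    have key : ∀ i, (show EuclideanSpace K (Fin m) from v) i = 0 := by
      intro i
      obtain ⟨h, hh, hhe⟩ := (he y).coord i
      have h0 := hv h hh
      have hd : MDifferentiableAt 𝓘(K, EuclideanSpace K (Fin m)) 𝓘(K, K) h y :=
        (hA h hh y).mdifferentiableAt (by simp)
      rw [hd.mfderiv] at h0
      have h1 : HasFDerivAt (h ∘ (e y).symm)
          (EuclideanSpace.proj i : EuclideanSpace K (Fin m) →L[K] K) (e y y) := by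
        refine (EuclideanSpace.proj i : EuclideanSpace K (Fin m) →L[K] K).hasFDerivAt.congr_of_eventuallyEq ?_
        filter_upwards [(e y).open_target.mem_nhds hy] with b hb
        rw [Function.comp_apply, ← hhe _ ((e y).map_target hb), (e y).right_inv hb]
        rfl
      have h2 : fderivWithin K (writtenInExtChartAt 𝓘(K, EuclideanSpace K (Fin m)) 𝓘(K, K) y h)
          (Set.range 𝓘(K, EuclideanSpace K (Fin m)))
          (extChartAt 𝓘(K, EuclideanSpace K (Fin m)) y y) =
          (EuclideanSpace.proj i : EuclideanSpace K (Fin m) →L[K] K) := by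
        rw [ModelWithCorners.range_eq_univ, fderivWithin_univ]
        exact h1.fderiv
      rw [h2] at h0
      exact h0
    exact (PiLp.ext key : (show EuclideanSpace K (Fin m) from v) = 0)

/-- The differentials of transition maps are invertible. -/
theorem IsRegularChart.det_fderiv_trans_ne_zero (he : IsRegularChart A e)
    (he' : IsRegularChart A e') {x : EuclideanSpace K (Fin m)}
    (hx : x ∈ (e.symm.trans e').source) : (fderiv K (e.symm.trans e') x).det ≠ 0 := by
  have hx' : (e.symm.trans e') x ∈ (e'.symm.trans e).source := by
    rw [OpenPartialHomeomorph.trans_source] at hx ⊢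
    refine ⟨?_, ?_⟩
    · exact e'.map_source hx.2
    · change e'.symm (e' (e.symm x)) ∈ e.source
      rw [e'.left_inv hx.2]
      exact e.map_target hx.1
  have h1 : HasFDerivAt (e.symm.trans e') (fderiv K (e.symm.trans e') x) x :=
    (((he.contDiffOn_trans he').contDiffAt ((e.symm.trans e').open_source.mem_nhds hx)).differentiableAt
      (by simp)).hasFDerivAt
  have h2 : HasFDerivAt (e'.symm.trans e) (fderiv K (e'.symm.trans e) ((e.symm.trans e') x))
      ((e.symm.trans e') x) :=
    (((he'.contDiffOn_trans he).contDiffAt ((e'.symm.trans e).open_source.mem_nhds hx')).differentiableAt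
      (by simp)).hasFDerivAt
  have h3 := h2.comp x h1
  have h4 : HasFDerivAt ((e'.symm.trans e) ∘ (e.symm.trans e')) (ContinuousLinearMap.id K _) x := by
    refine (hasFDerivAt_id x).congr_of_eventuallyEq ?_
    filter_upwards [(e.symm.trans e').open_source.mem_nhds hx] with b hb
    rw [OpenPartialHomeomorph.trans_source] at hb
    change e (e'.symm (e' (e.symm b))) = b
    rw [e'.left_inv hb.2, e.right_inv hb.1]
  have h5 := h3.unique h4
  have h6 := congrArg (fun T : EuclideanSpace K (Fin m) →L[K] EuclideanSpace K (Fin m) =>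
    LinearMap.det (T : EuclideanSpace K (Fin m) →ₗ[K] EuclideanSpace K (Fin m))) h5
  rw [ContinuousLinearMap.toLinearMap_comp, LinearMap.det_comp, ContinuousLinearMap.coe_id,
    LinearMap.det_id] at h6
  exact right_ne_zero_of_mul_eq_one h6

/-- Complex manifolds are oriented. -/
theorem isOrientedManifold_of_charts_complex [T2Space Y] [SecondCountableTopology Y]
    {A : Subalgebra ℂ (Y → ℂ)} (e : Y → OpenPartialHomeomorph Y (EuclideanSpace ℂ (Fin m)))
    (hmem : ∀ y, y ∈ (e y).source) (he : ∀ y, IsRegularChart A (e y)) :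
    IsOrientedManifold A m := by
  refine isOrientedManifold_of_charts e hmem he fun y y' x hx => ?_
  have hd : DifferentiableAt ℂ ((e y).symm.trans (e y')) x :=
    (((he y).contDiffOn_trans (he y')).contDiffAt
      (((e y).symm.trans (e y')).open_source.mem_nhds hx)).differentiableAt (by simp)
  rw [hd.fderiv_restrictScalars ℝ]
  have := (he y).det_fderiv_trans_ne_zero (he y') hx
  change 0 < LinearMap.det ((fderiv ℂ ((e y).symm.trans (e y')) x :
    EuclideanSpace ℂ (Fin m) →ₗ[ℂ] EuclideanSpace ℂ (Fin m)).restrictScalars ℝ)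
  -- The real determinant of a complex linear map is the squared absolute value of its complex
  -- determinant.
  rw [LinearMap.det_restrictScalars, Algebra.norm_complex_eq]
  exact Complex.normSq_pos.2 this

end Charts

/-! ### Quotients of level sets by local actions -/

section LocalQuotient

open Topology Module

variable (K : Type*) [RCLike K]
  (V : Type*) [NormedAddCommGroup V] [NormedSpace K V] [FiniteDimensional K V]
  (W : Type*) [NormedAddCommGroup W] [NormedSpace K W] [FiniteDimensional K W]
  (P : Type*) [NormedAddCommGroup P] [NormedSpace K P] [FiniteDimensional K P]
  (Z : Type*) [TopologicalSpace Z] {Y : Type*} [TopologicalSpace Y]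

/-- `Z` is a regular level set of `F` in an open subset of `V`; the fibres of the quotient map
`q : Z → Y` contain the local orbits of `act`; the functions in `A` are the restrictions of analytic
functions, and their differentials at a point of `Z` cut out the tangent space of the orbit. -/
structure LocalQuotient (A : Subalgebra K (Y → K)) where
  ι : Z → V
  F : V → W
  q : Z → Y
  Ω : Set V
  act : P → V → V
  act' : Z → P →L[K] V
  isEmbedding : IsEmbedding ι
  isOpen : IsOpen Ω
  mem_range : ∀ v, v ∈ Set.range ι ↔ v ∈ Ω ∧ F v = 0
  contDiff : ContDiff K ω F
  surj : ∀ z, Function.Surjective (fderiv K F (ι z))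
  q_continuous : Continuous q
  q_open : IsOpenMap q
  q_surj : Function.Surjective q
  regular : ∀ h ∈ A, ∃ H : V → K, ContDiff K ω H ∧ ∀ z, h (q z) = H (ι z)
  act_contDiff : ∀ z, ContDiffAt K ω (fun x : V × P => act x.2 x.1) (ι z, 0)
  act_zero : ∀ v, act 0 v = v
  act_orbit : ∀ᶠ p in 𝓝 (0 : P), ∀ z, ∃ z', ι z' = act p (ι z) ∧ q z' = q z
  act_deriv : ∀ z, HasFDerivAt (fun p => act p (ι z)) (act' z) 0
  act_inj : ∀ z, Function.Injective (act' z)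
  ker : ∀ z t, fderiv K F (ι z) t = 0 →
    (∀ h ∈ A, ∀ H : V → K, ContDiff K ω H → (∀ z, h (q z) = H (ι z)) → fderiv K H (ι z) t = 0) →
    ∃ p, act' z p = t

variable {K V W P Z} {A : Subalgebra K (Y → K)} (D : LocalQuotient K V W P Z A)

namespace LocalQuotient

theorem F_eq_zero (z : Z) : D.F (D.ι z) = 0 := ((D.mem_range _).1 ⟨z, rfl⟩).2

theorem mem_Ω (z : Z) : D.ι z ∈ D.Ω := ((D.mem_range _).1 ⟨z, rfl⟩).1

theorem hasFDerivAt_F (v : V) : HasFDerivAt D.F (fderiv K D.F v) v :=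
  (D.contDiff.differentiable (by simp) v).hasFDerivAt

/-- Functions that vanish on the level set have differentials vanishing on its tangent space. -/
theorem fderiv_eq_zero_of_eventually {E : Type*} [NormedAddCommGroup E] [NormedSpace K E] (z : Z)
    {G : V → E} {G' : V →L[K] E} (hG : HasFDerivAt G G' (D.ι z)) {a : E}
    (h : ∀ᶠ z' in 𝓝 z, G (D.ι z') = a) {t : V} (ht : fderiv K D.F (D.ι z) t = 0) : G' t = 0 := by
  have : CompleteSpace V := FiniteDimensional.complete K V
  have hs : HasStrictFDerivAt D.F (fderiv K D.F (D.ι z)) (D.ι z) :=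
    D.contDiff.contDiffAt.hasStrictFDerivAt (by simp)
  have hr : (fderiv K D.F (D.ι z) : V →ₗ[K] W).range = ⊤ := LinearMap.range_eq_top.2 (D.surj z)
  -- A local parametrization of the level set by its tangent space, with the inclusion as
  -- differential at the origin. Composed with it, `G` becomes locally constant.
  let k := hs.implicitFunction D.F _ hr (D.F (D.ι z))
  have hk : HasStrictFDerivAt k (fderiv K D.F (D.ι z)).ker.subtypeL 0 :=
    hs.to_implicitFunction hr
  have hk0 : k 0 = D.ι z := by
    simp [k]
  have hkF : ∀ᶠ x in 𝓝 (0 : (fderiv K D.F (D.ι z)).ker), D.F (k x) = 0 := by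
    have h1 := hs.map_implicitFunction_eq hr
    have h2 : Filter.Tendsto (fun x : (fderiv K D.F (D.ι z)).ker => (D.F (D.ι z), x)) (𝓝 0)
        (𝓝 (D.F (D.ι z), 0)) := by
      exact Continuous.tendsto' (by fun_prop) _ _ rfl
    filter_upwards [h2.eventually h1] with x hx
    rw [← D.F_eq_zero z]
    exact hx
  have hkΩ : ∀ᶠ x in 𝓝 (0 : (fderiv K D.F (D.ι z)).ker), k x ∈ D.Ω := by
    refine hk.continuousAt.eventually_mem ?_
    rw [hk0]
    exact D.isOpen.mem_nhds (D.mem_Ω z)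
  obtain ⟨O, hO, hOz⟩ := mem_nhds_induced D.ι z _ |>.1
    (by rw [← D.isEmbedding.eq_induced]; exact h)
  have hkO : ∀ᶠ x in 𝓝 (0 : (fderiv K D.F (D.ι z)).ker), k x ∈ O := by
    refine hk.continuousAt.eventually_mem ?_
    rwa [hk0]
  have hG0 : HasFDerivAt (G ∘ k) (G'.comp (fderiv K D.F (D.ι z)).ker.subtypeL) 0 := by
    refine HasFDerivAt.comp _ ?_ hk.hasFDerivAt
    rwa [hk0]
  have hG1 : HasFDerivAt (G ∘ k)
      (0 : (fderiv K D.F (D.ι z)).ker →L[K] E) 0 := by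
    refine (hasFDerivAt_const a _).congr_of_eventuallyEq ?_
    filter_upwards [hkF, hkΩ, hkO] with x h1 h2 h3
    obtain ⟨z', hz'⟩ := (D.mem_range _).2 ⟨h2, h1⟩
    rw [← hz'] at h3
    rw [Function.comp_apply, ← hz']
    exact hOz h3
  have := DFunLike.congr_fun (hG0.unique hG1) ⟨t, ht⟩
  simpa using this

/-- Small parameters keep `z` in the level set, so `F` vanishes along the local orbit. -/
theorem fderiv_F_act' (z : Z) (p : P) : fderiv K D.F (D.ι z) (D.act' z p) = 0 := by
  have h1 : HasFDerivAt (fun p => D.F (D.act p (D.ι z)))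
      ((fderiv K D.F (D.ι z)).comp (D.act' z)) 0 := by
    refine HasFDerivAt.comp (g := D.F) _ ?_ (D.act_deriv z)
    rw [D.act_zero]
    exact D.hasFDerivAt_F _
  have h2 : HasFDerivAt (fun p => D.F (D.act p (D.ι z))) (0 : P →L[K] W) 0 := by
    refine (hasFDerivAt_const 0 _).congr_of_eventuallyEq ?_
    filter_upwards [D.act_orbit] with p hp
    obtain ⟨z', hz', -⟩ := hp z
    rw [← hz', D.F_eq_zero]
  exact DFunLike.congr_fun (h1.unique h2) p

theorem fderiv_extension_act' {E : Type*} [NormedAddCommGroup E] [NormedSpace K E]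
    {h : Y → E} {H : V → E} (hH : Differentiable K H)
    (hh : ∀ z, h (D.q z) = H (D.ι z)) (z : Z) (p : P) :
    fderiv K H (D.ι z) (D.act' z p) = 0 := by
  have h1 : HasFDerivAt (fun p => H (D.act p (D.ι z)))
      ((fderiv K H (D.ι z)).comp (D.act' z)) 0 := by
    refine HasFDerivAt.comp (g := H) _ ?_ (D.act_deriv z)
    rw [D.act_zero]
    exact (hH _).hasFDerivAt
  have h2 : HasFDerivAt (fun p => H (D.act p (D.ι z))) (0 : P →L[K] E) 0 := by
    refine (hasFDerivAt_const (h (D.q z)) _).congr_of_eventuallyEq ?_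
    filter_upwards [D.act_orbit] with p hp
    obtain ⟨z', hz', hq⟩ := hp z
    rw [← hz', ← hh, hq]
  exact DFunLike.congr_fun (h1.unique h2) p

theorem exists_fin_span_eq_top {E : Type*} [AddCommGroup E] [Module K E]
    [FiniteDimensional K E] (U : Submodule K E) {m : ℕ} (hm : finrank K U = m) :
    ∃ b : Fin m → U, Submodule.span K (Set.range b) = ⊤ :=
  ⟨_, (Module.finBasisOfFinrankEq K U hm).span_eq⟩

theorem exists_fin_dualCoannihilator {T : Type*} [AddCommGroup T] [Module K T]
    [FiniteDimensional K T] (U : Submodule K (Module.Dual K T)) {m : ℕ} (hm : finrank K U = m) :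
    ∃ b : Fin m → U, ∀ t : T, (∀ i, (b i : Module.Dual K T) t = 0) → t ∈ U.dualCoannihilator := by
  obtain ⟨b, hb⟩ := exists_fin_span_eq_top (E := Module.Dual K T) U hm
  refine ⟨b, fun t ht => ?_⟩
  rw [Submodule.mem_dualCoannihilator]
  intro φ hφ
  have hφ' : (⟨φ, hφ⟩ : U) ∈ Submodule.span K (Set.range b) := by
    rw [hb]; trivial
  have key : ∀ ψ ∈ Submodule.span K (Set.range b), (ψ : Module.Dual K T) t = 0 := by
    intro ψ hψ
    refine Submodule.span_induction ?_ ?_ ?_ ?_ hψ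
    · rintro _ ⟨i, rfl⟩
      exact ht i
    · rfl
    · intro x y _ _ hx hy
      rw [Submodule.coe_add, LinearMap.add_apply, hx, hy, add_zero]
    · intro a x _ hx
      rw [Submodule.coe_smul, LinearMap.smul_apply, hx, smul_zero]
  exact key _ hφ'

/-- A tuple of regular functions whose differentials at `z` cut out the tangent space of the
orbit. -/
structure IsCoord {m : ℕ} (z : Z) (h : Fin m → Y → K) (H : V → EuclideanSpace K (Fin m)) :
    Prop where
  mem : ∀ i, h i ∈ A
  contDiff : ContDiff K ω H
  eq : ∀ z i, H (D.ι z) i = h i (D.q z)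
  ker : ∀ t, fderiv K D.F (D.ι z) t = 0 → fderiv K H (D.ι z) t = 0 → ∃ p, D.act' z p = t

/-- The differentials of regular functions, as functionals on the tangent space. -/
def cotangent (z : Z) : Submodule K (Module.Dual K (LinearMap.ker (fderiv K D.F (D.ι z)).toLinearMap)) where
  carrier := {φ | ∃ h ∈ A, ∃ H : V → K, ContDiff K ω H ∧ (∀ z, h (D.q z) = H (D.ι z)) ∧
    ∀ t, φ t = fderiv K H (D.ι z) t}
  zero_mem' := ⟨0, A.zero_mem, fun _ => 0, contDiff_const, fun _ => rfl, fun t => by simp⟩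
  add_mem' := by
    rintro φ ψ ⟨h, hA, H, hH, hh, hφ⟩ ⟨k, kA, G, hG, hk, hψ⟩
    refine ⟨h + k, A.add_mem hA kA, H + G, hH.add hG, fun z => by simp [hh, hk], fun t => ?_⟩
    rw [fderiv_add (hH.differentiable (by simp) _) (hG.differentiable (by simp) _)]
    simp [hφ, hψ]
  smul_mem' := by
    rintro c φ ⟨h, hA, H, hH, hh, hφ⟩
    refine ⟨c • h, A.smul_mem hA c, c • H, contDiff_const.smul hH, fun z => by simp [hh], fun t => ?_⟩
    rw [fderiv_const_smul (hH.differentiable (by simp) _)]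
    simp [hφ]

theorem finrank_ker (z : Z) :
    finrank K W + finrank K (LinearMap.ker (fderiv K D.F (D.ι z)).toLinearMap) = finrank K V := by
  rw [← LinearMap.finrank_range_add_finrank_ker (fderiv K D.F (D.ι z)).toLinearMap,
    LinearMap.range_eq_top.2 (D.surj z), finrank_top]

/-- The orbit directions, as a subspace of the tangent space. -/
def actKer (z : Z) : P →ₗ[K] LinearMap.ker (fderiv K D.F (D.ι z)).toLinearMap :=
  (D.act' z).toLinearMap.codRestrict _ (D.fderiv_F_act' z)

/-- The field `ker` gives one inclusion; the other holds because functions pulled back from the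
quotient are constant along local orbits. -/
theorem dualCoannihilator_cotangent (z : Z) :
    (D.cotangent z).dualCoannihilator = LinearMap.range (D.actKer z) := by
  ext t
  rw [Submodule.mem_dualCoannihilator]
  constructor
  · intro h
    obtain ⟨p, hp⟩ := D.ker z t t.2 fun h' hA H hH hh => by
      let φ : Module.Dual K (LinearMap.ker (fderiv K D.F (D.ι z)).toLinearMap) :=
        (fderiv K H (D.ι z)).toLinearMap.comp (Submodule.subtype _)
      exact h φ ⟨h', hA, H, hH, hh, fun _ => rfl⟩
    exact ⟨p, Subtype.ext hp⟩
  · rintro ⟨p, rfl⟩ φ ⟨h, hA, H, hH, hh, hφ⟩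
    rw [hφ]
    exact D.fderiv_extension_act' (hH.differentiable (by simp)) hh z p

/-- By duality the differentials span a space of dimension equal to the codimension of the orbit in
the level set. The expected dimension of the quotient is thereby a natural number as soon as `Z` has
a point. -/
theorem finrank_cotangent (z : Z) :
    finrank K (D.cotangent z) + finrank K P + finrank K W = finrank K V := by
  have h1 := Subspace.finrank_add_finrank_dualCoannihilator_eq (D.cotangent z)
  have h2 : finrank K (LinearMap.range (D.actKer z)) = finrank K P :=
    LinearMap.finrank_range_of_inj fun p p' hp => D.act_inj z (congrArg Subtype.val hp)
  rw [D.dualCoannihilator_cotangent z, h2] at h1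
  rw [h1, add_comm]
  exact D.finrank_ker z

/-- The coordinates are regular functions whose differentials form a basis of `cotangent`. -/
theorem exists_isCoord (z : Z) {m : ℕ} (hm : m + finrank K P + finrank K W = finrank K V) :
    ∃ h H, D.IsCoord (m := m) z h H := by
  have hfr : finrank K (D.cotangent z) = m := by
    have := D.finrank_cotangent z
    omega
  obtain ⟨b, hb⟩ := exists_fin_dualCoannihilator (D.cotangent z) hfr
  choose h hA H hH hh hφ using fun i => (b i).2
  refine ⟨h, fun v => WithLp.toLp 2 fun i => H i v, hA, ?_, fun z i => (hh i z).symm, ?_⟩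
  · rw [contDiff_euclidean]
    exact hH
  · intro t ht ht'
    have hHd : ∀ i, HasFDerivAt (H i) (fderiv K (H i) (D.ι z)) (D.ι z) := fun i =>
      ((hH i).differentiable (by simp) _).hasFDerivAt
    have hd : HasFDerivAt (fun v => (WithLp.toLp 2 fun i => H i v : EuclideanSpace K (Fin m)))
        (fderiv K (fun v => (WithLp.toLp 2 fun i => H i v : EuclideanSpace K (Fin m))) (D.ι z))
        (D.ι z) := by
      refine DifferentiableAt.hasFDerivAt ?_
      rw [differentiableAt_euclidean]
      exact fun i => (hHd i).differentiableAt
    have hi : ∀ i, fderiv K (H i) (D.ι z) t = 0 := by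
      intro i
      have h1 := (EuclideanSpace.proj i : EuclideanSpace K (Fin m) →L[K] K).hasFDerivAt.comp _ hd
      have h2 := DFunLike.congr_fun (h1.unique (hHd i)) t
      rw [← h2, ContinuousLinearMap.comp_apply, ht', map_zero]
    have hmem := hb ⟨t, ht⟩ fun i => (hφ i _).trans (hi i)
    rw [D.dualCoannihilator_cotangent] at hmem
    obtain ⟨p, hp⟩ := hmem
    exact ⟨p, congrArg Subtype.val hp⟩

end LocalQuotient

end LocalQuotient

/-! ### Slices and charts of the quotient. -/

section LocalQuotientChart

open Topology Module

variable {K : Type*} [RCLike K]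
  {V : Type*} [NormedAddCommGroup V] [NormedSpace K V] [FiniteDimensional K V]
  {W : Type*} [NormedAddCommGroup W] [NormedSpace K W] [FiniteDimensional K W]
  {P : Type*} [NormedAddCommGroup P] [NormedSpace K P] [FiniteDimensional K P]
  {Z : Type*} [TopologicalSpace Z] {Y : Type*} [TopologicalSpace Y]
  {A : Subalgebra K (Y → K)} (D : LocalQuotient K V W P Z A)

namespace LocalQuotient

/-- The constraints `F`, the invariant coordinates `H` and a linear measure `ℓ` of the position
along the orbit form local coordinates of `V`. The slice `F = 0`, `ℓ = ℓ v₀` is parametrized by `H`,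
and every nearby point of the level set can be moved along its orbit into the slice. -/
theorem exists_chart {m : ℕ} (hm : m + finrank K P + finrank K W = finrank K V) {z₀ : Z}
    {h : Fin m → Y → K} {H : V → EuclideanSpace K (Fin m)} (hc : D.IsCoord z₀ h H)
    {N : Set Z} (hN : N ∈ 𝓝 z₀) :
    ∃ e : OpenPartialHomeomorph Y (EuclideanSpace K (Fin m)), D.q z₀ ∈ e.source ∧
      e.source ⊆ D.q '' N ∧ IsRegularChart A e ∧ ∀ z, e (D.q z) = H (D.ι z) := by
  have : CompleteSpace V := FiniteDimensional.complete K V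
  have : CompleteSpace P := FiniteDimensional.complete K P
  -- A left inverse of the infinitesimal action, measuring displacement along the orbit.
  obtain ⟨l, hl⟩ := LinearMap.exists_leftInverse_of_injective (D.act' z₀).toLinearMap
    (LinearMap.ker_eq_bot.2 (D.act_inj z₀))
  let ℓ : V →L[K] P := LinearMap.toContinuousLinearMap l
  have hℓ : ∀ p, ℓ (D.act' z₀ p) = p := fun p => DFunLike.congr_fun hl p
  let v₀ := D.ι z₀
  -- the local diffeomorphism
  let Ψ : V → W × EuclideanSpace K (Fin m) × P := fun v => (D.F v, H v, ℓ v)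
  have hΨ : ContDiff K ω Ψ := D.contDiff.prodMk (hc.contDiff.prodMk ℓ.contDiff)
  let Ψ' : V →L[K] W × EuclideanSpace K (Fin m) × P :=
    (fderiv K D.F v₀).prod ((fderiv K H v₀).prod ℓ)
  have hΨ' : HasFDerivAt Ψ Ψ' v₀ :=
    (D.hasFDerivAt_F v₀).prodMk
      ((hc.contDiff.differentiable (by simp) v₀).hasFDerivAt.prodMk ℓ.hasFDerivAt)
  -- A vector killed by the differentials of `F` and `H` is an orbit direction, and `ℓ` detects
  -- those.
  have hinj : Function.Injective Ψ'.toLinearMap := by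
    rw [← LinearMap.ker_eq_bot, LinearMap.ker_eq_bot']
    intro t ht
    have h1 : fderiv K D.F v₀ t = 0 := congrArg Prod.fst ht
    have h2 : fderiv K H v₀ t = 0 := congrArg (fun x => x.2.1) ht
    have h3 : ℓ t = 0 := congrArg (fun x => x.2.2) ht
    obtain ⟨p, rfl⟩ := hc.ker t h1 h2
    rw [hℓ] at h3
    rw [h3, map_zero]
  have hfr : finrank K V = finrank K (W × EuclideanSpace K (Fin m) × P) := by
    rw [finrank_prod, finrank_prod, finrank_euclideanSpace_fin]
    omega
  let L : V ≃L[K] W × EuclideanSpace K (Fin m) × P :=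
    (LinearEquiv.ofInjectiveOfFinrankEq Ψ'.toLinearMap hinj hfr).toContinuousLinearEquiv
  have hL : HasFDerivAt Ψ (L : V →L[K] W × EuclideanSpace K (Fin m) × P) v₀ := by
    have hLΨ : (L : V →L[K] W × EuclideanSpace K (Fin m) × P) = Ψ' := by
      ext1 t; rfl
    rwa [hLΨ]
  let e₀ := hΨ.contDiffAt.toOpenPartialHomeomorph Ψ hL (by simp : (ω : WithTop ℕ∞) ≠ 0)
  have he₀ : ∀ v, e₀ v = Ψ v := fun v => rfl
  have hv₀ : v₀ ∈ e₀.source := hΨ.contDiffAt.mem_toOpenPartialHomeomorph_source hL (by simp)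
  have hsymm : ContDiffAt K ω e₀.symm (Ψ v₀) := by
    refine e₀.contDiffAt_symm (f₀' := L) (e₀.map_source hv₀) ?_ ?_
    · rw [← he₀, e₀.left_inv hv₀]; exact hL
    · rw [← he₀, e₀.left_inv hv₀]; exact hΨ.contDiffAt
  -- the slice
  let j : EuclideanSpace K (Fin m) → W × EuclideanSpace K (Fin m) × P := fun b => (0, b, ℓ v₀)
  have hj : ContDiff K ω j := contDiff_const.prodMk (contDiff_id.prodMk contDiff_const)
  have hj₀ : j (H v₀) = Ψ v₀ := by
    change (0, H v₀, ℓ v₀) = (D.F v₀, H v₀, ℓ v₀)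
    rw [D.F_eq_zero]
  let s : EuclideanSpace K (Fin m) → V := fun b => e₀.symm (j b)
  have hs : ContDiffAt K ω s (H v₀) := by
    refine ContDiffAt.comp _ ?_ hj.contDiffAt
    rwa [hj₀]
  have hs₀ : s (H v₀) = v₀ := by
    change e₀.symm (j (H v₀)) = v₀
    rw [hj₀]
    exact e₀.left_inv hv₀
  have hB : ∀ᶠ b in 𝓝 (H v₀), j b ∈ e₀.target ∧ s b ∈ D.Ω ∧ ContDiffAt K ω s b := by
    refine Filter.Eventually.and ?_ (Filter.Eventually.and ?_ (hs.eventually (by simp)))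
    · refine hj.continuous.continuousAt.eventually_mem ?_
      rw [hj₀]
      exact e₀.open_target.mem_nhds (e₀.map_source hv₀)
    · refine hs.continuousAt.eventually_mem ?_
      rw [hs₀]
      exact D.isOpen.mem_nhds (D.mem_Ω z₀)
  obtain ⟨B, hBsub, hBo, hBz⟩ := eventually_nhds_iff.1 hB
  have hsΨ : ∀ b ∈ B, Ψ (s b) = j b := fun b hb => e₀.right_inv (hBsub b hb).1
  have hsF : ∀ b ∈ B, D.F (s b) = 0 := fun b hb => congrArg Prod.fst (hsΨ b hb)
  have hsH : ∀ b ∈ B, H (s b) = b := fun b hb => congrArg (fun x => x.2.1) (hsΨ b hb)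
  have hex : ∀ b, ∃ z, b ∈ B → D.ι z = s b := by
    intro b
    by_cases hb : b ∈ B
    · obtain ⟨z, hz⟩ := (D.mem_range _).2 ⟨(hBsub b hb).2.1, hsF b hb⟩
      exact ⟨z, fun _ => hz⟩
    · exact ⟨z₀, fun hb' => absurd hb' hb⟩
  choose σ hσ using hex
  have hσc : ContinuousOn σ B := by
    rw [continuousOn_iff_continuous_domRestrict, D.isEmbedding.continuous_iff]
    have : ContinuousOn s B := fun b hb => (hBsub b hb).2.2.continuousAt.continuousWithinAt
    rw [continuousOn_iff_continuous_domRestrict] at this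
    exact this.congr fun b => (hσ b b.2).symm
  -- the coordinates on the quotient
  let η : Y → EuclideanSpace K (Fin m) := fun y => WithLp.toLp 2 fun i => h i y
  have hη : ∀ z, η (D.q z) = H (D.ι z) := fun z => PiLp.ext fun i => (hc.eq z i).symm
  have hηc : Continuous η := by
    rw [(D.q_open.isQuotientMap D.q_continuous D.q_surj).continuous_iff]
    exact (hc.contDiff.continuous.comp D.isEmbedding.continuous).congr fun z => (hη z).symm
  have hησ : ∀ b ∈ B, η (D.q (σ b)) = b := fun b hb => by rw [hη, hσ b hb, hsH b hb]
  -- every point near `z₀` can be moved to the slice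
  have hmove : ∀ᶠ z in 𝓝 z₀, H (D.ι z) ∈ B ∧ D.q (σ (H (D.ι z))) = D.q z := by
    have hιc : Filter.Tendsto D.ι (𝓝 z₀) (𝓝 v₀) := D.isEmbedding.continuous.tendsto z₀
    have hHB : ∀ᶠ z in 𝓝 z₀, H (D.ι z) ∈ B :=
      (hc.contDiff.continuous.tendsto v₀ |>.comp hιc).eventually (hBo.mem_nhds hBz)
    have hact : HasStrictFDerivAt (fun x : V × P => D.act x.2 x.1)
        (fderiv K (fun x : V × P => D.act x.2 x.1) (v₀, 0)) (v₀, 0) :=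
      (D.act_contDiff z₀).hasStrictFDerivAt (by simp)
    have hact2 : ∀ p, fderiv K (fun x : V × P => D.act x.2 x.1) (v₀, 0) (0, p) =
        D.act' z₀ p := by
      intro p
      have h1 : HasFDerivAt (fun p : P => D.act p v₀)
          ((fderiv K (fun x : V × P => D.act x.2 x.1) (v₀, 0)).comp
            (ContinuousLinearMap.inr K V P)) 0 :=
        HasFDerivAt.comp (f := fun p : P => (v₀, p)) (g := fun x : V × P => D.act x.2 x.1) 0
          hact.hasFDerivAt (hasFDerivAt_prodMk_right v₀ 0)
      exact DFunLike.congr_fun (h1.unique (D.act_deriv z₀)) p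
    have hG : HasStrictFDerivAt (fun x : V × P => ℓ (D.act x.2 x.1))
        (ℓ.comp (fderiv K (fun x : V × P => D.act x.2 x.1) (v₀, 0))) (v₀, 0) :=
      ℓ.hasStrictFDerivAt.comp _ hact
    have hinv : ((ℓ.comp (fderiv K (fun x : V × P => D.act x.2 x.1) (v₀, 0))).comp
        (ContinuousLinearMap.inr K V P)).IsInvertible := by
      have : (ℓ.comp (fderiv K (fun x : V × P => D.act x.2 x.1) (v₀, 0))).comp
          (ContinuousLinearMap.inr K V P) = ContinuousLinearMap.id K P := by
        ext p
        change ℓ (fderiv K (fun x : V × P => D.act x.2 x.1) (v₀, 0) (0, p)) = p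
        rw [hact2, hℓ]
      rw [this]
      exact ⟨ContinuousLinearEquiv.refl K P, rfl⟩
    -- `ψ v` is the small parameter whose action brings the `ℓ`-coordinate of `v` back to that of
    -- `v₀`; it exists since `ℓ` inverts the infinitesimal action.
    let ψ := hG.implicitFunctionOfProdDomain hinv
    have hψ : Filter.Tendsto ψ (𝓝 v₀) (𝓝 0) := hG.tendsto_implicitFunctionOfProdDomain hinv
    have hψe : ∀ᶠ v in 𝓝 v₀, ℓ (D.act (ψ v) v) = ℓ v₀ := by
      have := hG.eventually_apply_implicitFunctionOfProdDomain hinv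
      simpa only [D.act_zero] using this
    have hψs : ∀ᶠ v in 𝓝 v₀, D.act (ψ v) v ∈ e₀.source := by
      have h1 : Filter.Tendsto (fun v => D.act (ψ v) v) (𝓝 v₀) (𝓝 (D.act 0 v₀)) :=
        Filter.Tendsto.comp (g := fun x : V × P => D.act x.2 x.1)
          (D.act_contDiff z₀).continuousAt (Filter.Tendsto.prodMk_nhds Filter.tendsto_id hψ)
      rw [D.act_zero] at h1
      exact h1.eventually (e₀.open_source.mem_nhds hv₀)
    filter_upwards [hHB, hιc.eventually hψe, hιc.eventually hψs,
      hιc.eventually (hψ.eventually D.act_orbit)] with z hz1 hz2 hz3 hz4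
    refine ⟨hz1, ?_⟩
    obtain ⟨z', hz', hq⟩ := hz4 z
    rw [← hz'] at hz2 hz3
    -- On the level set `H` descends to the quotient, so moving along the orbit does not change it.
    have hH : H (D.ι z') = H (D.ι z) := by rw [← hη, ← hη, hq]
    have hΨz : Ψ (D.ι z') = j (H (D.ι z)) := by
      change (D.F (D.ι z'), H (D.ι z'), ℓ (D.ι z')) = (0, H (D.ι z), ℓ v₀)
      rw [D.F_eq_zero, hH, hz2]
    have hιz : D.ι z' = s (H (D.ι z)) := by
      change _ = e₀.symm (j (H (D.ι z)))
      rw [← hΨz]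
      exact (e₀.left_inv hz3).symm
    rw [← hq]
    congr 1
    apply D.isEmbedding.injective
    rw [hσ _ hz1, hιz]
  obtain ⟨N₁, hN₁sub, hN₁o, hN₁z⟩ := eventually_nhds_iff.1 (hmove.and hN)
  let U : Set Y := D.q '' N₁
  have hU : IsOpen U := D.q_open _ hN₁o
  have hUη : ∀ y ∈ U, η y ∈ B ∧ D.q (σ (η y)) = y := by
    rintro _ ⟨z, hz, rfl⟩
    rw [hη]
    exact (hN₁sub z hz).1
  let e : OpenPartialHomeomorph Y (EuclideanSpace K (Fin m)) :=
    { toFun := η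
      invFun := fun b => D.q (σ b)
      source := U
      target := B ∩ (fun b => D.q (σ b)) ⁻¹' U
      map_source' := fun y hy => ⟨(hUη y hy).1, by
        change D.q (σ (η y)) ∈ U
        rwa [(hUη y hy).2]⟩
      map_target' := fun b hb => hb.2
      left_inv' := fun y hy => (hUη y hy).2
      right_inv' := fun b hb => hησ b hb.1
      open_source := hU
      open_target := (D.q_continuous.comp_continuousOn hσc).isOpen_inter_preimage hBo hU
      continuousOn_toFun := hηc.continuousOn
      continuousOn_invFun := (D.q_continuous.comp_continuousOn hσc).mono Set.inter_subset_left }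
  refine ⟨e, ⟨z₀, hN₁z, rfl⟩, ?_, ⟨fun i => ⟨h i, hc.mem i, fun y _ => rfl⟩, ?_⟩, hη⟩
  · rintro _ ⟨z, hz, rfl⟩
    exact ⟨z, (hN₁sub z hz).2, rfl⟩
  · intro k hk b hb
    obtain ⟨G, hG, hkG⟩ := D.regular k hk
    refine ContDiffAt.contDiffWithinAt ?_
    refine (hG.contDiffAt.comp b (hBsub b hb.1).2.2).congr_of_eventuallyEq ?_
    filter_upwards [hBo.mem_nhds hb.1] with b' hb'
    change k (D.q (σ b')) = G (s b')
    rw [hkG, hσ b' hb']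

/-- Quotients in the complex category are oriented manifolds. -/
theorem isOrientedManifold_complex {V W P : Type*} [NormedAddCommGroup V] [NormedSpace ℂ V]
    [FiniteDimensional ℂ V] [NormedAddCommGroup W] [NormedSpace ℂ W] [FiniteDimensional ℂ W]
    [NormedAddCommGroup P] [NormedSpace ℂ P] [FiniteDimensional ℂ P]
    {A : Subalgebra ℂ (Y → ℂ)} (D : LocalQuotient ℂ V W P Z A) [T2Space Y]
    [SecondCountableTopology Y] (d : ℤ) (hd : d = finrank ℂ V - finrank ℂ W - finrank ℂ P) :
    IsOrientedManifold A d := by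
  rcases isEmpty_or_nonempty Z with hZ | ⟨⟨z⟩⟩
  · refine ⟨inferInstance, inferInstance, Or.inl ⟨fun y => ?_⟩⟩
    exact hZ.false (D.q_surj y).choose
  · have hm := D.finrank_cotangent z
    set m := finrank ℂ (D.cotangent z)
    have hdm : d = m := by omega
    rw [hdm]
    have hch : ∀ y : Y, ∃ e : OpenPartialHomeomorph Y (EuclideanSpace ℂ (Fin m)),
        y ∈ e.source ∧ IsRegularChart A e := by
      intro y
      obtain ⟨z, rfl⟩ := D.q_surj y
      obtain ⟨h, H, hc⟩ := D.exists_isCoord z hm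
      obtain ⟨e, he, -, hr, -⟩ := D.exists_chart hm hc Filter.univ_mem
      exact ⟨e, he, hr⟩
    choose e he hr using hch
    exact isOrientedManifold_of_charts_complex e he hr

end LocalQuotient

end LocalQuotientChart

/-! ### Orientation of real quotients. -/

section RealOrientation

open Topology Module

variable {V : Type*} [NormedAddCommGroup V] [NormedSpace ℝ V] [FiniteDimensional ℝ V]
  {W : Type*} [NormedAddCommGroup W] [NormedSpace ℝ W] [FiniteDimensional ℝ W]
  {P : Type*} [NormedAddCommGroup P] [NormedSpace ℝ P] [FiniteDimensional ℝ P]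
  {E : Type*} [NormedAddCommGroup E] [NormedSpace ℝ E] [FiniteDimensional ℝ E]

/-- Shears compose by adding their parameters, so a shear is the square of the shear with half the
parameter, and its determinant is a nonzero square. -/
theorem det_shear_pos (B : W →ₗ[ℝ] E) :
    0 < LinearMap.det ((LinearMap.fst ℝ W (E × P)).prod
      (((LinearMap.fst ℝ E P).comp (LinearMap.snd ℝ W (E × P)) +
        B.comp (LinearMap.fst ℝ W (E × P))).prod
        ((LinearMap.snd ℝ E P).comp (LinearMap.snd ℝ W (E × P))))) := by
  let S : (W →ₗ[ℝ] E) → (W × E × P →ₗ[ℝ] W × E × P) := fun B => (LinearMap.fst ℝ W (E × P)).prod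
      (((LinearMap.fst ℝ E P).comp (LinearMap.snd ℝ W (E × P)) +
        B.comp (LinearMap.fst ℝ W (E × P))).prod
        ((LinearMap.snd ℝ E P).comp (LinearMap.snd ℝ W (E × P))))
  have hadd : ∀ B C, S (B + C) = (S B).comp (S C) := by
    intro B C
    refine LinearMap.ext fun ⟨w, a, p⟩ => ?_
    refine Prod.ext rfl (Prod.ext ?_ rfl)
    change a + (B w + C w) = a + C w + B w
    abel
  have h0 : S 0 = LinearMap.id := by
    refine LinearMap.ext fun ⟨w, a, p⟩ => ?_
    simp [S]
  have hhalf : S B = (S ((1 / 2 : ℝ) • B)).comp (S ((1 / 2 : ℝ) • B)) := by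
    rw [← hadd, ← add_smul]; norm_num
  have hne : LinearMap.det (S ((1 / 2 : ℝ) • B)) ≠ 0 := by
    have h1 : (S ((1 / 2 : ℝ) • B)).comp (S (-((1 / 2 : ℝ) • B))) = LinearMap.id := by
      rw [← hadd, add_neg_cancel, h0]
    have h2 := congrArg LinearMap.det h1
    rw [LinearMap.det_comp, LinearMap.det_id] at h2
    exact left_ne_zero_of_mul_eq_one h2
  change 0 < LinearMap.det (S B)
  rw [hhalf, LinearMap.det_comp]
  exact mul_self_pos.2 hne

/-- Changing the middle block of an isomorphism `V → W × E × P`. -/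
theorem exists_det_eq (J : (W × E × P) ≃L[ℝ] V) (F : V →L[ℝ] W) (H₁ H₂ : V →L[ℝ] E)
    (ℓ : V →L[ℝ] P) (τ : E →L[ℝ] E) (hinj : Function.Injective (F.prod (H₁.prod ℓ)))
    (h : ∀ t, F t = 0 → H₂ t = τ (H₁ t)) :
    ∃ c > 0, ((J : (W × E × P) →L[ℝ] V).comp (F.prod (H₂.prod ℓ))).det =
      c * τ.det * ((J : (W × E × P) →L[ℝ] V).comp (F.prod (H₁.prod ℓ))).det := by
  let L := LinearEquiv.ofInjectiveOfFinrankEq (F.prod (H₁.prod ℓ)).toLinearMap hinj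
    J.toLinearEquiv.finrank_eq.symm
  have hL : ∀ t, L t = (F t, H₁ t, ℓ t) := fun t => rfl
  let B : W →ₗ[ℝ] E := H₂.toLinearMap.comp (L.symm.toLinearMap.comp (LinearMap.inl ℝ W (E × P)))
  let R : W × E × P →ₗ[ℝ] W × E × P :=
    LinearMap.prodMap LinearMap.id (LinearMap.prodMap τ.toLinearMap LinearMap.id)
  let S : W × E × P →ₗ[ℝ] W × E × P := (LinearMap.fst ℝ W (E × P)).prod
      (((LinearMap.fst ℝ E P).comp (LinearMap.snd ℝ W (E × P)) +
        B.comp (LinearMap.fst ℝ W (E × P))).prod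
        ((LinearMap.snd ℝ E P).comp (LinearMap.snd ℝ W (E × P))))
  -- Subtracting from `t` the vector with the same `F` and vanishing `H₁`, `ℓ` lands in the kernel
  -- of `F`, where `H₂ = τ ∘ H₁`. The subtracted vector contributes the shear `B`.
  have hSR : ∀ t, S (R (F t, H₁ t, ℓ t)) = (F t, H₂ t, ℓ t) := by
    intro t
    have h1 : L (L.symm (F t, 0, 0)) = (F t, 0, 0) := L.apply_symm_apply _
    rw [hL] at h1
    have h2 : F (L.symm (F t, 0, 0)) = F t := congrArg Prod.fst h1
    have h3 : H₁ (L.symm (F t, 0, 0)) = 0 := congrArg (fun x => x.2.1) h1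
    have h4 := h (t - L.symm (F t, 0, 0)) (by rw [map_sub, h2, sub_self])
    rw [map_sub, map_sub, h3, sub_zero, sub_eq_iff_eq_add] at h4
    rw [h4]
    rfl
  refine ⟨LinearMap.det S, det_shear_pos B, ?_⟩
  have hdR : LinearMap.det R = τ.det := by
    rw [LinearMap.det_prodMap, LinearMap.det_prodMap, LinearMap.det_id, LinearMap.det_id, one_mul,
      mul_one]
  have hcomp : ((J : (W × E × P) →L[ℝ] V).comp (F.prod (H₂.prod ℓ))).toLinearMap =
      (J.toLinearEquiv.toLinearMap.comp ((S.comp R).comp J.toLinearEquiv.symm.toLinearMap)).comp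
        ((J : (W × E × P) →L[ℝ] V).comp (F.prod (H₁.prod ℓ))).toLinearMap := by
    ext t
    change J (F t, H₂ t, ℓ t) = J (S (R (J.symm (J (F t, H₁ t, ℓ t)))))
    rw [J.symm_apply_apply, hSR]
  rw [ContinuousLinearMap.det, hcomp, LinearMap.det_comp, LinearMap.det_conj, LinearMap.det_comp,
    hdR]

/-- The reflection in the first coordinate. -/
theorem exists_flip {m : ℕ} (hm : 0 < m) : ∃ (d : Fin m → ℝ)
    (R : EuclideanSpace ℝ (Fin m) →L[ℝ] EuclideanSpace ℝ (Fin m)),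
    (∀ a i, R a i = d i * a i) ∧ R.det = -1 ∧ Function.Injective R := by
  let d : Fin m → ℝ := Function.update 1 ⟨0, hm⟩ (-1)
  let b := (EuclideanSpace.basisFun (Fin m) ℝ).toBasis
  let R := LinearMap.toContinuousLinearMap (Matrix.toLin b b (Matrix.diagonal d))
  have hR : ∀ a i, R a i = d i * a i := by
    intro a i
    have h1 := Matrix.toLin_apply (v₁ := b) (v₂ := b) (Matrix.diagonal d) a
    change (Matrix.toLin b b (Matrix.diagonal d) a) i = _
    rw [h1]
    simp [b, Matrix.mulVec_diagonal, Finset.sum_apply, Pi.single_apply]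
  have hdet : R.det = -1 := by
    change LinearMap.det (Matrix.toLin b b (Matrix.diagonal d)) = -1
    rw [LinearMap.det_toLin, Matrix.det_diagonal]
    rw [Finset.prod_update_of_mem (Finset.mem_univ _)]
    simp
  refine ⟨d, R, hR, hdet, ?_⟩
  intro a a' haa
  ext i
  have h1 := congrArg (fun x : EuclideanSpace ℝ (Fin m) => x i) haa
  simp only [hR] at h1
  have hd : d i ≠ 0 := by
    by_cases hi : i = ⟨0, hm⟩
    · subst hi; simp [d]
    · simp [d, Function.update_of_ne hi]
  exact mul_left_cancel₀ hd h1

variable {Z : Type*} [TopologicalSpace Z] {Y : Type*} [TopologicalSpace Y]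

namespace LocalQuotient

/-- If a chart is given by the extension `H` then `H` is a coordinate tuple at all points over the
chart. -/
theorem IsCoord.of_chart {K : Type*} [RCLike K]
    {V W P : Type*} [NormedAddCommGroup V] [NormedSpace K V]
    [FiniteDimensional K V] [NormedAddCommGroup W] [NormedSpace K W] [FiniteDimensional K W]
    [NormedAddCommGroup P] [NormedSpace K P] [FiniteDimensional K P]
    {A : Subalgebra K (Y → K)} {D : LocalQuotient K V W P Z A}
    {m : ℕ} {z₀ : Z} {h : Fin m → Y → K}
    {H : V → EuclideanSpace K (Fin m)} (hc : D.IsCoord z₀ h H)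
    {e : OpenPartialHomeomorph Y (EuclideanSpace K (Fin m))} (he : IsRegularChart A e)
    (heH : ∀ z, e (D.q z) = H (D.ι z)) {z : Z} (hz : D.q z ∈ e.source) : D.IsCoord z h H where
  mem := hc.mem
  contDiff := hc.contDiff
  eq := hc.eq
  ker := by
    intro t ht ht'
    refine D.ker z t ht fun k hk G hG hkG => ?_
    have hφ : HasFDerivAt (k ∘ e.symm) (fderiv K (k ∘ e.symm) (H (D.ι z))) (H (D.ι z)) := by
      rw [← heH]
      exact (((he.analytic k hk).contDiffAt
        (e.open_target.mem_nhds (e.map_source hz))).differentiableAt (by simp)).hasFDerivAt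
    have hH : HasFDerivAt H (fderiv K H (D.ι z)) (D.ι z) :=
      (hc.contDiff.differentiable (by simp) _).hasFDerivAt
    have hG' : HasFDerivAt G (fderiv K G (D.ι z)) (D.ι z) :=
      (hG.differentiable (by simp) _).hasFDerivAt
    -- Near `z` the function factors on the level set through `H`, so its differential vanishes
    -- wherever that of `H` does.
    have h0 := D.fderiv_eq_zero_of_eventually z (hG'.sub (hφ.comp _ hH)) (a := 0) (t := t) ?_ ht
    · rw [sub_apply, ContinuousLinearMap.comp_apply, ht', map_zero,
        sub_zero] at h0
      exact h0
    · filter_upwards [D.q_continuous.continuousAt.eventually_mem (e.open_source.mem_nhds hz)]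
        with z' hz'
      change G (D.ι z') - k (e.symm (H (D.ι z'))) = 0
      rw [← heH, e.left_inv hz', hkG, sub_self]

variable {A : Subalgebra ℝ (Y → ℝ)} (D : LocalQuotient ℝ V W P Z A)

/-- The Jacobian determinant of the constraints, the coordinates and the orbit directions. -/
def jac {m : ℕ} (J : (W × EuclideanSpace ℝ (Fin m) × P) ≃L[ℝ] V) (ℓ : V → V →L[ℝ] P)
    (H : V → EuclideanSpace ℝ (Fin m)) (v : V) : ℝ :=
  ((J : (W × EuclideanSpace ℝ (Fin m) × P) →L[ℝ] V).comp
    ((fderiv ℝ D.F v).prod ((fderiv ℝ H v).prod (ℓ v)))).det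

variable {m : ℕ} (J : (W × EuclideanSpace ℝ (Fin m) × P) ≃L[ℝ] V) {ℓ : V → V →L[ℝ] P}

theorem continuous_jac (hℓ : Continuous ℓ) {H : V → EuclideanSpace ℝ (Fin m)}
    (hH : ContDiff ℝ ω H) : Continuous (D.jac J ℓ H) := by
  refine ContinuousLinearMap.continuous_det.comp ?_
  have h1 : Continuous (fderiv ℝ D.F) := D.contDiff.continuous_fderiv (by simp)
  have h2 : Continuous (fderiv ℝ H) := hH.continuous_fderiv (by simp)
  exact continuous_const.clm_comp
    ((ContinuousLinearMap.prodₗᵢ ℝ).continuous.comp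
      (h1.prodMk ((ContinuousLinearMap.prodₗᵢ ℝ).continuous.comp (h2.prodMk hℓ))))

variable {D J}

theorem IsCoord.injective (hℓ' : ∀ z, Function.Injective fun p => ℓ (D.ι z) (D.act' z p))
    {z : Z} {h : Fin m → Y → ℝ} {H : V → EuclideanSpace ℝ (Fin m)} (hc : D.IsCoord z h H) :
    Function.Injective ((fderiv ℝ D.F (D.ι z)).prod ((fderiv ℝ H (D.ι z)).prod (ℓ (D.ι z)))) := by
  rw [injective_iff_map_eq_zero]
  intro t ht
  have h1 : fderiv ℝ D.F (D.ι z) t = 0 := congrArg Prod.fst ht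
  have h2 : fderiv ℝ H (D.ι z) t = 0 := congrArg (fun x => x.2.1) ht
  have h3 : ℓ (D.ι z) t = 0 := congrArg (fun x => x.2.2) ht
  obtain ⟨p, rfl⟩ := hc.ker t h1 h2
  have : p = 0 := hℓ' z (by simp only [h3, map_zero])
  rw [this, map_zero]

theorem IsCoord.jac_ne_zero (hℓ' : ∀ z, Function.Injective fun p => ℓ (D.ι z) (D.act' z p))
    {z : Z} {h : Fin m → Y → ℝ} {H : V → EuclideanSpace ℝ (Fin m)} (hc : D.IsCoord z h H) :
    D.jac J ℓ H (D.ι z) ≠ 0 := by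
  have h1 : Function.Injective ((J : (W × EuclideanSpace ℝ (Fin m) × P) →L[ℝ] V).comp
    ((fderiv ℝ D.F (D.ι z)).prod ((fderiv ℝ H (D.ι z)).prod (ℓ (D.ι z))))).toLinearMap :=
    J.injective.comp (hc.injective hℓ')
  have h2 := LinearEquiv.isUnit_det' (LinearEquiv.ofInjectiveEndo _ h1)
  exact h2.ne_zero

/-- Coordinates with positive Jacobian exist in positive dimension. -/
theorem exists_isCoord_pos (hm0 : 0 < m)
    (hℓ' : ∀ z, Function.Injective fun p => ℓ (D.ι z) (D.act' z p))
    (hm : m + finrank ℝ P + finrank ℝ W = finrank ℝ V) (z : Z) :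
    ∃ h H, D.IsCoord (m := m) z h H ∧ 0 < D.jac J ℓ H (D.ι z) := by
  obtain ⟨h, H, hc⟩ := D.exists_isCoord z hm
  rcases (hc.jac_ne_zero (J := J) hℓ').lt_or_gt with hneg | hpos
  -- A negative Jacobian is corrected by changing the sign of the first coordinate, which exists
  -- because `m` is positive.
  · obtain ⟨d, R, hR, hdet, hRinj⟩ := exists_flip hm0
    have hd : ∀ v, fderiv ℝ (fun v => R (H v)) v = R.comp (fderiv ℝ H v) := fun v =>
      (R.hasFDerivAt.comp v (hc.contDiff.differentiable (by simp) v).hasFDerivAt).fderiv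
    refine ⟨fun i => d i • h i, fun v => R (H v), ⟨fun i => A.smul_mem (hc.mem i) _,
      R.contDiff.comp hc.contDiff, ?_, ?_⟩, ?_⟩
    · intro z i
      rw [hR, hc.eq]
      rfl
    · intro t ht ht'
      rw [hd, ContinuousLinearMap.comp_apply] at ht'
      exact hc.ker t ht (hRinj (by rw [ht', map_zero]))
    · obtain ⟨c, hc0, hce⟩ := exists_det_eq J (fderiv ℝ D.F (D.ι z)) (fderiv ℝ H (D.ι z))
        (fderiv ℝ (fun v => R (H v)) (D.ι z)) (ℓ (D.ι z)) R (hc.injective hℓ')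
        (fun t _ => by rw [hd]; rfl)
      change 0 < ContinuousLinearMap.det _
      rw [hce, hdet]
      rw [jac] at hneg
      nlinarith [mul_pos_of_neg_of_neg hneg (neg_neg_of_pos hc0)]
  · exact ⟨h, H, hc, hpos⟩

/-- Quotients with connected fibres in the real category are oriented manifolds. -/
theorem isOrientedManifold_real [T2Space Y] [SecondCountableTopology Y]
    (D : LocalQuotient ℝ V W P Z A) (hfib : ∀ y, IsPreconnected (D.q ⁻¹' {y}))
    (ℓ : V → V →L[ℝ] P) (hℓ : Continuous ℓ)
    (hℓ' : ∀ z, Function.Injective fun p => ℓ (D.ι z) (D.act' z p))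
    (d : ℤ) (hd : d = finrank ℝ V - finrank ℝ W - finrank ℝ P) :
    IsOrientedManifold A d := by
  rcases isEmpty_or_nonempty Z with hZ | ⟨⟨z⟩⟩
  · refine ⟨inferInstance, inferInstance, Or.inl ⟨fun y => ?_⟩⟩
    exact hZ.false (D.q_surj y).choose
  have hm := D.finrank_cotangent z
  set m := finrank ℝ (D.cotangent z)
  have hdm : d = m := by omega
  rw [hdm]
  -- In dimension zero there is no coordinate to reflect, but every determinant is one.
  rcases Nat.eq_zero_or_pos m with hm0 | hm0
  · have hch : ∀ y : Y, ∃ e : OpenPartialHomeomorph Y (EuclideanSpace ℝ (Fin m)),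
        y ∈ e.source ∧ IsRegularChart A e := by
      intro y
      obtain ⟨z, rfl⟩ := D.q_surj y
      obtain ⟨h, H, hc⟩ := D.exists_isCoord z hm
      obtain ⟨e, he, -, hr, -⟩ := D.exists_chart hm hc Filter.univ_mem
      exact ⟨e, he, hr⟩
    choose e he hr using hch
    refine isOrientedManifold_of_charts e he hr fun y y' x hx => ?_
    have : finrank ℝ (EuclideanSpace ℝ (Fin m)) = 0 := by simp [hm0]
    rw [ContinuousLinearMap.det, LinearMap.det_eq_one_of_finrank_eq_zero this]
    exact one_pos
  · have hfr : finrank ℝ (W × EuclideanSpace ℝ (Fin m) × P) = finrank ℝ V := by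
      rw [finrank_prod, finrank_prod, finrank_euclideanSpace_fin]
      omega
    let J : (W × EuclideanSpace ℝ (Fin m) × P) ≃L[ℝ] V :=
      (LinearEquiv.ofFinrankEq _ _ hfr).toContinuousLinearEquiv
    have hch : ∀ y : Y, ∃ (e : OpenPartialHomeomorph Y (EuclideanSpace ℝ (Fin m)))
        (h : Fin m → Y → ℝ) (H : V → EuclideanSpace ℝ (Fin m)),
        y ∈ e.source ∧ IsRegularChart A e ∧ (∀ z, e (D.q z) = H (D.ι z)) ∧
        (∀ z, D.q z ∈ e.source → D.IsCoord z h H ∧ 0 < D.jac J ℓ H (D.ι z)) := by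
      intro y
      obtain ⟨z, rfl⟩ := D.q_surj y
      obtain ⟨h, H, hc, hpos⟩ := exists_isCoord_pos (J := J) hm0 hℓ' hm z
      have hcont : Continuous fun z' => D.jac J ℓ H (D.ι z') :=
        (D.continuous_jac J hℓ hc.contDiff).comp D.isEmbedding.continuous
      obtain ⟨e, he, hsub, hr, heH⟩ := D.exists_chart hm hc
        ((isOpen_lt continuous_const hcont).mem_nhds hpos)
      refine ⟨e, h, H, he, hr, heH, fun z' hz' => ⟨hc.of_chart hr heH hz', ?_⟩⟩
      obtain ⟨z₁, hz₁, hq⟩ := hsub hz'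
      by_contra hneg
      -- The fibre is connected and meets the region of positive Jacobian. A nonpositive value on it
      -- would force a zero by the intermediate value theorem, but the Jacobian of a coordinate
      -- tuple never vanishes.
      have hpre := (hfib (D.q z')).image (fun z' => D.jac J ℓ H (D.ι z')) hcont.continuousOn
      have h0 : (0 : ℝ) ∈ (fun z' => D.jac J ℓ H (D.ι z')) '' (D.q ⁻¹' {D.q z'}) :=
        hpre.ordConnected.out ⟨z', rfl, rfl⟩ ⟨z₁, hq, rfl⟩ ⟨not_lt.1 hneg, le_of_lt hz₁⟩
      obtain ⟨z₂, hz₂, h20⟩ := h0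
      have hz₂' : D.q z₂ ∈ e.source := by
        have : D.q z₂ = D.q z' := hz₂
        rwa [this]
      exact (hc.of_chart hr heH hz₂').jac_ne_zero hℓ' h20
    choose e h H he hr heH hpos using hch
    refine isOrientedManifold_of_charts e he hr fun y y' x hx => ?_
    obtain ⟨z, hz⟩ := D.q_surj ((e y).symm x)
    have hx' := hx
    rw [OpenPartialHomeomorph.trans_source] at hx'
    have hz1 : D.q z ∈ (e y).source := by rw [hz]; exact (e y).map_target hx'.1
    have hz2 : D.q z ∈ (e y').source := by rw [hz]; exact hx'.2
    have hxz : x = H y (D.ι z) := by rw [← heH, hz, (e y).right_inv hx'.1]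
    obtain ⟨hc1, hp1⟩ := hpos y z hz1
    obtain ⟨hc2, hp2⟩ := hpos y' z hz2
    set τ := fderiv ℝ ((e y).symm.trans (e y')) x with hτ
    have hτ' : HasFDerivAt ((e y).symm.trans (e y')) τ (H y (D.ι z)) := by
      rw [← hxz]
      exact ((((hr y).contDiffOn_trans (hr y')).contDiffAt
        (((e y).symm.trans (e y')).open_source.mem_nhds hx)).differentiableAt (by simp)).hasFDerivAt
    -- On the tangent space the two coordinate tuples differ by the differential `τ` of the
    -- transition map, so the quotient of the two positive Jacobians is a positive multiple of its
    -- determinant.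
    obtain ⟨c, hc0, hce⟩ := exists_det_eq J (fderiv ℝ D.F (D.ι z)) (fderiv ℝ (H y) (D.ι z))
        (fderiv ℝ (H y') (D.ι z)) (ℓ (D.ι z)) τ (hc1.injective hℓ') (fun t ht => by
      have d1 : HasFDerivAt (H y) (fderiv ℝ (H y) (D.ι z)) (D.ι z) :=
        (hc1.contDiff.differentiable (by simp) _).hasFDerivAt
      have d2 : HasFDerivAt (H y') (fderiv ℝ (H y') (D.ι z)) (D.ι z) :=
        (hc2.contDiff.differentiable (by simp) _).hasFDerivAt
      have h0 := D.fderiv_eq_zero_of_eventually z (d2.sub (hτ'.comp _ d1)) (a := 0) (t := t) ?_ ht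
      · exact sub_eq_zero.1 h0
      · filter_upwards [D.q_continuous.continuousAt.eventually_mem
          ((e y).open_source.mem_nhds hz1)] with z' hz'
        change H y' (D.ι z') - e y' ((e y).symm (H y (D.ι z'))) = 0
        rw [← heH, ← heH, (e y).left_inv hz', sub_self])
    rw [jac, hce] at hp2
    have h3 : 0 < c * τ.det := (pos_iff_pos_of_mul_pos hp2).2 hp1
    exact (pos_iff_pos_of_mul_pos h3).1 hc0

end LocalQuotient

end RealOrientation

/-! ### Quaternions over `ℝ` and `ℂ` -/

/-- The quaternion algebra over `K`, a normed algebra for `K = ℝ` and `K = ℂ`. -/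
def Quat (K : Type*) [RCLike K] : Type _ := Quaternion K

namespace Quat

variable {K : Type*} [RCLike K]

instance : Ring (Quat K) := inferInstanceAs (Ring (Quaternion K))
instance : Algebra K (Quat K) := inferInstanceAs (Algebra K (Quaternion K))
instance : Module.Finite K (Quat K) := inferInstanceAs (Module.Finite K (Quaternion K))

theorem finrank_eq_four : Module.finrank K (Quat K) = 4 := Quaternion.finrank_eq_four (R := K)

/-- The real part. -/
def re (x : Quat K) : K := QuaternionAlgebra.re x
/-- The first imaginary coordinate. -/
def imI (x : Quat K) : K := QuaternionAlgebra.imI x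
/-- The second imaginary coordinate. -/
def imJ (x : Quat K) : K := QuaternionAlgebra.imJ x
/-- The third imaginary coordinate. -/
def imK (x : Quat K) : K := QuaternionAlgebra.imK x

@[ext]
theorem ext {x y : Quat K} (h0 : x.re = y.re) (h1 : x.imI = y.imI) (h2 : x.imJ = y.imJ)
    (h3 : x.imK = y.imK) : x = y := QuaternionAlgebra.ext h0 h1 h2 h3

/-- The quaternion with given coordinates. -/
def mk (a b c d : K) : Quat K := (⟨a, b, c, d⟩ : Quaternion K)

@[simp] theorem re_mk (a b c d : K) : (mk a b c d).re = a := rfl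
@[simp] theorem imI_mk (a b c d : K) : (mk a b c d).imI = b := rfl
@[simp] theorem imJ_mk (a b c d : K) : (mk a b c d).imJ = c := rfl
@[simp] theorem imK_mk (a b c d : K) : (mk a b c d).imK = d := rfl

variable (x y : Quat K) (a : K)

@[simp] theorem re_zero : (0 : Quat K).re = 0 := rfl
@[simp] theorem imI_zero : (0 : Quat K).imI = 0 := rfl
@[simp] theorem imJ_zero : (0 : Quat K).imJ = 0 := rfl
@[simp] theorem imK_zero : (0 : Quat K).imK = 0 := rfl
@[simp] theorem re_one : (1 : Quat K).re = 1 := rfl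
@[simp] theorem imI_one : (1 : Quat K).imI = 0 := rfl
@[simp] theorem imJ_one : (1 : Quat K).imJ = 0 := rfl
@[simp] theorem imK_one : (1 : Quat K).imK = 0 := rfl
@[simp] theorem re_add : (x + y).re = x.re + y.re := rfl
@[simp] theorem imI_add : (x + y).imI = x.imI + y.imI := rfl
@[simp] theorem imJ_add : (x + y).imJ = x.imJ + y.imJ := rfl
@[simp] theorem imK_add : (x + y).imK = x.imK + y.imK := rfl
@[simp] theorem re_neg : (-x).re = -x.re := rfl
@[simp] theorem imI_neg : (-x).imI = -x.imI := rfl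
@[simp] theorem imJ_neg : (-x).imJ = -x.imJ := rfl
@[simp] theorem imK_neg : (-x).imK = -x.imK := rfl
@[simp] theorem re_sub : (x - y).re = x.re - y.re := rfl
@[simp] theorem imI_sub : (x - y).imI = x.imI - y.imI := rfl
@[simp] theorem imJ_sub : (x - y).imJ = x.imJ - y.imJ := rfl
@[simp] theorem imK_sub : (x - y).imK = x.imK - y.imK := rfl
@[simp] theorem re_smul : (a • x).re = a * x.re := rfl
@[simp] theorem imI_smul : (a • x).imI = a * x.imI := rfl
@[simp] theorem imJ_smul : (a • x).imJ = a * x.imJ := rfl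
@[simp] theorem imK_smul : (a • x).imK = a * x.imK := rfl
@[simp] theorem re_mul : (x * y).re =
    x.re * y.re - x.imI * y.imI - x.imJ * y.imJ - x.imK * y.imK :=
  Quaternion.re_mul (R := K) x y
@[simp] theorem imI_mul : (x * y).imI =
    x.re * y.imI + x.imI * y.re + x.imJ * y.imK - x.imK * y.imJ :=
  Quaternion.imI_mul (R := K) x y
@[simp] theorem imJ_mul : (x * y).imJ =
    x.re * y.imJ - x.imI * y.imK + x.imJ * y.re + x.imK * y.imI :=
  Quaternion.imJ_mul (R := K) x y
@[simp] theorem imK_mul : (x * y).imK =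
    x.re * y.imK + x.imI * y.imJ - x.imJ * y.imI + x.imK * y.re :=
  Quaternion.imK_mul (R := K) x y

/-- The coordinates as a linear equivalence. -/
def toPi : Quat K ≃ₗ[K] (Fin 4 → K) where
  toFun x := ![x.re, x.imI, x.imJ, x.imK]
  invFun v := mk (v 0) (v 1) (v 2) (v 3)
  map_add' x y := by ext i; fin_cases i <;> simp
  map_smul' a x := by ext i; fin_cases i <;> simp
  left_inv x := rfl
  right_inv v := by ext i; fin_cases i <;> simp

/-- The sum of the norms of the coordinates is submultiplicative over `ℝ` and over `ℂ` alike; the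
reduced norm is isotropic over `ℂ` and could not serve. -/
instance : Norm (Quat K) := ⟨fun x => ‖x.re‖ + ‖x.imI‖ + ‖x.imJ‖ + ‖x.imK‖⟩

theorem norm_def : ‖x‖ = ‖x.re‖ + ‖x.imI‖ + ‖x.imJ‖ + ‖x.imK‖ := rfl

/-- The norm makes the quaternions a normed group. -/
@[reducible]
def normedAddCommGroup : NormedAddCommGroup (Quat K) :=
  AddGroupNorm.toNormedAddCommGroup
    { toFun := fun x => ‖x.re‖ + ‖x.imI‖ + ‖x.imJ‖ + ‖x.imK‖
      map_zero' := by simp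
      add_le' := fun x y => by
        have h0 := norm_add_le x.re y.re
        have h1 := norm_add_le x.imI y.imI
        have h2 := norm_add_le x.imJ y.imJ
        have h3 := norm_add_le x.imK y.imK
        simp only [re_add, imI_add, imJ_add, imK_add]
        linarith
      neg' := fun x => by simp
      eq_zero_of_map_eq_zero' := fun x h => by
        have h0 := norm_nonneg x.re
        have h1 := norm_nonneg x.imI
        have h2 := norm_nonneg x.imJ
        have h3 := norm_nonneg x.imK
        ext <;> refine norm_eq_zero.1 ?_ <;> linarith }

instance : NormedRing (Quat K) where
  __ := normedAddCommGroup
  __ := (inferInstance : Ring (Quat K))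
  dist_eq _ _ := rfl
  norm_mul_le x y := by
    change ‖(x * y).re‖ + ‖(x * y).imI‖ + ‖(x * y).imJ‖ + ‖(x * y).imK‖ ≤
      (‖x.re‖ + ‖x.imI‖ + ‖x.imJ‖ + ‖x.imK‖) * (‖y.re‖ + ‖y.imI‖ + ‖y.imJ‖ + ‖y.imK‖)
    have h0 : ‖(x * y).re‖ ≤ ‖x.re‖ * ‖y.re‖ + ‖x.imI‖ * ‖y.imI‖ + ‖x.imJ‖ * ‖y.imJ‖ +
        ‖x.imK‖ * ‖y.imK‖ := by
      rw [re_mul]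
      refine (norm_sub_le _ _).trans ?_
      gcongr
      · refine (norm_sub_le _ _).trans ?_
        gcongr
        · refine (norm_sub_le _ _).trans ?_
          simp
        · simp
      · simp
    have h1 : ‖(x * y).imI‖ ≤ ‖x.re‖ * ‖y.imI‖ + ‖x.imI‖ * ‖y.re‖ + ‖x.imJ‖ * ‖y.imK‖ +
        ‖x.imK‖ * ‖y.imJ‖ := by
      rw [imI_mul]
      refine (norm_sub_le _ _).trans ?_
      gcongr
      · refine (norm_add_le _ _).trans ?_
        gcongr
        · refine (norm_add_le _ _).trans ?_
          simp
        · simp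
      · simp
    have h2 : ‖(x * y).imJ‖ ≤ ‖x.re‖ * ‖y.imJ‖ + ‖x.imI‖ * ‖y.imK‖ + ‖x.imJ‖ * ‖y.re‖ +
        ‖x.imK‖ * ‖y.imI‖ := by
      rw [imJ_mul]
      refine (norm_add_le _ _).trans ?_
      gcongr
      · refine (norm_add_le _ _).trans ?_
        gcongr
        · refine (norm_sub_le _ _).trans ?_
          simp
        · simp
      · simp
    have h3 : ‖(x * y).imK‖ ≤ ‖x.re‖ * ‖y.imK‖ + ‖x.imI‖ * ‖y.imJ‖ + ‖x.imJ‖ * ‖y.imI‖ +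
        ‖x.imK‖ * ‖y.re‖ := by
      rw [imK_mul]
      refine (norm_add_le _ _).trans ?_
      gcongr
      · refine (norm_sub_le _ _).trans ?_
        gcongr
        · refine (norm_add_le _ _).trans ?_
          simp
        · simp
      · simp
    linarith

instance : NormedAlgebra K (Quat K) where
  norm_smul_le a x := by
    simp only [norm_def, re_smul, imI_smul, imJ_smul, imK_smul, norm_mul]
    linarith

/-- The conjugate quaternion, as a linear map. -/
def conj : Quat K →ₗ[K] Quat K where
  toFun x := mk x.re (-x.imI) (-x.imJ) (-x.imK)
  map_add' x y := by ext <;> simp <;> ring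
  map_smul' a x := by ext <;> simp

@[simp] theorem re_conj : (conj x).re = x.re := rfl
@[simp] theorem imI_conj : (conj x).imI = -x.imI := rfl
@[simp] theorem imJ_conj : (conj x).imJ = -x.imJ := rfl
@[simp] theorem imK_conj : (conj x).imK = -x.imK := rfl

/-- The reduced norm. -/
def N (x : Quat K) : K := x.re ^ 2 + x.imI ^ 2 + x.imJ ^ 2 + x.imK ^ 2

theorem conj_conj : conj (conj x) = x := by ext <;> simp

theorem conj_mul : conj (x * y) = conj y * conj x := by ext <;> simp <;> ring

theorem mul_conj : x * conj x = N x • 1 := by ext <;> simp [N] <;> ring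

theorem conj_mul_self : conj x * x = N x • 1 := by ext <;> simp [N] <;> ring

theorem N_mul : N (x * y) = N x * N y := by simp [N]; ring

theorem N_conj : N (conj x) = N x := by simp [N]

@[simp] theorem N_one : N (1 : Quat K) = 1 := by simp [N]

@[simp] theorem conj_one : conj (1 : Quat K) = 1 := by ext <;> simp

theorem re_mul_comm : (x * y).re = (y * x).re := by simp; ring

theorem re_mul_conj_self : (x * conj x).re = N x := by simp [N]; ring

variable {x y}

theorem mul_conj_of_N_eq_one (h : N x = 1) : x * conj x = 1 := by rw [mul_conj, h, one_smul]

theorem conj_mul_of_N_eq_one (h : N x = 1) : conj x * x = 1 := by rw [conj_mul_self, h, one_smul]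

/-- Non-degeneracy of the trace form, tested on the standard basis. -/
theorem eq_zero_of_re_mul (h : ∀ y, (x * y).re = 0) : x = 0 := by
  ext
  · simpa using h (mk 1 0 0 0)
  · simpa using h (mk 0 1 0 0)
  · simpa using h (mk 0 0 1 0)
  · simpa using h (mk 0 0 0 1)

theorem eq_zero_of_re_mul_pure (hx : x.re = 0) (h : ∀ y : Quat K, y.re = 0 → (x * y).re = 0) :
    x = 0 := by
  refine eq_zero_of_re_mul fun y => ?_
  have := h (mk 0 y.imI y.imJ y.imK) rfl
  simp [hx] at this ⊢
  exact this

/-- Elements commuting with a common nonzero pure quaternion commute. -/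
theorem comm_of_comm_pure {z : Quat K} (hz : z ≠ 0) (hz0 : z.re = 0) (hx : z * x = x * z)
    (hy : z * y = y * z) : x * y = y * x := by
  have h2 : (2 : K) ≠ 0 := two_ne_zero
  have cx1 := congrArg Quat.imI hx
  have cx2 := congrArg Quat.imJ hx
  have cx3 := congrArg Quat.imK hx
  have cy1 := congrArg Quat.imI hy
  have cy2 := congrArg Quat.imJ hy
  have cy3 := congrArg Quat.imK hy
  simp only [imI_mul, imJ_mul, imK_mul, hz0, zero_mul, mul_zero, zero_add, add_zero, zero_sub]
    at cx1 cx2 cx3 cy1 cy2 cy3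
  have e1 : x.imJ * z.imK = x.imK * z.imJ := by
    apply mul_left_cancel₀ h2; linear_combination -cx1
  have e2 : x.imK * z.imI = x.imI * z.imK := by
    apply mul_left_cancel₀ h2; linear_combination -cx2
  have e3 : x.imI * z.imJ = x.imJ * z.imI := by
    apply mul_left_cancel₀ h2; linear_combination -cx3
  have f1 : y.imJ * z.imK = y.imK * z.imJ := by
    apply mul_left_cancel₀ h2; linear_combination -cy1
  have f2 : y.imK * z.imI = y.imI * z.imK := by
    apply mul_left_cancel₀ h2; linear_combination -cy2
  have f3 : y.imI * z.imJ = y.imJ * z.imI := by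
    apply mul_left_cancel₀ h2; linear_combination -cy3
  -- Commuting with `z` means that the imaginary part is parallel to `z`; the factor is found by
  -- dividing by a nonzero coordinate of `z`.
  have key : ∃ a b : K, ∃ w : Quat K, x.imI = a * w.imI ∧ x.imJ = a * w.imJ ∧ x.imK = a * w.imK ∧
      y.imI = b * w.imI ∧ y.imJ = b * w.imJ ∧ y.imK = b * w.imK := by
    by_cases h1 : z.imI = 0
    · by_cases h2 : z.imJ = 0
      · have h3 : z.imK ≠ 0 := fun h3 => hz (Quat.ext hz0 h1 h2 h3)
        refine ⟨x.imK / z.imK, y.imK / z.imK, z, ?_, ?_, ?_, ?_, ?_, ?_⟩ <;> field_simp <;>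
          first | linear_combination e1 | linear_combination -e2 | linear_combination f1 |
            linear_combination -f2
      · refine ⟨x.imJ / z.imJ, y.imJ / z.imJ, z, ?_, ?_, ?_, ?_, ?_, ?_⟩ <;> field_simp <;>
          first | linear_combination e3 | linear_combination -e1 | linear_combination f3 |
            linear_combination -f1
    · refine ⟨x.imI / z.imI, y.imI / z.imI, z, ?_, ?_, ?_, ?_, ?_, ?_⟩ <;> field_simp <;>
          first | linear_combination e2 | linear_combination -e3 | linear_combination f2 |
            linear_combination -f3
  obtain ⟨a, b, w, a1, a2, a3, b1, b2, b3⟩ := key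
  ext <;> simp [a1, a2, a3, b1, b2, b3] <;> ring

/-- Derivations of the quaternion algebra are inner. -/
theorem exists_inner_derivation (D : Quat K →ₗ[K] Quat K)
    (hD : ∀ x y, D (x * y) = D x * y + x * D y) :
    ∃ x : Quat K, x.re = 0 ∧ ∀ y, D y = x * y - y * x := by
  have h2 : (2 : K) ≠ 0 := two_ne_zero
  let i : Quat K := mk 0 1 0 0
  let j : Quat K := mk 0 0 1 0
  let k : Quat K := mk 0 0 0 1
  have hone : D 1 = 0 := by
    have := hD 1 1
    simpa using this
  have hii : D i * i + i * D i = 0 := by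
    rw [← hD, show i * i = -1 by ext <;> simp [i], map_neg, hone, neg_zero]
  have hjj : D j * j + j * D j = 0 := by
    rw [← hD, show j * j = -1 by ext <;> simp [j], map_neg, hone, neg_zero]
  have hk : D k = D i * j + i * D j := by
    rw [← hD, show i * j = k by ext <;> simp [i, j, k]]
  have hij : D i * j + i * D j + (D j * i + j * D i) = 0 := by
    rw [← hD, ← hD, ← map_add, show i * j + j * i = 0 by ext <;> simp [i, j], map_zero]
  have i0 := congrArg Quat.re hii
  have i1 := congrArg Quat.imI hii
  have j0 := congrArg Quat.re hjj
  have j2 := congrArg Quat.imJ hjj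
  have r0 := congrArg Quat.re hij
  simp [i, j] at i0 i1 j0 j2 r0
  have i0' : (D i).imI = 0 := i0
  have i1' : (D i).re = 0 := i1
  have j0' : (D j).imJ = 0 := j0
  have j2' : (D j).re = 0 := j2
  have r0' : (D j).imI = -(D i).imJ := by apply mul_left_cancel₀ h2; linear_combination -r0
  -- The solution of `D i = [x, i]` and `D j = [x, j]`. The relations among `i` and `j` make the
  -- remaining coordinates agree.
  let x : Quat K := mk 0 ((D j).imK / 2) (-(D i).imK / 2) ((D i).imJ / 2)
  have hDi : D i = x * i - i * x := by
    ext <;> simp [x, i] <;>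
      first | exact i0' | exact i1' | (change (D i).imK = _; ring)
  have hDj : D j = x * j - j * x := by
    ext <;> simp [x, j] <;>
      first | exact j2' | exact j0' |
        (change (D j).imI = _; rw [r0']; ring)
  have hDk : D k = x * k - k * x := by
    rw [hk, hDi, hDj, show k = i * j by ext <;> simp [i, j, k]]
    noncomm_ring
  refine ⟨x, rfl, fun y => ?_⟩
  have hy : y = y.re • 1 + y.imI • i + y.imJ • j + y.imK • k := by
    ext <;> simp [i, j, k]
  rw [hy]
  simp only [map_add, map_smul, hone, hDi, hDj, hDk, mul_add, add_mul, smul_mul_assoc,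
    mul_smul_comm, smul_sub, one_mul, mul_one, smul_zero]
  abel

theorem exists_not_comm : ∃ x y : Quat K, x * y ≠ y * x := by
  refine ⟨mk 0 1 0 0, mk 0 0 1 0, fun h => ?_⟩
  have := congrArg Quat.imK h
  simp at this
  have h2 : (2 : K) ≠ 0 := two_ne_zero
  exact h2 (by linear_combination this)

end Quat

/-! ### The equations of the relative homomorphism space -/

section Equations

open Module Quat

variable {g n : ℕ}

/-- The generators, as a disjoint union of finite types. -/
def SurfaceGen.equivSum : SurfaceGen g n ≃ (Fin g ⊕ Fin g) ⊕ Fin n where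
  toFun
    | .mu j => .inl (.inl j)
    | .nu j => .inl (.inr j)
    | .beta i => .inr i
  invFun
    | .inl (.inl j) => .mu j
    | .inl (.inr j) => .nu j
    | .inr i => .beta i
  left_inv s := by cases s <;> rfl
  right_inv s := by rcases s with (_ | _) | _ <;> rfl

instance : DecidableEq (SurfaceGen g n) := SurfaceGen.equivSum.decidableEq
instance : Fintype (SurfaceGen g n) := Fintype.ofEquiv _ SurfaceGen.equivSum.symm

theorem SurfaceGen.sum_eq {M : Type*} [AddCommMonoid M] (f : SurfaceGen g n → M) :
    ∑ s, f s = (∑ j, f (.mu j) + ∑ j, f (.nu j)) + ∑ i, f (.beta i) := by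
  rw [← SurfaceGen.equivSum.symm.sum_comp, Fintype.sum_sum_type, Fintype.sum_sum_type]
  rfl

variable {K : Type*} [RCLike K]

/-- A commutator `[μ_j, ν_j]` or a generator `β_i`. -/
def block (v : SurfaceGen g n → Quat K) : Fin g ⊕ Fin n → Quat K
  | .inl j => v (.mu j) * v (.nu j) * conj (v (.mu j)) * conj (v (.nu j))
  | .inr i => v (.beta i)

/-- The factors of the relator, in order. -/
def blocks (g n : ℕ) : List (Fin g ⊕ Fin n) :=
  (List.finRange g).map .inl ++ (List.finRange n).map .inr

theorem nodup_blocks : (blocks g n).Nodup := by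
  refine List.Nodup.append ((List.nodup_finRange g).map Sum.inl_injective)
    ((List.nodup_finRange n).map Sum.inr_injective) ?_
  intro b h1 h2
  obtain ⟨j, -, rfl⟩ := List.mem_map.1 h1
  obtain ⟨i, -, h⟩ := List.mem_map.1 h2
  cases h

theorem mem_blocks (b : Fin g ⊕ Fin n) : b ∈ blocks g n := by
  rcases b with j | i <;> simp [blocks]

/-- The value of the relator. -/
def relator (v : SurfaceGen g n → Quat K) : Quat K := ((blocks g n).map (block v)).prod

/-- The block containing a generator. -/
def SurfaceGen.toBlock : SurfaceGen g n → Fin g ⊕ Fin n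
  | .mu j => .inl j
  | .nu j => .inl j
  | .beta i => .inr i

theorem block_update (v : SurfaceGen g n → Quat K) (s : SurfaceGen g n) (x : Quat K)
    {b : Fin g ⊕ Fin n} (hb : b ≠ s.toBlock) : block (Function.update v s x) b = block v b := by
  rcases b with j | i
  · have h1 : SurfaceGen.mu j ≠ s := by rintro rfl; exact hb rfl
    have h2 : SurfaceGen.nu j ≠ s := by rintro rfl; exact hb rfl
    simp [block, Function.update_of_ne h1, Function.update_of_ne h2]
  · have h1 : SurfaceGen.beta i ≠ s := by rintro rfl; exact hb rfl
    simp [block, Function.update_of_ne h1]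

/-- The coordinates as continuous linear maps. -/
def reL : Quat K →L[K] K := LinearMap.toContinuousLinearMap
  { toFun := Quat.re, map_add' := re_add, map_smul' := fun a x => re_smul x a }
/-- The first imaginary coordinate, as a continuous linear map. -/
def imIL : Quat K →L[K] K := LinearMap.toContinuousLinearMap
  { toFun := Quat.imI, map_add' := imI_add, map_smul' := fun a x => imI_smul x a }
/-- The second imaginary coordinate, as a continuous linear map. -/
def imJL : Quat K →L[K] K := LinearMap.toContinuousLinearMap
  { toFun := Quat.imJ, map_add' := imJ_add, map_smul' := fun a x => imJ_smul x a }
/-- The third imaginary coordinate, as a continuous linear map. -/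
def imKL : Quat K →L[K] K := LinearMap.toContinuousLinearMap
  { toFun := Quat.imK, map_add' := imK_add, map_smul' := fun a x => imK_smul x a }

@[fun_prop] theorem contDiff_re {m : WithTop ℕ∞} : ContDiff K m (Quat.re : Quat K → K) :=
  (show Quat K →L[K] K from reL).contDiff
@[fun_prop] theorem contDiff_imI {m : WithTop ℕ∞} : ContDiff K m (Quat.imI : Quat K → K) :=
  (show Quat K →L[K] K from imIL).contDiff
@[fun_prop] theorem contDiff_imJ {m : WithTop ℕ∞} : ContDiff K m (Quat.imJ : Quat K → K) :=
  (show Quat K →L[K] K from imJL).contDiff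
@[fun_prop] theorem contDiff_imK {m : WithTop ℕ∞} : ContDiff K m (Quat.imK : Quat K → K) :=
  (show Quat K →L[K] K from imKL).contDiff
@[fun_prop] theorem contDiff_conj {m : WithTop ℕ∞} : ContDiff K m (conj : Quat K → Quat K) :=
  (LinearMap.toContinuousLinearMap (conj : Quat K →ₗ[K] Quat K)).contDiff
@[fun_prop] theorem contDiff_N {m : WithTop ℕ∞} : ContDiff K m (N : Quat K → K) := by
  unfold N; fun_prop
@[fun_prop] theorem continuous_re : Continuous (Quat.re : Quat K → K) := reL.continuous
@[fun_prop] theorem continuous_imI : Continuous (Quat.imI : Quat K → K) := imIL.continuous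
@[fun_prop] theorem continuous_imJ : Continuous (Quat.imJ : Quat K → K) := imJL.continuous
@[fun_prop] theorem continuous_imK : Continuous (Quat.imK : Quat K → K) := imKL.continuous
@[fun_prop] theorem continuous_conj : Continuous (conj : Quat K → Quat K) :=
  (contDiff_conj (m := 1)).continuous
@[fun_prop] theorem continuous_N : Continuous (N : Quat K → K) :=
  (contDiff_N (m := 1)).continuous

theorem contDiff_list_prod {E β : Type*} [NormedAddCommGroup E] [NormedSpace K E]
    {m : WithTop ℕ∞} (L : List β) (f : β → E → Quat K) (hf : ∀ b, ContDiff K m (f b)) :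
    ContDiff K m fun v => (L.map fun b => f b v).prod := by
  induction L with
  | nil => simpa using contDiff_const
  | cons b L ih => simpa using (hf b).mul ih

theorem contDiff_relator {m : WithTop ℕ∞} :
    ContDiff K m (relator : (SurfaceGen g n → Quat K) → Quat K) := by
  refine contDiff_list_prod (blocks g n) (fun b v => block v b) fun b => ?_
  rcases b with j | i <;> simp only [block] <;> fun_prop

theorem relator_eq_prod_append (v : SurfaceGen g n → Quat K) (l l' : List (Fin g ⊕ Fin n))
    (b : Fin g ⊕ Fin n) (h : blocks g n = l ++ b :: l') :
    relator v = (l.map (block v)).prod * (block v b * (l'.map (block v)).prod) := by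
  rw [relator, h]; simp

theorem fderiv_apply_of_hasDerivAt {E E' : Type*} [NormedAddCommGroup E] [NormedSpace K E]
    [NormedAddCommGroup E'] [NormedSpace K E'] {f : E → E'} {v t : E} {w : E'}
    (hf : DifferentiableAt K f v) (h : HasDerivAt (fun s : K => f (v + s • t)) w 0) :
    fderiv K f v t = w := by
  have h1 : HasDerivAt (fun s : K => v + s • t) t 0 := by
    simpa using ((hasDerivAt_id (0 : K)).smul_const t).const_add v
  have h2 : HasDerivAt (fun s : K => f (v + s • t)) (fderiv K f v t) 0 := by
    refine HasFDerivAt.comp_hasDerivAt (0 : K) ?_ h1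
    simpa using hf.hasFDerivAt
  exact h2.unique h

theorem hasDerivAt_line {E : Type*} [NormedAddCommGroup E] [NormedSpace K E] (x y : E) :
    HasDerivAt (fun s : K => x + s • y) y 0 := by
  simpa using ((hasDerivAt_id (0 : K)).smul_const y).const_add x

theorem add_smul_single (v : SurfaceGen g n → Quat K) (s : SurfaceGen g n) (y : Quat K) (r : K) :
    v + r • (Pi.single s y : SurfaceGen g n → Quat K) = Function.update v s (v s + r • y) := by
  ext1 s'
  rcases eq_or_ne s' s with rfl | h
  · simp
  · simp [h]

theorem N_list_prod {β : Type*} (l : List β) (f : β → Quat K) (h : ∀ b, N (f b) = 1) :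
    N (l.map f).prod = 1 := by
  induction l with
  | nil => simp
  | cons b l ih => simp [N_mul, h, ih]

theorem N_block {v : SurfaceGen g n → Quat K} (hv : ∀ s, N (v s) = 1) (b : Fin g ⊕ Fin n) :
    N (block v b) = 1 := by
  rcases b with j | i <;> simp [block, N_mul, N_conj, hv]

/-- The derivative of the relator in the direction of a single generator. -/
theorem fderiv_relator_single {v : SurfaceGen g n → Quat K}
    {l l' : List (Fin g ⊕ Fin n)} {s : SurfaceGen g n} (h : blocks g n = l ++ s.toBlock :: l')
    {y d : Quat K} (hd : HasDerivAt (fun r : K => block (Function.update v s (v s + r • y)) s.toBlock) d 0) :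
    fderiv K relator v (Pi.single s y) =
      (l.map (block v)).prod * (d * (l'.map (block v)).prod) := by
  refine fderiv_apply_of_hasDerivAt (contDiff_relator (m := 1) |>.differentiable (by simp) v) ?_
  -- Each generator occurs in one block and each block occurs once, so only one factor of the
  -- relator varies.
  have hnd := nodup_blocks (g := g) (n := n)
  rw [h, List.nodup_append] at hnd
  have h1 : ∀ r : K, relator (v + r • (Pi.single s y : SurfaceGen g n → Quat K)) = (l.map (block v)).prod *
      (block (Function.update v s (v s + r • y)) s.toBlock * (l'.map (block v)).prod) := by
    intro r
    rw [relator_eq_prod_append _ l l' _ h, add_smul_single]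
    congr 2
    · refine List.map_congr_left fun b hb => block_update _ _ _ ?_
      rintro rfl
      exact hnd.2.2 _ hb _ List.mem_cons_self rfl
    · congr 1
      refine List.map_congr_left fun b hb => block_update _ _ _ ?_
      rintro rfl
      exact (List.nodup_cons.1 hnd.2.1).1 hb
  simp only [h1]
  exact (hd.mul_const _).const_mul _

/-- For the trace form the adjoint of `x ↦ x - u x u⁻¹` is `z ↦ z - u⁻¹ z u`. Since the form is
non-degenerate on pure quaternions, `z` is fixed by conjugation by `u`. -/
theorem comm_of_re_mul_eq_zero {z u : Quat K} (hu : N u = 1)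
    (h : ∀ x : Quat K, x.re = 0 → (z * (x - u * x * conj u)).re = 0) (hz : z.re = 0) :
    z * u = u * z := by
  have h0 : z - conj u * z * u = 0 := by
    refine eq_zero_of_re_mul_pure ?_ fun y hy => ?_
    · rw [re_sub, hz, re_mul_comm, ← mul_assoc, mul_conj_of_N_eq_one hu, one_mul, hz, sub_zero]
    · rw [← h y hy, mul_sub, sub_mul, re_sub, re_sub]
      congr 1
      rw [show conj u * z * u * y = conj u * (z * u * y) by noncomm_ring, re_mul_comm]
      congr 1
      noncomm_ring
  have h1 : z = conj u * z * u := sub_eq_zero.1 h0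
  calc z * u = (u * conj u) * (z * u) := by rw [mul_conj_of_N_eq_one hu, one_mul]
    _ = u * (conj u * z * u) := by noncomm_ring
    _ = u * z := by rw [← h1]

variable {v : SurfaceGen g n → Quat K}

/-- By the first relation `a⁻¹ z a` commutes with `b`. By the second it is `b z b⁻¹`, so `z`
commutes with `b`; then `a⁻¹ z a = z`. -/
theorem comm_of_commutator {z a b : Quat K} (ha : N a = 1) (hb : N b = 1)
    (h1 : z * (a * b * conj a) = a * b * conj a * z)
    (h2 : conj a * z * a = b * z * conj b) : z * a = a * z ∧ z * b = b * z := by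
  have ha' := mul_conj_of_N_eq_one ha
  have ha'' := conj_mul_of_N_eq_one ha
  have hb' := mul_conj_of_N_eq_one hb
  have hb'' := conj_mul_of_N_eq_one hb
  have h3 : conj a * z * a * b = b * (conj a * z * a) := by
    calc conj a * z * a * b = conj a * z * a * b * (conj a * a) := by rw [ha'', mul_one]
      _ = conj a * (z * (a * b * conj a)) * a := by noncomm_ring
      _ = (conj a * a) * b * conj a * z * a := by rw [h1]; noncomm_ring
      _ = b * (conj a * z * a) := by rw [ha'']; noncomm_ring
  rw [h2] at h3
  have h4 : z * b = b * z := by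
    have : z = b * z * conj b := by
      calc z = (conj b * b) * z * (conj b * b) := by rw [hb'']; noncomm_ring
        _ = conj b * (b * z * conj b * b) := by noncomm_ring
        _ = (conj b * b) * (b * z * conj b) := by rw [h3]; noncomm_ring
        _ = b * z * conj b := by rw [hb'', one_mul]
    calc z * b = b * z * (conj b * b) := by nth_rewrite 1 [this]; noncomm_ring
      _ = b * z := by rw [hb'', mul_one]
  refine ⟨?_, h4⟩
  have h5 : conj a * z * a = z := by
    rw [h2, ← h4, mul_assoc, hb', mul_one]
  calc z * a = (a * conj a) * z * a := by rw [ha', one_mul]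
    _ = a * (conj a * z * a) := by noncomm_ring
    _ = a * z := by rw [h5]

/-- The reduced equations: the constraints for the value at one generator. -/
def con (c : K) (x : Quat K) : Fin 5 → K := ![N x - 1, x.re - c, x.imI, x.imJ, x.imK]

/-- The differential of `con`. -/
def dcon (x t : Quat K) : Fin 5 → K := ![2 * (t * conj x).re, t.re, t.imI, t.imJ, t.imK]

open Classical in
/-- The constraints used for a generator; `c i` is half the trace of `β_i`. -/
def labels (c : Fin n → K) : SurfaceGen g n → Finset (Fin 5)
  | .mu _ => {0}
  | .nu _ => {0}
  -- At a central value the differentials of norm and trace are proportional, so there the value is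
  -- fixed by four linear equations instead.
  | .beta i => if c i ^ 2 = 1 then {1, 2, 3, 4} else {0, 1}

/-- The half trace prescribed for a generator (irrelevant for `μ_j` and `ν_j`). -/
def halfTrace (c : Fin n → K) : SurfaceGen g n → K
  | .mu _ => 0
  | .nu _ => 0
  | .beta i => c i

/-- The index set of the constraints on the individual generators. -/
abbrev ConIndex (g : ℕ) {n : ℕ} (c : Fin n → K) : Type := Σ s : SurfaceGen g n, labels c s

/-- The defining equations of the relative homomorphism space. -/
def equations (c : Fin n → K) (v : SurfaceGen g n → Quat K) :
    (ConIndex g c → K) × (Fin 3 → K) :=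
  (fun x => con (halfTrace c x.1) (v x.1) x.2,
    ![(relator v).imI, (relator v).imJ, (relator v).imK])

/-- The conjugacy class of the elements with half trace `c` different from `± 1` or central. -/
def cls (c : K) : Set (Quat K) := {x | N x = 1 ∧ x.re = c ∧ (c ^ 2 = 1 → x = c • 1)}

/-- The relative homomorphism space, as a set of tuples. -/
def relTuples (g : ℕ) {n : ℕ} (c : Fin n → K) : Set (SurfaceGen g n → Quat K) :=
  {v | (∀ s, N (v s) = 1) ∧ (∀ i, v (.beta i) ∈ cls (c i)) ∧ relator v = 1}

theorem contDiff_equations (c : Fin n → K) {m : WithTop ℕ∞} :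
    ContDiff K m (equations (g := g) c) := by
  refine ContDiff.prodMk (contDiff_pi.2 ?_) (contDiff_pi.2 fun i => ?_)
  · rintro ⟨s, l, hl⟩
    simp only
    fin_cases l <;> simp [con] <;> fun_prop
  · have := contDiff_relator (K := K) (g := g) (n := n) (m := m)
    fin_cases i <;> simp <;> fun_prop

theorem N_relator (hv : ∀ s, N (v s) = 1) : N (relator v) = 1 :=
  N_list_prod _ _ (N_block hv)

/-- The relator has norm one whenever the generators do, so the vanishing of its imaginary part
leaves only `1` and `-1`, and the open condition discards the latter. The relation thus costs three
equations rather than four. -/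
theorem mem_relTuples_iff (c : Fin n → K) (v : SurfaceGen g n → Quat K) :
    v ∈ relTuples g c ↔ relator v ≠ -1 ∧ equations c v = 0 := by
  have h2 : (1 : K) ≠ -1 := by
    intro h
    have : (2 : K) = 0 := by linear_combination h
    exact two_ne_zero this
  have key : ((∀ s, N (v s) = 1) ∧ ∀ i, v (.beta i) ∈ cls (c i)) ↔
      (equations c v).1 = 0 := by
    constructor
    · rintro ⟨h1, h3⟩
      ext ⟨s, l, hl⟩
      simp only [equations, Pi.zero_apply]
      rcases s with j | j | i
      · simp [labels] at hl; subst hl; simp [con, h1]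
      · simp [labels] at hl; subst hl; simp [con, h1]
      · obtain ⟨h4, h5, h6⟩ := h3 i
        by_cases hc : c i ^ 2 = 1
        · simp [labels, hc] at hl
          have h7 := h6 hc
          rcases hl with rfl | rfl | rfl | rfl <;> simp [con, halfTrace, h7]
        · simp [labels, hc] at hl
          rcases hl with rfl | rfl <;> simp [con, halfTrace, h4, h5]
    · intro h
      have h' : ∀ s, ∀ l ∈ labels c s, con (halfTrace c s) (v s) l = 0 := fun s l hl =>
        congrFun h ⟨s, l, hl⟩
      have hb : ∀ i, v (.beta i) ∈ cls (c i) := by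
        intro i
        have := h' (.beta i)
        by_cases hc : c i ^ 2 = 1
        · simp [labels, hc, con, halfTrace] at this
          obtain ⟨h1, h3, h4, h5⟩ := this
          have e : v (.beta i) = c i • 1 := by
            ext <;> simp [*]
            linear_combination h1
          refine ⟨?_, by simp [e], fun _ => e⟩
          simp [e, N, hc]
        · simp [labels, hc, con, halfTrace] at this
          exact ⟨by linear_combination this.1, by linear_combination this.2, fun h => absurd h hc⟩
      refine ⟨?_, hb⟩
      rintro (j | j | i)
      · have := h' (.mu j)
        simp [labels, con] at this
        linear_combination this
      · have := h' (.nu j)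
        simp [labels, con] at this
        linear_combination this
      · exact (hb i).1
  constructor
  · rintro ⟨h1, h3, h4⟩
    refine ⟨?_, Prod.ext (key.1 ⟨h1, h3⟩) ?_⟩
    · rw [h4]
      intro h
      exact h2 (by simpa using congrArg Quat.re h)
    · simp [equations, h4]
  · rintro ⟨h1, h3⟩
    obtain ⟨h4, h5⟩ := key.2 (congrArg Prod.fst h3)
    refine ⟨h4, h5, ?_⟩
    have h6 := congrArg Prod.snd h3
    have e1 : (relator v).imI = 0 := congrFun h6 0
    have e2 : (relator v).imJ = 0 := congrFun h6 1
    have e3 : (relator v).imK = 0 := congrFun h6 2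
    have h7 := N_relator h4
    simp only [N, e1, e2, e3] at h7
    have h8 : (relator v).re ^ 2 = 1 := by linear_combination h7
    rcases sq_eq_one_iff.1 h8 with h | h
    · exact Quat.ext h e1 e2 e3
    · exact absurd (Quat.ext (by simpa using h) (by simpa using e1) (by simpa using e2)
        (by simpa using e3)) h1

end Equations

/-! ### Regularity of the equations at non-coaxial points -/

section Regularity

open Module Quat

variable {K : Type*} [RCLike K] {g n : ℕ} {v : SurfaceGen g n → Quat K} {c : Fin n → K}

theorem hasDerivAt_N_line (x t : Quat K) :
    HasDerivAt (fun r : K => N (x + r • t)) (2 * (t * conj x).re) 0 := by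
  have h : ∀ r : K, N (x + r • t) = N x + r * (2 * (t * conj x).re) + r ^ 2 * N t := by
    intro r
    simp [N]; ring
  simp only [h]
  refine ((((hasDerivAt_id (0 : K)).mul_const (2 * (t * conj x).re)).const_add (N x)).add
    (((hasDerivAt_id (0 : K)).pow 2).mul_const (N t))).congr_deriv ?_
  simp

theorem hasDerivAt_comp_line {E : Type*} [NormedAddCommGroup E] [NormedSpace K E]
    (L : Quat K →L[K] E) {x : K → Quat K} {d : Quat K} (h : HasDerivAt x d 0) :
    HasDerivAt (fun r => L (x r)) (L d) 0 :=
  L.hasFDerivAt.comp_hasDerivAt (0 : K) h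

theorem hasDerivAt_con (a : K) (x t : Quat K) (l : Fin 5) :
    HasDerivAt (fun r : K => con a (x + r • t) l) (dcon x t l) 0 := by
  fin_cases l
  · exact (hasDerivAt_N_line x t).sub_const 1
  · exact (hasDerivAt_comp_line reL (hasDerivAt_line x t)).sub_const a
  · exact hasDerivAt_comp_line imIL (hasDerivAt_line x t)
  · exact hasDerivAt_comp_line imJL (hasDerivAt_line x t)
  · exact hasDerivAt_comp_line imKL (hasDerivAt_line x t)

theorem fderiv_equations (v t : SurfaceGen g n → Quat K) :
    fderiv K (equations c) v t = (fun x => dcon (v x.1) (t x.1) x.2,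
      ![(fderiv K relator v t).imI, (fderiv K relator v t).imJ, (fderiv K relator v t).imK]) := by
  refine fderiv_apply_of_hasDerivAt
    (contDiff_equations c (m := 1) |>.differentiable (by simp) v) ?_
  refine HasDerivAt.prodMk (hasDerivAt_pi.2 fun x => hasDerivAt_con _ _ _ _) ?_
  have h : HasDerivAt (fun r : K => relator (v + r • t)) (fderiv K relator v t) 0 := by
    refine HasFDerivAt.comp_hasDerivAt (0 : K) (l := relator) ?_ (hasDerivAt_line v t)
    simpa using ((contDiff_relator (m := 1)).differentiable (by simp) v).hasFDerivAt
  refine hasDerivAt_pi.2 fun i => ?_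
  fin_cases i
  · exact hasDerivAt_comp_line imIL h
  · exact hasDerivAt_comp_line imJL h
  · exact hasDerivAt_comp_line imKL h

theorem exists_dcon_eq (hv : v ∈ relTuples g c) (w : ConIndex g c → K) :
    ∃ t : SurfaceGen g n → Quat K, ∀ x, dcon (v x.1) (t x.1) x.2 = w x := by
  have h2 : (2 : K) ≠ 0 := two_ne_zero
  obtain ⟨h1, h3, -⟩ := hv
  have key : ∀ s, ∃ t : Quat K, ∀ l (hl : l ∈ labels c s), dcon (v s) t l = w ⟨s, l, hl⟩ := by
    have free : ∀ s, labels c s = {0} →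
        ∃ t : Quat K, ∀ l (hl : l ∈ labels c s), dcon (v s) t l = w ⟨s, l, hl⟩ := by
      intro s hs
      refine ⟨(w ⟨s, 0, by simp [hs]⟩ / 2) • v s, fun l hl => ?_⟩
      obtain rfl : l = 0 := by simpa [hs] using hl
      have := re_mul_conj_self (v s)
      rw [h1 s] at this
      simp only [dcon, smul_mul_assoc, re_smul, this]
      simp
      field_simp
    rintro (j | j | i)
    · exact free _ rfl
    · exact free _ rfl
    · by_cases hc : c i ^ 2 = 1
      · have hs : labels (g := g) c (.beta i) = {1, 2, 3, 4} := by simp [labels, hc]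
        refine ⟨mk (w ⟨.beta i, 1, by simp [hs]⟩) (w ⟨.beta i, 2, by simp [hs]⟩)
          (w ⟨.beta i, 3, by simp [hs]⟩) (w ⟨.beta i, 4, by simp [hs]⟩), fun l hl => ?_⟩
        have hl' := hl
        rw [hs] at hl'
        simp at hl'
        rcases hl' with rfl | rfl | rfl | rfl <;> simp [dcon]
      · have hs : labels (g := g) c (.beta i) = {0, 1} := by simp [labels, hc]
        set x := v (.beta i) with hx
        have hxN : N x = 1 := h1 _
        have hxc : x.re = c i := (h3 i).2.1
        have hne : 1 - c i ^ 2 ≠ 0 := sub_ne_zero.2 (Ne.symm hc)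
        have hn : x.imI ^ 2 + x.imJ ^ 2 + x.imK ^ 2 = 1 - c i ^ 2 := by
          rw [N, hxc] at hxN
          linear_combination hxN
        set w0 := w ⟨.beta i, 0, by simp [hs]⟩ with hw0
        set w1 := w ⟨.beta i, 1, by simp [hs]⟩ with hw1
        -- The real part of `t` is forced to be `w1`; the multiple `y` of the imaginary part of `x`,
        -- whose norm is `1 - c i ^ 2`, is solved from the norm equation.
        set y := (w0 / 2 - w1 * c i) / (1 - c i ^ 2) with hy
        refine ⟨mk w1 (y * x.imI) (y * x.imJ) (y * x.imK), fun l hl => ?_⟩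
        have hl' := hl
        rw [hs] at hl'
        simp at hl'
        rcases hl' with rfl | rfl
        · have e : y * (1 - c i ^ 2) = w0 / 2 - w1 * c i := by rw [hy]; field_simp
          simp [dcon, hxc, ← hw0]
          linear_combination 2 * y * hn + 2 * e
        · simp [dcon, hw1]
  choose t ht using key
  exact ⟨t, fun x => ht x.1 x.2 x.2.2⟩

theorem dcon_single (s : SurfaceGen g n) (y : Quat K) (hy : ∀ l ∈ labels c s, dcon (v s) y l = 0)
    (x : ConIndex g c) : dcon (v x.1) ((Pi.single s y : SurfaceGen g n → Quat K) x.1) x.2 = 0 := by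
  obtain ⟨s', l, hl⟩ := x
  rcases eq_or_ne s' s with rfl | h
  · simpa using hy l hl
  · have : ∀ l, dcon (v s') 0 l = 0 := fun l => by fin_cases l <;> simp [dcon]
    simp [h, this]

theorem re_mul_N_eq_one {x y : Quat K} (hx : x.re = 0) (hy : N y = 1) :
    (x * y * conj y).re = 0 := by rw [mul_assoc, mul_conj_of_N_eq_one hy, mul_one, hx]

theorem conj_of_pure {x : Quat K} (hx : x.re = 0) : conj x = -x := by ext <;> simp [hx]

/-- Varying `a` in the direction `x a` changes the commutator, translated back to the identity, by
`x - Ad(a b a⁻¹) x`. -/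
theorem commutator_variation_left {a b x : Quat K} (ha : N a = 1) (hb : N b = 1) (hx : x.re = 0) :
    (x * a * b * conj a * conj b + a * b * conj (x * a) * conj b) * conj (a * b * conj a * conj b) =
      x - a * b * conj a * x * conj (a * b * conj a) := by
  have hw : N (a * b * conj a * conj b) = 1 := by simp [N_mul, N_conj, ha, hb]
  calc _ = x * ((a * b * conj a * conj b) * conj (a * b * conj a * conj b)) +
        a * b * conj a * conj x * conj b * conj (a * b * conj a * conj b) := by
        rw [Quat.conj_mul x a]; noncomm_ring
    _ = x - a * b * conj a * x * (conj b * b) * conj (a * b * conj a) := by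
        rw [mul_conj_of_N_eq_one hw, Quat.conj_mul _ (conj b), conj_conj, conj_of_pure hx]
        noncomm_ring
    _ = _ := by rw [conj_mul_of_N_eq_one hb, mul_one]

/-- The corresponding variation of `b` contributes `Ad(a) x - Ad([a, b]) x`. -/
theorem commutator_variation_right {a b x : Quat K} (ha : N a = 1) (hb : N b = 1) (hx : x.re = 0) :
    (a * (x * b) * conj a * conj b + a * b * conj a * conj (x * b)) * conj (a * b * conj a * conj b) =
      a * x * conj a - a * b * conj a * conj b * x * conj (a * b * conj a * conj b) := by
  have hw : N (a * b * conj a * conj b) = 1 := by simp [N_mul, N_conj, ha, hb]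
  calc _ = a * x * b * conj a * conj b * conj (a * b * conj a * conj b) +
        a * b * conj a * conj b * conj x * conj (a * b * conj a * conj b) := by
        rw [Quat.conj_mul x b]; noncomm_ring
    _ = a * x * (conj a * a) * b * conj a * conj b * conj (a * b * conj a * conj b) -
        a * b * conj a * conj b * x * conj (a * b * conj a * conj b) := by
        rw [conj_mul_of_N_eq_one ha, mul_one, conj_of_pure hx]; noncomm_ring
    _ = a * x * conj a * ((a * b * conj a * conj b) * conj (a * b * conj a * conj b)) -
        a * b * conj a * conj b * x * conj (a * b * conj a * conj b) := by noncomm_ring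
    _ = _ := by rw [mul_conj_of_N_eq_one hw, mul_one]

/-- A pure quaternion annihilating the image of the differential of the relator commutes with all
generators. -/
theorem comm_of_re_mul_fderiv (hv : v ∈ relTuples g c) {z : Quat K} (hz : z.re = 0)
    (h : ∀ t, (∀ x : ConIndex g c, dcon (v x.1) (t x.1) x.2 = 0) →
      (z * fderiv K relator v t).re = 0) (s : SurfaceGen g n) : z * v s = v s * z := by
  obtain ⟨h1, h3, h4⟩ := hv
  have hconj : ∀ s, v s * conj (v s) = 1 := fun s => mul_conj_of_N_eq_one (h1 s)
  -- If `z` commutes with the product of the blocks before the given one, then invariance of the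
  -- trace under cyclic permutation and the relation `relator v = 1` remove all the other blocks
  -- from the condition.
  have step : ∀ (l l' : List (Fin g ⊕ Fin n)) (s : SurfaceGen g n)
      (_ : blocks g n = l ++ s.toBlock :: l')
      (_ : z * (l.map (block v)).prod = (l.map (block v)).prod * z) (y d : Quat K)
      (_ : ∀ l ∈ labels c s, dcon (v s) y l = 0)
      (_ : HasDerivAt (fun r : K => block (Function.update v s (v s + r • y)) s.toBlock) d 0),
      (z * (d * conj (block v s.toBlock))).re = 0 := by
    intro l l' s hl hzl y d hy hd
    have e1 := h _ (dcon_single s y hy)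
    rw [fderiv_relator_single hl hd] at e1
    have e2 := relator_eq_prod_append v l l' _ hl
    rw [h4] at e2
    set A := (l.map (block v)).prod
    set B := (l'.map (block v)).prod
    set w := block v s.toBlock
    have hA : N A = 1 := N_list_prod _ _ (N_block h1)
    have hw : N w = 1 := N_block h1 _
    have e3 : w * B = conj A := by
      calc w * B = conj A * A * (w * B) := by rw [conj_mul_of_N_eq_one hA, one_mul]
        _ = conj A * (A * (w * B)) := by noncomm_ring
        _ = conj A := by rw [← e2, mul_one]
    have e4 : B * A = conj w := by
      calc B * A = conj w * w * (B * A) := by rw [conj_mul_of_N_eq_one hw, one_mul]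
        _ = conj w * (w * B) * A := by noncomm_ring
        _ = conj w := by rw [e3, mul_assoc, conj_mul_of_N_eq_one hA, mul_one]
    rw [← e1, ← e4, show z * (A * (d * B)) = z * A * (d * B) by noncomm_ring, hzl,
      show z * (d * (B * A)) = z * (d * B) * A by noncomm_ring, re_mul_comm]
    congr 1
    noncomm_ring
  -- Induction along the relator: once `z` commutes with the generators of a block, it commutes with
  -- the longer initial product.
  have main : ∀ (l' l : List (Fin g ⊕ Fin n)) (_ : blocks g n = l ++ l')
      (_ : z * (l.map (block v)).prod = (l.map (block v)).prod * z),
      ∀ s : SurfaceGen g n, s.toBlock ∈ l' → z * v s = v s * z := by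
    intro l'
    induction l' with
    | nil => intro l _ _ s hs; simp at hs
    | cons b l' ih =>
      intro l hl hzl
      have hb : ∀ s : SurfaceGen g n, s.toBlock = b → z * v s = v s * z := by
        rcases b with j | i
        · have ha := h1 (.mu j)
          have hb := h1 (.nu j)
          set a := v (.mu j) with ha0
          set b := v (.nu j) with hb0
          have hab : N (a * b * conj a) = 1 := by simp [N_mul, N_conj, ha, hb]
          have c1 : z * (a * b * conj a) = a * b * conj a * z := by
            refine comm_of_re_mul_eq_zero hab (fun x hx => ?_) hz
            have := step l l' (.mu j) hl hzl (x * a)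
              (x * a * b * conj a * conj b + a * b * conj (x * a) * conj b) ?_ ?_
            · rw [← this]
              congr 2
              exact (commutator_variation_left ha hb hx).symm
            · intro l hl
              obtain rfl : l = 0 := by simpa [labels] using hl
              simp only [dcon, ← ha0]
              simp [re_mul_N_eq_one hx ha, -re_mul]
            · simp only [SurfaceGen.toBlock, block]
              simp only [Function.update_self, Function.update_of_ne (show
                (SurfaceGen.nu j : SurfaceGen g n) ≠ .mu j by simp), ← ha0, ← hb0]
              have d1 := hasDerivAt_line (K := K) a (x * a)
              have d2 := hasDerivAt_comp_line (LinearMap.toContinuousLinearMap conj) d1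
              simp only [LinearMap.coe_toContinuousLinearMap'] at d2
              refine (((d1.mul_const b).mul d2).mul_const (conj b)).congr_deriv ?_
              rw [zero_smul, add_zero, add_mul]
          -- Variation of `b` gives `a⁻¹ z a = w⁻¹ z w` for the commutator `w`. As `w = (a b a⁻¹)
          -- b⁻¹` and `z` commutes with `a b a⁻¹`, the right side is `b z b⁻¹`.
          have c2 : conj a * z * a = b * z * conj b := by
            have hw : N (a * b * conj a * conj b) = 1 := by simp [N_mul, N_conj, ha, hb]
            have e6 : conj (a * b * conj a * conj b) * z * (a * b * conj a * conj b) =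
                b * z * conj b := by
              have hu := conj_mul_of_N_eq_one hab
              calc conj (a * b * conj a * conj b) * z * (a * b * conj a * conj b)
                  = b * conj (a * b * conj a) * (z * (a * b * conj a)) * conj b := by
                    rw [conj_mul _ (conj b), conj_conj]; noncomm_ring
                _ = b * (conj (a * b * conj a) * (a * b * conj a)) * z * conj b := by
                    rw [c1]; noncomm_ring
                _ = b * z * conj b := by rw [hu, mul_one]
            rw [← e6, ← sub_eq_zero]
            set w := a * b * conj a * conj b with hw0
            refine eq_zero_of_re_mul_pure ?_ fun x hx => ?_
            · rw [re_sub, re_mul_comm, ← mul_assoc, mul_conj_of_N_eq_one ha, one_mul, re_mul_comm,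
                ← mul_assoc, mul_conj_of_N_eq_one hw, one_mul, sub_self]
            · have := step l l' (.nu j) hl hzl (x * b)
                (a * (x * b) * conj a * conj b + a * b * conj a * conj (x * b)) ?_ ?_
              · rw [← this]
                rw [show (SurfaceGen.nu j : SurfaceGen g n).toBlock = .inl j from rfl]
                simp only [block, ← ha0, ← hb0]
                rw [commutator_variation_right ha hb hx, ← hw0]
                rw [sub_mul, mul_sub, re_sub, re_sub]
                congr 1
                · rw [show conj a * z * a * x = conj a * (z * a * x) by noncomm_ring, re_mul_comm]
                  congr 1; noncomm_ring
                · rw [show conj w * z * w * x = conj w * (z * w * x) by noncomm_ring, re_mul_comm]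
                  congr 1; noncomm_ring
              · intro l hl
                obtain rfl : l = 0 := by simpa [labels] using hl
                simp only [dcon, ← hb0]
                simp [re_mul_N_eq_one hx hb, -re_mul]
              · simp only [SurfaceGen.toBlock, block]
                simp only [Function.update_self, Function.update_of_ne (show
                  (SurfaceGen.mu j : SurfaceGen g n) ≠ .nu j by simp), ← ha0, ← hb0]
                have d1 := hasDerivAt_line (K := K) b (x * b)
                have d2 := hasDerivAt_comp_line (LinearMap.toContinuousLinearMap conj) d1
                simp only [LinearMap.coe_toContinuousLinearMap'] at d2
                refine (((d1.const_mul a).mul_const (conj a)).mul d2).congr_deriv ?_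
                rw [zero_smul, add_zero]
          obtain ⟨c3, c4⟩ := comm_of_commutator ha hb c1 c2
          rintro (j' | j' | i) hs
          · obtain rfl : j' = j := by simpa [SurfaceGen.toBlock] using hs
            exact c3
          · obtain rfl : j' = j := by simpa [SurfaceGen.toBlock] using hs
            exact c4
          · simp [SurfaceGen.toBlock] at hs
        · have c1 : z * v (.beta i) = v (.beta i) * z := by
            have hN := h1 (.beta i)
            obtain ⟨-, h5, h6⟩ := h3 i
            by_cases hc : c i ^ 2 = 1
            · rw [h6 hc]; simp
            refine comm_of_re_mul_eq_zero hN (fun x hx => ?_) hz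
            set b := v (.beta i) with hb0
            -- The vectors `x b - b x` are tangent to the conjugacy class of `b`.
            have := step l l' (.beta i) hl hzl (x * b - b * x) (x * b - b * x) ?_ ?_
            · rw [← this]
              congr 2
              simp only [SurfaceGen.toBlock, block, ← hb0]
              rw [sub_mul, mul_assoc x, mul_conj_of_N_eq_one hN, mul_one]
            · intro l hl
              have e8 : (x * b - b * x).re = 0 := by rw [re_sub, re_mul_comm, sub_self]
              have e9 : ((x * b - b * x) * conj b).re = 0 := by
                rw [sub_mul, re_sub, mul_assoc x, mul_conj_of_N_eq_one hN, mul_one, hx,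
                  re_mul_comm, ← mul_assoc, conj_mul_of_N_eq_one hN, one_mul, hx, sub_self]
              have hl' : l = 0 ∨ l = 1 := by simpa [labels, hc] using hl
              rcases hl' with rfl | rfl
              · simp only [dcon, ← hb0, e9]; simp
              · simp only [dcon, e8]; simp
            · simp only [SurfaceGen.toBlock, block, Function.update_self]
              exact hasDerivAt_line _ _
          rintro (j' | j' | i') hs
          · simp [SurfaceGen.toBlock] at hs
          · simp [SurfaceGen.toBlock] at hs
          · obtain rfl : i' = i := by simpa [SurfaceGen.toBlock] using hs
            exact c1
      have hzb : z * block v b = block v b * z := by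
        rcases b with j | i
        · have c1 := hb (.mu j) rfl
          have c2 := hb (.nu j) rfl
          have comm_conj : ∀ s, z * v s = v s * z → z * conj (v s) = conj (v s) * z := by
            intro s hs
            calc z * conj (v s) = (conj (v s) * v s) * z * conj (v s) := by
                  rw [conj_mul_of_N_eq_one (h1 s), one_mul]
              _ = conj (v s) * (v s * z) * conj (v s) := by noncomm_ring
              _ = conj (v s) * z * (v s * conj (v s)) := by rw [← hs]; noncomm_ring
              _ = conj (v s) * z := by rw [hconj, mul_one]
          simp only [block]
          exact (((Commute.mul_right (c1 : Commute _ _) (c2 : Commute _ _)).mul_right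
            (comm_conj _ c1 : Commute _ _)).mul_right (comm_conj _ c2 : Commute _ _))
        · exact hb (.beta i) rfl
      intro s hs
      rcases List.mem_cons.1 hs with h | h
      · exact hb s h
      · refine ih (l ++ [b]) (by simp [hl]) ?_ s h
        simp only [List.map_append, List.prod_append, List.map_cons, List.map_nil,
          List.prod_singleton]
        exact (Commute.mul_right (hzl : Commute _ _) (hzb : Commute _ _))
  exact main (blocks g n) [] rfl (by simp) s (mem_blocks _)

/-- The equations are regular at non-coaxial points. -/
theorem surjective_fderiv_equations (hv : v ∈ relTuples g c)
    (hnc : ∃ s s', v s * v s' ≠ v s' * v s) :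
    Function.Surjective (fderiv K (equations c) v) := by
  let T : Submodule K (SurfaceGen g n → Quat K) :=
    { carrier := {t | ∀ x : ConIndex g c, (fderiv K (equations c) v t).1 x = 0}
      add_mem' := fun {a b} ha hb x => by
        rw [map_add, Prod.fst_add, Pi.add_apply, ha x, hb x, add_zero]
      zero_mem' := fun x => by simp
      smul_mem' := fun a t ht x => by
        rw [map_smul, Prod.smul_fst, Pi.smul_apply, ht x, smul_zero] }
  let f : (SurfaceGen g n → Quat K) →ₗ[K] (Fin 3 → K) :=
    (LinearMap.snd K _ _).comp (fderiv K (equations c) v).toLinearMap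
  have hf : Submodule.map f T = ⊤ := by
    by_contra hne
    obtain ⟨φ, hφ, hle⟩ := Submodule.exists_le_ker_of_lt_top _ (lt_top_iff_ne_top.2 hne)
    -- The pure quaternion representing `φ` through the trace form, up to sign.
    let z : Quat K := mk 0 (φ (Pi.single 0 1)) (φ (Pi.single 1 1)) (φ (Pi.single 2 1))
    have hφ' : ∀ y : Quat K, φ ![y.imI, y.imJ, y.imK] = -(z * y).re := by
      intro y
      have : (![y.imI, y.imJ, y.imK] : Fin 3 → K) =
          y.imI • Pi.single 0 1 + y.imJ • Pi.single 1 1 + y.imK • Pi.single 2 1 := by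
        ext i; fin_cases i <;> simp
      rw [this]
      simp [z]
      ring
    have hz : ∀ s, z * v s = v s * z := by
      refine comm_of_re_mul_fderiv hv rfl fun t ht => ?_
      have ht' : t ∈ T := fun x => by rw [fderiv_equations]; exact ht x
      have := hle (Submodule.mem_map_of_mem (f := f) ht')
      rw [LinearMap.mem_ker] at this
      have e : f t = ![(fderiv K relator v t).imI, (fderiv K relator v t).imJ,
          (fderiv K relator v t).imK] := by
        simp [f, fderiv_equations]
      rw [e, hφ', neg_eq_zero] at this
      exact this
    obtain ⟨s, s', hs⟩ := hnc
    have hz0 : z ≠ 0 := by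
      intro h0
      refine hφ (LinearMap.pi_ext' fun i => ?_)
      have e1 : φ (Pi.single 0 1) = 0 := congrArg Quat.imI h0
      have e2 : φ (Pi.single 1 1) = 0 := congrArg Quat.imJ h0
      have e3 : φ (Pi.single 2 1) = 0 := congrArg Quat.imK h0
      fin_cases i <;> ext <;> simp [e1, e2, e3]
    exact hs (comm_of_comm_pure hz0 rfl (hz s) (hz s'))
  -- The constraints on single generators are solved first. The relator is then corrected by a
  -- vector of `T`, which leaves them unchanged.
  rintro ⟨w1, w2⟩
  obtain ⟨t, ht⟩ := exists_dcon_eq hv w1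
  have hmem : w2 - f t ∈ Submodule.map f T := by rw [hf]; trivial
  obtain ⟨t', ht', hft'⟩ := hmem
  refine ⟨t + t', ?_⟩
  rw [map_add]
  refine Prod.ext ?_ ?_
  · ext x
    rw [Prod.fst_add, Pi.add_apply, ht' x, add_zero, fderiv_equations]
    exact ht x
  · change f t + f t' = w2
    rw [hft']
    abel

theorem finrank_tuples : finrank K (SurfaceGen g n → Quat K) = 4 * (2 * g + n) := by
  have h : ∀ s : SurfaceGen g n, finrank K (Quat K) = 4 := fun _ => finrank_eq_four
  have := Module.Free.of_basis (Module.finBasis K (Quat K))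
  rw [Module.finrank_pi_fintype, Finset.sum_congr rfl fun s _ => h s, SurfaceGen.sum_eq]
  simp
  ring

theorem finrank_equations (c : Fin n → K) :
    finrank K ((ConIndex g c → K) × (Fin 3 → K)) =
      2 * g + 2 * n + 2 * Nat.card {i // c i ^ 2 = 1} + 3 := by
  classical
  rw [Module.finrank_prod, Module.finrank_fintype_fun_eq_card, Module.finrank_fintype_fun_eq_card,
    Fintype.card_sigma, SurfaceGen.sum_eq]
  have : ∀ i, Fintype.card (labels (g := g) c (.beta i)) = 2 + if c i ^ 2 = 1 then 2 else 0 := by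
    intro i
    by_cases h : c i ^ 2 = 1 <;> simp [labels, h, -Finset.mem_insert, -Finset.mem_singleton] <;> rfl
  simp only [this, Finset.sum_add_distrib, ← Finset.sum_filter]
  rw [Nat.card_eq_fintype_card, Fintype.card_subtype]
  simp [labels]
  ring

end Regularity

/-! ### Irreducible tuples and the infinitesimal conjugation action -/

section Irreducible

open Module Quat

variable {K : Type*} [RCLike K] {S : Type*} [Fintype S]

/-- The evaluation of noncommutative polynomials at a tuple. -/
def evalTuple (v : S → Quat K) : FreeAlgebra K S →ₐ[K] Quat K := FreeAlgebra.lift K v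

@[simp]
theorem evalTuple_ι (v : S → Quat K) (s : S) : evalTuple v (FreeAlgebra.ι K s) = v s :=
  FreeAlgebra.lift_ι_apply v s

/-- The entries of the tuple generate the quaternion algebra. -/
def IsIrred (v : S → Quat K) : Prop := Function.Surjective (evalTuple v)

theorem IsIrred.exists_not_comm {v : S → Quat K} (hv : IsIrred v) :
    ∃ s s', v s * v s' ≠ v s' * v s := by
  by_contra! h
  have key : ∀ x y, evalTuple v x * evalTuple v y = evalTuple v y * evalTuple v x := by
    have h1 : ∀ s y, Commute (v s) (evalTuple v y) := by
      intro s y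
      induction y using FreeAlgebra.induction with
      | grade0 r => rw [AlgHom.commutes]; exact Algebra.commute_algebraMap_right r _
      | grade1 s' => rw [evalTuple_ι]; exact h s s'
      | mul a b ha hb => rw [map_mul]; exact ha.mul_right hb
      | add a b ha hb => rw [map_add]; exact ha.add_right hb
    intro x y
    change Commute _ _
    induction x using FreeAlgebra.induction with
    | grade0 r => rw [AlgHom.commutes]; exact Algebra.commute_algebraMap_left r _
    | grade1 s' => rw [evalTuple_ι]; exact h1 s' y
    | mul a b ha hb => rw [map_mul]; exact ha.mul_left hb
    | add a b ha hb => rw [map_add]; exact ha.add_left hb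
  obtain ⟨x, y, hxy⟩ := Quat.exists_not_comm (K := K)
  obtain ⟨x, rfl⟩ := hv x
  obtain ⟨y, rfl⟩ := hv y
  exact hxy (key x y)

theorem IsIrred.eq_zero_of_comm {v : S → Quat K} (hv : IsIrred v) {p : Quat K} (hp : p.re = 0)
    (h : ∀ s, p * v s = v s * p) : p = 0 := by
  by_contra h0
  obtain ⟨s, s', hs⟩ := hv.exists_not_comm
  exact hs (comm_of_comm_pure h0 hp (h s) (h s'))

@[fun_prop]
theorem contDiff_evalTuple {m : WithTop ℕ∞} (x : FreeAlgebra K S) :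
    ContDiff K m fun v : S → Quat K => evalTuple v x := by
  induction x using FreeAlgebra.induction with
  | grade0 r => simp only [AlgHom.commutes]; exact contDiff_const
  | grade1 s => simp only [evalTuple_ι]; fun_prop
  | mul a b ha hb => simp only [map_mul]; exact ha.mul hb
  | add a b ha hb => simp only [map_add]; exact ha.add hb

/-- Some noncommutative polynomials take values forming a basis at `v`; linear independence of these
values persists nearby. -/
theorem isOpen_isIrred : IsOpen {v : S → Quat K | IsIrred v} := by
  rw [isOpen_iff_mem_nhds]
  intro v hv
  have := Module.Free.of_basis (Module.finBasis K (Quat K))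
  let b := Module.finBasis K (Quat K)
  choose x hx using fun i => hv (b i)
  have hopen := isOpen_setOfPred_linearIndependent (𝕜 := K) (E := Quat K)
    (ι := Fin (finrank K (Quat K)))
  have hc : Continuous fun v : S → Quat K => fun i => evalTuple v (x i) :=
    continuous_pi fun i => (contDiff_evalTuple (m := 1) (x i)).continuous
  have hmem : LinearIndependent K fun i => evalTuple v (x i) := by
    simp only [hx]
    exact b.linearIndependent
  filter_upwards [(hopen.preimage hc).mem_nhds hmem] with w hw
  have hw' : LinearIndependent K fun i => evalTuple w (x i) := hw
  have hspan := hw'.span_eq_top_of_card_eq_finrank' (by simp)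
  intro y
  have hy : y ∈ Submodule.span K (Set.range fun i => evalTuple w (x i)) := by
    rw [hspan]; trivial
  have hle : Submodule.span K (Set.range fun i => evalTuple w (x i)) ≤
      LinearMap.range (evalTuple w).toLinearMap := by
    rw [Submodule.span_le]
    rintro _ ⟨i, rfl⟩
    exact ⟨x i, rfl⟩
  exact hle hy

/-- The evaluation at a first order deformation of a tuple. -/
def evalDual (v t : S → Quat K) : FreeAlgebra K S →ₐ[K] DualNumber (Quat K) :=
  FreeAlgebra.lift K fun s => TrivSqZeroExt.inl (v s) + TrivSqZeroExt.inr (t s)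

theorem evalDual_ι (v t : S → Quat K) (s : S) : evalDual v t (FreeAlgebra.ι K s) =
    TrivSqZeroExt.inl (v s) + TrivSqZeroExt.inr (t s) := FreeAlgebra.lift_ι_apply _ s

theorem fst_evalDual (v t : S → Quat K) (x : FreeAlgebra K S) :
    (evalDual v t x).fst = evalTuple v x := by
  induction x using FreeAlgebra.induction with
  | grade0 r => simp only [AlgHom.commutes]; rfl
  | grade1 s => simp [evalDual_ι]
  | mul a b ha hb => simp only [map_mul, TrivSqZeroExt.fst_mul, ha, hb]
  | add a b ha hb => simp only [map_add, TrivSqZeroExt.fst_add, ha, hb]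

theorem snd_evalDual_mul (v t : S → Quat K) (x y : FreeAlgebra K S) :
    (evalDual v t (x * y)).snd =
      evalTuple v x * (evalDual v t y).snd + (evalDual v t x).snd * evalTuple v y := by
  rw [map_mul, TrivSqZeroExt.snd_mul, fst_evalDual, fst_evalDual]
  rfl

theorem hasDerivAt_evalTuple (v t : S → Quat K) (x : FreeAlgebra K S) :
    HasDerivAt (fun r : K => evalTuple (v + r • t) x) (evalDual v t x).snd 0 := by
  induction x using FreeAlgebra.induction with
  | grade0 a =>
    simp only [AlgHom.commutes]
    exact (hasDerivAt_const (0 : K) _).congr_deriv (by simp [TrivSqZeroExt.algebraMap_eq_inl'])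
  | grade1 s =>
    simp only [evalTuple_ι, evalDual_ι]
    exact (hasDerivAt_line (v s) (t s)).congr_deriv (by simp)
  | mul a b ha hb =>
    simp only [map_mul (evalTuple _)]
    refine (ha.mul hb).congr_deriv ?_
    rw [snd_evalDual_mul, zero_smul, add_zero, add_comm]
  | add a b ha hb =>
    simp only [map_add]
    exact (ha.add hb).congr_deriv (by simp)

/-- A deformation of an irreducible tuple which preserves traces to the first order is
infinitesimally a conjugation. -/
theorem IsIrred.exists_pure {v t : S → Quat K} (hv : IsIrred v)
    (h : ∀ x, (evalDual v t x).snd.re = 0) :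
    ∃ p : Quat K, p.re = 0 ∧ ∀ s, p * v s - v s * p = t s := by
  obtain ⟨σ, hσ⟩ := (evalTuple v).toLinearMap.exists_rightInverse_of_surjective
    (LinearMap.range_eq_top.2 hv)
  have hσ' : ∀ y, evalTuple v (σ y) = y := fun y => DFunLike.congr_fun hσ y
  -- If `x` vanishes at `v`, its derivative is orthogonal for the trace form to every value, hence
  -- to the whole algebra. The derivative therefore factors through evaluation and defines a
  -- derivation of the quaternions.
  have hker : ∀ x, evalTuple v x = 0 → (evalDual v t x).snd = 0 := by
    intro x hx
    refine eq_zero_of_re_mul fun y => ?_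
    obtain ⟨y, rfl⟩ := hv y
    have := h (x * y)
    rwa [snd_evalDual_mul, hx, zero_mul, zero_add] at this
  let D : Quat K →ₗ[K] Quat K :=
    { toFun := fun y => (evalDual v t (σ y)).snd
      map_add' := fun x y => by simp
      map_smul' := fun a x => by simp }
  have hD : ∀ x, D (evalTuple v x) = (evalDual v t x).snd := by
    intro x
    have := hker (σ (evalTuple v x) - x) (by rw [map_sub, hσ', sub_self])
    rw [map_sub, TrivSqZeroExt.snd_sub, sub_eq_zero] at this
    exact this
  obtain ⟨p, hp, hpD⟩ := exists_inner_derivation D fun x y => by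
    obtain ⟨x, rfl⟩ := hv x
    obtain ⟨y, rfl⟩ := hv y
    rw [← map_mul, hD, hD, hD, snd_evalDual_mul, add_comm]
  refine ⟨p, hp, fun s => ?_⟩
  rw [← evalTuple_ι (K := K) v s, ← hpD, hD, evalDual_ι]
  simp

/-- The pure quaternion with given coordinates. -/
def pure : (Fin 3 → K) →L[K] Quat K := LinearMap.toContinuousLinearMap
  { toFun := fun p => mk 0 (p 0) (p 1) (p 2)
    map_add' := fun p q => by ext <;> simp
    map_smul' := fun a p => by ext <;> simp }

@[simp] theorem re_pure (p : Fin 3 → K) : (pure p).re = 0 := rfl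
@[simp] theorem imI_pure (p : Fin 3 → K) : (pure p).imI = p 0 := rfl
@[simp] theorem imJ_pure (p : Fin 3 → K) : (pure p).imJ = p 1 := rfl
@[simp] theorem imK_pure (p : Fin 3 → K) : (pure p).imK = p 2 := rfl

theorem exists_pure_eq {x : Quat K} (hx : x.re = 0) : ∃ p, pure p = x :=
  ⟨![x.imI, x.imJ, x.imK], by ext <;> simp [hx]⟩

theorem pure_eq_zero {p : Fin 3 → K} (h : pure p = 0) : p = 0 := by
  ext i
  fin_cases i
  · exact congrArg Quat.imI h
  · exact congrArg Quat.imJ h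
  · exact congrArg Quat.imK h

/-- Conjugation by `1 + p`. -/
def conjAct (p : Fin 3 → K) (v : S → Quat K) : S → Quat K :=
  -- Dividing by the norm turns the conjugate into the inverse, so no square root is needed and the
  -- action is rational in `p`.
  fun s => (N (1 + pure p))⁻¹ • ((1 + pure p) * v s * conj (1 + pure p))

/-- The infinitesimal conjugation action. -/
def conjAct' (v : S → Quat K) : (Fin 3 → K) →L[K] (S → Quat K) :=
  ContinuousLinearMap.pi fun s =>
    ((ContinuousLinearMap.mul K (Quat K)).flip (v s) - ContinuousLinearMap.mul K (Quat K) (v s)).comp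
      pure

theorem conjAct'_apply (v : S → Quat K) (p : Fin 3 → K) (s : S) :
    conjAct' v p s = pure p * v s - v s * pure p := rfl

theorem conjAct_zero (v : S → Quat K) : conjAct 0 v = v := by
  ext1 s
  simp [conjAct]

theorem contDiffAt_conjAct (v : S → Quat K) {m : WithTop ℕ∞} :
    ContDiffAt K m (fun x : (S → Quat K) × (Fin 3 → K) => conjAct x.2 x.1) (v, 0) := by
  refine contDiffAt_pi.2 fun s => ?_
  have h1 : ContDiffAt K m (fun x : (S → Quat K) × (Fin 3 → K) => N (1 + pure x.2)) (v, 0) :=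
    ContDiff.contDiffAt (by fun_prop)
  have h2 : ContDiffAt K m (fun x : (S → Quat K) × (Fin 3 → K) =>
      (1 + pure x.2) * x.1 s * conj (1 + pure x.2)) (v, 0) :=
    ContDiff.contDiffAt (by fun_prop)
  exact (h1.inv (by simp)).smul h2

theorem hasFDerivAt_conjAct (v : S → Quat K) :
    HasFDerivAt (fun p => conjAct p v) (conjAct' v) 0 := by
  have hd : DifferentiableAt K (fun p => conjAct p v) 0 := by
    have h1 := (contDiffAt_conjAct (m := 1) v).differentiableAt (by simp)
    exact DifferentiableAt.comp (g := fun x : (S → Quat K) × (Fin 3 → K) => conjAct x.2 x.1)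
      (f := fun p => (v, p)) (0 : Fin 3 → K) h1 (by fun_prop)
  have : fderiv K (fun p => conjAct p v) 0 = conjAct' v := by
    ext1 p
    refine fderiv_apply_of_hasDerivAt hd (hasDerivAt_pi.2 fun s => ?_)
    -- As `p` is pure, the norm of `1 + r p` has no term of first order in `r`.
    have hN : HasDerivAt (fun r : K => (N (1 + pure (0 + r • p)))⁻¹) 0 0 := by
      have := hasDerivAt_N_line (1 : Quat K) (pure p)
      have h2 : HasDerivAt (fun r : K => N (1 + r • pure p)) 0 0 := by simpa using this
      simp only [zero_add, map_smul]
      exact (h2.inv (by simp)).congr_deriv (by simp)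
    have h4 : HasDerivAt (fun r : K => 1 + pure (0 + r • p)) (pure p) 0 := by
      simpa [map_smul] using hasDerivAt_line (1 : Quat K) (pure p)
    have h5 := hasDerivAt_comp_line (LinearMap.toContinuousLinearMap conj) h4
    simp only [LinearMap.coe_toContinuousLinearMap'] at h5
    refine (hN.smul ((h4.mul_const (v s)).mul h5)).congr_deriv ?_
    rw [conjAct'_apply, conj_of_pure (re_pure p)]
    simp
    abel
  exact this ▸ hd.hasFDerivAt

theorem eventually_N_ne_zero : ∀ᶠ p in nhds (0 : Fin 3 → K), N (1 + pure p) ≠ 0 := by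
  refine ContinuousAt.eventually_ne (g := fun p : Fin 3 → K => N (1 + pure p)) ?_ (by simp)
  exact Continuous.continuousAt (by fun_prop)

end Irreducible

/-! ### Homomorphisms to a group of unit quaternions -/

section Model

open Module Quat Topology

/-- An identification of a topological group with the quaternions of reduced norm one. -/
structure QuatModel (K : Type*) [RCLike K] (G : Type*) [Group G] [TopologicalSpace G] where
  Q : G →* Quat K
  isEmbedding : IsEmbedding Q
  mem_range : ∀ x, x ∈ Set.range Q ↔ N x = 1
  exists_sqrt : ∀ x : Quat K, N x ≠ 0 → ∃ r : K, r ^ 2 = N x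

variable {K : Type*} [RCLike K] {G : Type*} [Group G] [TopologicalSpace G] {g n : ℕ}

namespace QuatModel

variable (M : QuatModel K G)

theorem N_Q (a : G) : N (M.Q a) = 1 := (M.mem_range _).1 ⟨a, rfl⟩

theorem Q_injective : Function.Injective M.Q := M.isEmbedding.injective

theorem Q_inv (a : G) : M.Q a⁻¹ = conj (M.Q a) := by
  have h1 : M.Q a⁻¹ * M.Q a = 1 := by rw [← map_mul, inv_mul_cancel, map_one]
  calc M.Q a⁻¹ = M.Q a⁻¹ * (M.Q a * conj (M.Q a)) := by
        rw [mul_conj_of_N_eq_one (M.N_Q a), mul_one]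
    _ = conj (M.Q a) := by rw [← mul_assoc, h1, one_mul]

/-- The values of a homomorphism at the generators, as quaternions. -/
def tuple (ρ : HomSpace g n G) : SurfaceGen g n → Quat K :=
  fun s => M.Q ((show SurfaceGroup g n →* G from ρ) (gen s))

theorem N_tuple (ρ : HomSpace g n G) (s : SurfaceGen g n) : N (M.tuple ρ s) = 1 := M.N_Q _

theorem isEmbedding_tuple : IsEmbedding (M.tuple : HomSpace g n G → SurfaceGen g n → Quat K) := by
  have h1 : IsEmbedding (fun (ρ : HomSpace g n G) (s : SurfaceGen g n) =>
      (show SurfaceGroup g n →* G from ρ) (gen s)) := by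
    refine ⟨⟨rfl⟩, fun ρ σ h => ?_⟩
    exact PresentedGroup.ext fun s => congrFun h s
  exact (IsEmbedding.piMap fun _ => M.isEmbedding).comp h1

theorem Q_lift_surfaceRelator (a : SurfaceGen g n → G) :
    M.Q (FreeGroup.lift a (surfaceRelator g n)) = relator fun s => M.Q (a s) := by
  rw [surfaceRelator, map_mul, map_mul, relator, blocks, List.map_append, List.prod_append,
    map_list_prod, map_list_prod, map_list_prod, map_list_prod, List.ofFn_eq_map, List.ofFn_eq_map]
  simp only [List.map_map]
  congr 2
  · refine List.map_congr_left fun j _ => ?_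
    simp [block, M.Q_inv]
  · refine List.map_congr_left fun i _ => ?_
    simp [block]

theorem mem_range_tuple (v : SurfaceGen g n → Quat K) :
    v ∈ Set.range (M.tuple : HomSpace g n G → _) ↔ (∀ s, N (v s) = 1) ∧ relator v = 1 := by
  constructor
  · rintro ⟨ρ, rfl⟩
    refine ⟨M.N_tuple ρ, ?_⟩
    have h1 := M.Q_lift_surfaceRelator fun s => (show SurfaceGroup g n →* G from ρ) (gen s)
    have h2 : FreeGroup.lift (fun s => (show SurfaceGroup g n →* G from ρ) (gen s)) =
        (show SurfaceGroup g n →* G from ρ).comp (PresentedGroup.mk {surfaceRelator g n}) := by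
      ext s
      simp [gen]
      rfl
    rw [h2] at h1
    have h3 : PresentedGroup.mk {surfaceRelator g n} (surfaceRelator g n) = 1 :=
      PresentedGroup.one_of_mem (Set.mem_singleton _)
    rw [MonoidHom.comp_apply, h3, map_one, map_one] at h1
    exact h1.symm
  · rintro ⟨h1, h2⟩
    choose a ha using fun s => (M.mem_range (v s)).2 (h1 s)
    have h3 : ∀ r ∈ ({surfaceRelator g n} : Set (FreeGroup (SurfaceGen g n))),
        FreeGroup.lift a r = 1 := by
      rintro r rfl
      refine M.Q_injective ?_
      rw [M.Q_lift_surfaceRelator, map_one, ← h2]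
      simp only [ha]
    refine ⟨(PresentedGroup.toGroup h3 : SurfaceGroup g n →* G), ?_⟩
    ext1 s
    change M.Q (PresentedGroup.toGroup h3 (PresentedGroup.of s)) = _
    rw [PresentedGroup.toGroup.of, ha]

/-- The polynomial functions in the coordinates of the values at the generators. -/
def regular (g n : ℕ) : Subalgebra K (HomSpace g n G → K) :=
  Algebra.adjoin K (Set.range fun (x : SurfaceGen g n × Fin 4) (ρ : HomSpace g n G) =>
    toPi (M.tuple ρ x.1) x.2)

theorem regular_fg : (M.regular g n).FG :=
  ⟨(Set.finite_range _).toFinset, by rw [Set.Finite.coe_toFinset]; rfl⟩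

theorem toPi_mem_regular (s : SurfaceGen g n) (l : Fin 4) :
    (fun ρ => toPi (M.tuple ρ s) l) ∈ M.regular g n :=
  Algebra.subset_adjoin ⟨(s, l), rfl⟩

theorem linear_mem_regular (s : SurfaceGen g n) (φ : Quat K →ₗ[K] K) :
    (fun ρ => φ (M.tuple ρ s)) ∈ M.regular g n := by
  have : (fun ρ => φ (M.tuple ρ s)) =
      ∑ l : Fin 4, φ (toPi.symm (Pi.single l 1)) • fun ρ => toPi (M.tuple ρ s) l := by
    ext ρ
    have h1 : M.tuple ρ s = ∑ l : Fin 4, toPi (M.tuple ρ s) l • toPi.symm (Pi.single l 1) := by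
      apply toPi.injective
      rw [map_sum]
      simp only [map_smul, LinearEquiv.apply_symm_apply]
      ext l
      simp [Finset.sum_apply, Pi.single_apply]
    conv_lhs => rw [h1]
    simp [map_sum, mul_comm]
  rw [this]
  exact Subalgebra.sum_mem _ fun l _ => Subalgebra.smul_mem _ (M.toPi_mem_regular s l) _

theorem exists_contDiff_of_mem_regular {f : HomSpace g n G → K} (hf : f ∈ M.regular g n) :
    ∃ H : (SurfaceGen g n → Quat K) → K, ContDiff K ω H ∧ ∀ ρ, f ρ = H (M.tuple ρ) := by
  induction hf using Algebra.adjoin_induction with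
  | mem f hf =>
    obtain ⟨⟨s, l⟩, rfl⟩ := hf
    refine ⟨fun v => toPi (v s) l, ?_, fun ρ => rfl⟩
    have h : ContDiff K ω (toPi : Quat K → Fin 4 → K) :=
      (LinearMap.toContinuousLinearMap (toPi : Quat K ≃ₗ[K] (Fin 4 → K)).toLinearMap).contDiff
    fun_prop
  | algebraMap r => exact ⟨fun _ => r, contDiff_const, fun _ => rfl⟩
  | add f f' _ _ hf hf' =>
    obtain ⟨H, hH, h⟩ := hf
    obtain ⟨H', hH', h'⟩ := hf'
    exact ⟨_, hH.add hH', fun ρ => by simp [h, h']⟩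
  | mul f f' _ _ hf hf' =>
    obtain ⟨H, hH, h⟩ := hf
    obtain ⟨H', hH', h'⟩ := hf'
    exact ⟨_, hH.mul hH', fun ρ => by simp [h, h']⟩

/-- Half traces of noncommutative polynomials are the invariant functions used on quotients. The
induction carries all four coordinates, since the real part of a product involves each of them. -/
theorem evalTuple_mem_regular (x : FreeAlgebra K (SurfaceGen g n)) :
    (fun ρ => (evalTuple (M.tuple ρ) x).re) ∈ M.regular g n := by
  have coord : ∀ (s : SurfaceGen g n),
      (fun ρ => (M.tuple ρ s).re) ∈ M.regular g n ∧ (fun ρ => (M.tuple ρ s).imI) ∈ M.regular g n ∧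
      (fun ρ => (M.tuple ρ s).imJ) ∈ M.regular g n ∧ (fun ρ => (M.tuple ρ s).imK) ∈ M.regular g n :=
    fun s => ⟨M.toPi_mem_regular s 0, M.toPi_mem_regular s 1, M.toPi_mem_regular s 2,
      M.toPi_mem_regular s 3⟩
  let A := M.regular g n
  have hA : ∀ {f f' : HomSpace g n G → K}, f ∈ A → f' ∈ A → (fun ρ => f ρ * f' ρ) ∈ A :=
    fun h h' => A.mul_mem h h'
  have key : (fun ρ => (evalTuple (M.tuple ρ) x).re) ∈ A ∧
      (fun ρ => (evalTuple (M.tuple ρ) x).imI) ∈ A ∧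
      (fun ρ => (evalTuple (M.tuple ρ) x).imJ) ∈ A ∧
      (fun ρ => (evalTuple (M.tuple ρ) x).imK) ∈ A := by
    induction x using FreeAlgebra.induction with
    | grade0 r =>
      simp only [AlgHom.commutes]
      refine ⟨?_, ?_, ?_, ?_⟩
      all_goals
        simp only [Algebra.algebraMap_eq_smul_one, re_smul, imI_smul, imJ_smul, imK_smul]
        exact A.algebraMap_mem _
    | grade1 s => simp only [evalTuple_ι]; exact coord s
    | mul a b ha hb =>
      obtain ⟨a0, a1, a2, a3⟩ := ha
      obtain ⟨b0, b1, b2, b3⟩ := hb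
      simp only [map_mul, re_mul, imI_mul, imJ_mul, imK_mul]
      exact ⟨A.sub_mem (A.sub_mem (A.sub_mem (hA a0 b0) (hA a1 b1)) (hA a2 b2)) (hA a3 b3),
        A.sub_mem (A.add_mem (A.add_mem (hA a0 b1) (hA a1 b0)) (hA a2 b3)) (hA a3 b2),
        A.add_mem (A.add_mem (A.sub_mem (hA a0 b2) (hA a1 b3)) (hA a2 b0)) (hA a3 b1),
        A.add_mem (A.sub_mem (A.add_mem (hA a0 b3) (hA a1 b2)) (hA a2 b1)) (hA a3 b0)⟩
    | add a b ha hb =>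
      simp only [map_add, re_add, imI_add, imJ_add, imK_add]
      exact ⟨A.add_mem ha.1 hb.1, A.add_mem ha.2.1 hb.2.1, A.add_mem ha.2.2.1 hb.2.2.1,
        A.add_mem ha.2.2.2 hb.2.2.2⟩
  exact key.1

/-- The relative homomorphism space; `c i` is the half trace of `β_i`. -/
def rel (g : ℕ) (c : Fin n → K) : Set (HomSpace g n G) :=
  {ρ | ∀ i, M.tuple ρ (.beta i) ∈ cls (c i)}

/-- The values at the generators commute. -/
def IsAbelian (ρ : HomSpace g n G) : Prop :=
  ∀ s s', M.tuple ρ s * M.tuple ρ s' = M.tuple ρ s' * M.tuple ρ s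

theorem tuple_mem_relTuples {c : Fin n → K} {ρ : HomSpace g n G} :
    M.tuple ρ ∈ relTuples g c ↔ ρ ∈ M.rel g c :=
  ⟨fun h => h.2.1, fun h => ⟨M.N_tuple ρ, h, ((M.mem_range_tuple _).1 ⟨ρ, rfl⟩).2⟩⟩

theorem exists_tuple_eq {c : Fin n → K} {v : SurfaceGen g n → Quat K} (hv : v ∈ relTuples g c) :
    ∃ ρ ∈ M.rel g c, M.tuple ρ = v := by
  obtain ⟨ρ, rfl⟩ := (M.mem_range_tuple v).2 ⟨hv.1, hv.2.2⟩
  exact ⟨ρ, M.tuple_mem_relTuples.1 hv, rfl⟩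

/-- The non-coaxial locus in the homomorphism space. -/
def nonabelian (g : ℕ) (c : Fin n → K) : Set (HomSpace g n G) :=
  {ρ | ρ ∈ M.rel g c ∧ ¬ M.IsAbelian ρ}

/-- The irreducible homomorphisms. -/
def irreducible (g : ℕ) (c : Fin n → K) : Set (HomSpace g n G) :=
  {ρ | ρ ∈ M.rel g c ∧ IsIrred (M.tuple ρ)}

theorem isOpen_relator_ne : IsOpen {v : SurfaceGen g n → Quat K | relator v ≠ -1} :=
  isOpen_ne_fun (contDiff_relator (m := 1)).continuous continuous_const

/-- The non-coaxial locus as a regular level set. -/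
def homLocalQuotient (c : Fin n → K) :
    LocalQuotient K (SurfaceGen g n → Quat K) ((ConIndex g c → K) × (Fin 3 → K)) (Fin 0 → K)
      (M.nonabelian g c) (restrict (M.regular g n) (M.nonabelian g c)) where
  ι ρ := M.tuple ρ.1
  F := equations c
  q := id
  Ω := {v | relator v ≠ -1 ∧ ∃ s s', v s * v s' ≠ v s' * v s}
  -- The acting space is zero-dimensional: the level set is its own quotient.
  act _ v := v
  act' _ := 0
  isEmbedding := M.isEmbedding_tuple.comp IsEmbedding.subtypeVal
  isOpen := by
    refine isOpen_relator_ne.inter ?_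
    have : {v : SurfaceGen g n → Quat K | ∃ s s', v s * v s' ≠ v s' * v s} =
        ⋃ s, ⋃ s', {v | v s * v s' ≠ v s' * v s} := by
      ext v
      simp
    change IsOpen {v : SurfaceGen g n → Quat K | ∃ s s', v s * v s' ≠ v s' * v s}
    rw [this]
    exact isOpen_iUnion fun s => isOpen_iUnion fun s' =>
      isOpen_ne_fun (by fun_prop) (by fun_prop)
  mem_range v := by
    constructor
    · rintro ⟨⟨ρ, h1, h2⟩, rfl⟩
      obtain ⟨h3, h4⟩ := (mem_relTuples_iff c _).1 (M.tuple_mem_relTuples.2 h1)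
      refine ⟨⟨h3, ?_⟩, h4⟩
      by_contra! h5
      exact h2 h5
    · rintro ⟨⟨h1, h2⟩, h3⟩
      obtain ⟨ρ, hρ, rfl⟩ := M.exists_tuple_eq ((mem_relTuples_iff c _).2 ⟨h1, h3⟩)
      obtain ⟨s, s', hs⟩ := h2
      exact ⟨⟨ρ, hρ, fun h => hs (h s s')⟩, rfl⟩
  contDiff := contDiff_equations c
  surj := by
    rintro ⟨ρ, h1, h2⟩
    refine surjective_fderiv_equations (M.tuple_mem_relTuples.2 h1) ?_
    by_contra! h5
    exact h2 h5
  q_continuous := continuous_id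
  q_open := IsOpenMap.id
  q_surj := Function.surjective_id
  regular := by
    rintro _ ⟨f, hf, rfl⟩
    obtain ⟨H, hH, h⟩ := M.exists_contDiff_of_mem_regular hf
    exact ⟨H, hH, fun z => h z⟩
  act_contDiff _ := contDiff_fst.contDiffAt
  act_zero _ := rfl
  act_orbit := Filter.Eventually.of_forall fun _ z => ⟨z, rfl, rfl⟩
  act_deriv _ := hasFDerivAt_const _ _
  act_inj _ := Function.injective_of_subsingleton _
  ker z t _ h := by
    refine ⟨0, ?_⟩
    ext1 s
    -- Coordinates of the generators are regular functions, so regular functions separate all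
    -- tangent vectors.
    have key : ∀ φ : Quat K →L[K] K, φ (t s) = 0 := by
      intro φ
      let L : (SurfaceGen g n → Quat K) →L[K] K := φ.comp (ContinuousLinearMap.proj s)
      have := h _ ⟨_, M.linear_mem_regular s φ.toLinearMap, rfl⟩ L L.contDiff fun z => rfl
      rw [L.fderiv] at this
      exact this
    have h0 : t s = 0 := Quat.ext (key reL) (key imIL) (key imJL) (key imKL)
    rw [h0]
    rfl

theorem t2Space_homSpace (M : QuatModel K G) : T2Space (HomSpace g n G) := M.isEmbedding_tuple.t2Space

theorem secondCountableTopology_homSpace (M : QuatModel K G) : SecondCountableTopology (HomSpace g n G) := by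
  have := FiniteDimensional.proper K (SurfaceGen g n → Quat K)
  exact M.isEmbedding_tuple.secondCountableTopology

theorem finrank_hom (c : Fin n → K) :
    6 * (g : ℤ) - 3 + 2 * ((n : ℤ) - Nat.card {i // c i ^ 2 = 1}) =
      finrank K (SurfaceGen g n → Quat K) - finrank K ((ConIndex g c → K) × (Fin 3 → K)) := by
  rw [finrank_tuples, finrank_equations]
  push_cast
  ring

end QuatModel

theorem isOrientedManifold_nonabelian_complex (M : QuatModel ℂ G) (c : Fin n → ℂ) :
    IsOrientedManifold (restrict (M.regular g n) (M.nonabelian g c))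
      (6 * (g : ℤ) - 3 + 2 * ((n : ℤ) - Nat.card {i // c i ^ 2 = 1})) := by
  have := M.t2Space_homSpace (g := g) (n := n)
  have := M.secondCountableTopology_homSpace (g := g) (n := n)
  refine (M.homLocalQuotient c).isOrientedManifold_complex _ ?_
  rw [QuatModel.finrank_hom]
  simp

theorem isOrientedManifold_nonabelian_real (M : QuatModel ℝ G) (c : Fin n → ℝ) :
    IsOrientedManifold (restrict (M.regular g n) (M.nonabelian g c))
      (6 * (g : ℤ) - 3 + 2 * ((n : ℤ) - Nat.card {i // c i ^ 2 = 1})) := by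
  have := M.t2Space_homSpace (g := g) (n := n)
  have := M.secondCountableTopology_homSpace (g := g) (n := n)
  refine (M.homLocalQuotient c).isOrientedManifold_real ?_ (fun _ => 0) continuous_const
    (fun _ => Function.injective_of_subsingleton _) _ ?_
  · intro y
    change IsPreconnected ({y} : Set _)
    exact isPreconnected_singleton
  · rw [QuatModel.finrank_hom]
    simp

end Model

/-! ### The irreducible locus in the representation space -/

section RepModel

open Module Quat Topology

variable {K : Type*} [RCLike K] {G : Type*} [Group G] [TopologicalSpace G] {g n : ℕ}

namespace QuatModel

variable (M : QuatModel K G)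

/-- The conjugate of a homomorphism. -/
def conjHom (a : G) (ρ : HomSpace g n G) : HomSpace g n G :=
  (MulAut.conj a).toMonoidHom.comp (show SurfaceGroup g n →* G from ρ)

theorem tuple_conjHom (a : G) (ρ : HomSpace g n G) (s : SurfaceGen g n) :
    M.tuple (conjHom a ρ) s = M.Q a * M.tuple ρ s * conj (M.Q a) := by
  change M.Q (a * _ * a⁻¹) = _
  rw [map_mul, map_mul, M.Q_inv]
  rfl

theorem toOrbit_conjHom (a : G) (ρ : HomSpace g n G) : toOrbit (conjHom a ρ) = toOrbit ρ :=
  Quotient.sound (Setoid.symm' (conjSetoid g n G) ⟨a, fun _ => rfl⟩)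

theorem conj_smul_mem_cls {c : K} {x u : Quat K} (hu : N u = 1) (hx : x ∈ cls c) :
    u * x * conj u ∈ cls c := by
  refine ⟨by rw [N_mul, N_mul, N_conj, hu, hx.1]; simp, ?_, fun hc => ?_⟩
  · rw [mul_assoc, re_mul_comm, mul_assoc, conj_mul_of_N_eq_one hu, mul_one, hx.2.1]
  · rw [hx.2.2 hc, mul_smul_comm, mul_one, smul_mul_assoc, mul_conj_of_N_eq_one hu]

theorem conjHom_mem_rel {c : Fin n → K} {ρ : HomSpace g n G} (a : G) (h : ρ ∈ M.rel g c) :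
    conjHom a ρ ∈ M.rel g c := fun i => by
  rw [tuple_conjHom]
  exact conj_smul_mem_cls (M.N_Q a) (h i)

theorem evalTuple_conj {S : Type*} [Fintype S] {v w : S → Quat K} {u : Quat K} (hu : N u = 1)
    (h : ∀ s, w s = u * v s * conj u) (x : FreeAlgebra K S) :
    evalTuple w x = u * evalTuple v x * conj u := by
  induction x using FreeAlgebra.induction with
  | grade0 r =>
    rw [AlgHom.commutes, AlgHom.commutes, Algebra.algebraMap_eq_smul_one]
    rw [mul_smul_comm, mul_one, smul_mul_assoc, mul_conj_of_N_eq_one hu]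
  | grade1 s => simpa using h s
  | mul a b ha hb =>
    rw [map_mul, map_mul, ha, hb]
    calc u * evalTuple v a * conj u * (u * evalTuple v b * conj u)
        = u * evalTuple v a * (conj u * u) * evalTuple v b * conj u := by noncomm_ring
      _ = _ := by rw [conj_mul_of_N_eq_one hu]; noncomm_ring
  | add a b ha hb => rw [map_add, map_add, ha, hb]; noncomm_ring

theorem re_evalTuple_conjHom (a : G) (ρ : HomSpace g n G) (x : FreeAlgebra K (SurfaceGen g n)) :
    (evalTuple (M.tuple (conjHom a ρ)) x).re = (evalTuple (M.tuple ρ) x).re := by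
  rw [evalTuple_conj (M.N_Q a) (M.tuple_conjHom a ρ), mul_assoc, re_mul_comm, mul_assoc,
    conj_mul_of_N_eq_one (M.N_Q a), mul_one]

theorem isIrred_conjHom {ρ : HomSpace g n G} (a : G) (h : IsIrred (M.tuple ρ)) :
    IsIrred (M.tuple (conjHom a ρ)) := by
  intro y
  obtain ⟨x, hx⟩ := h (conj (M.Q a) * y * M.Q a)
  refine ⟨x, ?_⟩
  rw [evalTuple_conj (M.N_Q a) (M.tuple_conjHom a ρ), hx]
  have h1 := mul_conj_of_N_eq_one (M.N_Q a)
  calc M.Q a * (conj (M.Q a) * y * M.Q a) * conj (M.Q a)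
      = (M.Q a * conj (M.Q a)) * y * (M.Q a * conj (M.Q a)) := by noncomm_ring
    _ = y := by rw [h1, one_mul, mul_one]

/-- Dividing `x` by a square root of its norm gives an element of the group with the same
conjugation action. -/
theorem exists_conjHom_of_N_ne_zero (ρ : HomSpace g n G) {x : Quat K} (hx : N x ≠ 0) :
    ∃ a : G, ∀ s, M.tuple (conjHom a ρ) s = (N x)⁻¹ • (x * M.tuple ρ s * conj x) := by
  obtain ⟨r, hr⟩ := M.exists_sqrt x hx
  have hr0 : r ≠ 0 := by
    rintro rfl
    exact hx (by rw [← hr]; simp)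
  have hN : N (r⁻¹ • x) = 1 := by
    have : N (r⁻¹ • x) = r⁻¹ ^ 2 * N x := by simp [N]; ring
    rw [this, ← hr]
    field_simp
  obtain ⟨a, ha⟩ := (M.mem_range _).2 hN
  refine ⟨a, fun s => ?_⟩
  rw [tuple_conjHom, ha, map_smul, ← hr]
  simp only [smul_mul_assoc, mul_smul_comm, smul_smul]
  congr 1
  field_simp

/-- The projection to a quotient by conjugation behaves, on the irreducible locus, as the quotient
by the group action. -/
structure IsGoodQuotient {R : Type*} [TopologicalSpace R] (proj : HomSpace g n G → R)
    (c : Fin n → K) (T : Set R) : Prop where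
  continuous : Continuous proj
  invariant : ∀ a ρ, proj (conjHom a ρ) = proj ρ
  trace : ∀ x, ∃ h : R → K, ∀ ρ, h (proj ρ) = (evalTuple (M.tuple ρ) x).re
  image : T = proj '' M.irreducible g c
  open_image : ∀ U : Set (HomSpace g n G), IsOpen U →
    ∃ U' : Set R, IsOpen U' ∧ T ∩ U' = proj '' (M.irreducible g c ∩ U)

variable {R : Type*} [TopologicalSpace R] {proj : HomSpace g n G → R} {c : Fin n → K} {T : Set R}

/-- The projection of the irreducible locus. -/
def repProj (h : M.IsGoodQuotient proj c T) (ρ : M.irreducible g c) : T :=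
  ⟨proj ρ.1, h.image ▸ ⟨ρ.1, ρ.2, rfl⟩⟩

/-- The irreducible locus of the representation space as a local quotient. -/
def repLocalQuotient (h : M.IsGoodQuotient proj c T) :
    LocalQuotient K (SurfaceGen g n → Quat K) ((ConIndex g c → K) × (Fin 3 → K)) (Fin 3 → K)
      (M.irreducible g c) (restrict (pushforward (M.regular g n) proj) T) where
  ι ρ := M.tuple ρ.1
  F := equations c
  q := M.repProj h
  Ω := {v | relator v ≠ -1 ∧ IsIrred v}
  act := conjAct
  act' ρ := conjAct' (M.tuple ρ.1)
  isEmbedding := M.isEmbedding_tuple.comp IsEmbedding.subtypeVal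
  isOpen := isOpen_relator_ne.inter isOpen_isIrred
  mem_range v := by
    constructor
    · rintro ⟨⟨ρ, h1, h2⟩, rfl⟩
      obtain ⟨h3, h4⟩ := (mem_relTuples_iff c _).1 (M.tuple_mem_relTuples.2 h1)
      exact ⟨⟨h3, h2⟩, h4⟩
    · rintro ⟨⟨h1, h2⟩, h3⟩
      obtain ⟨ρ, hρ, rfl⟩ := M.exists_tuple_eq ((mem_relTuples_iff c _).2 ⟨h1, h3⟩)
      exact ⟨⟨ρ, hρ, h2⟩, rfl⟩
  contDiff := contDiff_equations c
  surj := by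
    rintro ⟨ρ, h1, h2⟩
    exact surjective_fderiv_equations (M.tuple_mem_relTuples.2 h1) h2.exists_not_comm
  q_continuous := (h.continuous.comp continuous_subtype_val).subtype_mk _
  q_open := by
    intro U hU
    obtain ⟨U₀, hU₀, rfl⟩ := isOpen_induced_iff.1 hU
    obtain ⟨U', hU', hT⟩ := h.open_image U₀ hU₀
    refine isOpen_induced_iff.2 ⟨U', hU', ?_⟩
    ext ⟨y, hy⟩
    constructor
    · intro hyU
      have : y ∈ T ∩ U' := ⟨hy, hyU⟩
      rw [hT] at this
      obtain ⟨ρ, ⟨h1, h2⟩, rfl⟩ := this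
      exact ⟨⟨ρ, h1⟩, h2, rfl⟩
    · rintro ⟨⟨ρ, h1⟩, h2, h3⟩
      have : y ∈ proj '' (M.irreducible g c ∩ U₀) := ⟨ρ, ⟨h1, h2⟩, congrArg Subtype.val h3⟩
      rw [← hT] at this
      exact this.2
  q_surj := by
    rintro ⟨y, hy⟩
    obtain ⟨ρ, h1, rfl⟩ := h.image ▸ hy
    exact ⟨⟨ρ, h1⟩, rfl⟩
  regular := by
    rintro _ ⟨f, hf, rfl⟩
    obtain ⟨H, hH, h⟩ := M.exists_contDiff_of_mem_regular hf
    exact ⟨H, hH, fun z => h z.1⟩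
  act_contDiff z := contDiffAt_conjAct _
  act_zero := conjAct_zero
  act_orbit := by
    filter_upwards [eventually_N_ne_zero] with p hp z
    obtain ⟨a, ha⟩ := M.exists_conjHom_of_N_ne_zero z.1 hp
    exact ⟨⟨conjHom a z.1, M.conjHom_mem_rel a z.2.1, M.isIrred_conjHom a z.2.2⟩,
      funext ha, Subtype.ext (h.invariant a z.1)⟩
  act_deriv z := hasFDerivAt_conjAct _
  act_inj z := by
    refine (injective_iff_map_eq_zero _).2 fun p hp => pure_eq_zero ?_
    refine z.2.2.eq_zero_of_comm (re_pure p) fun s => ?_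
    have := congrFun hp s
    rw [conjAct'_apply] at this
    exact sub_eq_zero.1 this
  ker z t _ ht := by
    -- Half traces are among the regular functions on the quotient, so `t` preserves them to first
    -- order and is an infinitesimal conjugation.
    obtain ⟨p, hp, hpt⟩ := z.2.2.exists_pure (t := t) fun x => by
      obtain ⟨f, hf⟩ := h.trace x
      have hc : ContDiff K ω fun v : SurfaceGen g n → Quat K => (evalTuple v x).re :=
        contDiff_re.comp (contDiff_evalTuple x)
      have hmem : (pullback K (Subtype.val : T → R)) f ∈
          restrict (pushforward (M.regular g n) proj) T := by
        refine ⟨f, ?_, rfl⟩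
        change (fun ρ => f (proj ρ)) ∈ M.regular g n
        simp only [hf]
        exact M.evalTuple_mem_regular x
      have h1 := ht _ hmem _ hc fun z => hf z.1
      rw [← h1]
      refine (fderiv_apply_of_hasDerivAt (hc.differentiable (by simp) _) ?_).symm
      exact hasDerivAt_comp_line reL (hasDerivAt_evalTuple _ t x)
    obtain ⟨p, rfl⟩ := exists_pure_eq hp
    exact ⟨p, funext fun s => hpt s⟩

theorem finrank_rep (c : Fin n → K) :
    6 * (g : ℤ) - 6 + 2 * ((n : ℤ) - Nat.card {i // c i ^ 2 = 1}) =
      finrank K (SurfaceGen g n → Quat K) - finrank K ((ConIndex g c → K) × (Fin 3 → K)) -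
        finrank K (Fin 3 → K) := by
  rw [finrank_tuples, finrank_equations]
  simp
  ring

end QuatModel

theorem isOrientedManifold_rep_complex {M : QuatModel ℂ G} {c : Fin n → ℂ} {R : Type*}
    [TopologicalSpace R] {proj : HomSpace g n G → R} {T : Set R} (h : M.IsGoodQuotient proj c T)
    [T2Space T] :
    IsOrientedManifold (restrict (pushforward (M.regular g n) proj) T)
      (6 * (g : ℤ) - 6 + 2 * ((n : ℤ) - Nat.card {i // c i ^ 2 = 1})) := by
  let D := M.repLocalQuotient h
  have := M.secondCountableTopology_homSpace (g := g) (n := n)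
  have : SecondCountableTopology T :=
    (IsOpenQuotientMap.mk D.q_surj D.q_continuous D.q_open).isQuotientMap.secondCountableTopology D.q_open
  exact D.isOrientedManifold_complex _ (QuatModel.finrank_rep c)

/-- The adjoint of the infinitesimal conjugation action at a real tuple. -/
def conjAdjoint {S : Type*} [Fintype S] (v : S → Quat ℝ) : (S → Quat ℝ) →L[ℝ] (Fin 3 → ℝ) :=
  (ContinuousLinearMap.pi ![imIL, imJL, imKL] : Quat ℝ →L[ℝ] (Fin 3 → ℝ)).comp
    (∑ s, ((ContinuousLinearMap.mul ℝ (Quat ℝ)).flip (v s) -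
      ContinuousLinearMap.mul ℝ (Quat ℝ) (v s)).comp
        ((LinearMap.toContinuousLinearMap conj).comp (ContinuousLinearMap.proj s)))

theorem continuous_conjAdjoint {S : Type*} [Fintype S] :
    Continuous (conjAdjoint : (S → Quat ℝ) → _) := by
  unfold conjAdjoint
  fun_prop

/-- Pairing `p` with the composite gives the sum of the reduced norms of the entries of the
infinitesimal conjugation, which is positive definite over `ℝ`. If it vanishes, `p` commutes with an
irreducible tuple. -/
theorem injective_conjAdjoint {S : Type*} [Fintype S] {v : S → Quat ℝ} (hv : IsIrred v) :
    Function.Injective fun p => conjAdjoint v (conjAct' v p) := by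
  refine (injective_iff_map_eq_zero ((conjAdjoint v).comp (conjAct' v))).2 fun p hp => ?_
  have h1 : ∑ s, N (pure p * v s - v s * pure p) =
      ∑ i, p i * conjAdjoint v (conjAct' v p) i := by
    have h2 : conjAdjoint v (conjAct' v p) = ∑ s,
        ![(conj (pure p * v s - v s * pure p) * v s - v s * conj (pure p * v s - v s * pure p)).imI,
          (conj (pure p * v s - v s * pure p) * v s - v s * conj (pure p * v s - v s * pure p)).imJ,
          (conj (pure p * v s - v s * pure p) * v s -
            v s * conj (pure p * v s - v s * pure p)).imK] := by
      simp only [conjAdjoint, ContinuousLinearMap.comp_apply, sum_apply,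
        map_sum]
      refine Finset.sum_congr rfl fun s _ => ?_
      ext i
      fin_cases i <;> rfl
    rw [h2]
    simp only [Finset.sum_apply, Finset.mul_sum]
    rw [Finset.sum_comm]
    refine Finset.sum_congr rfl fun s _ => ?_
    rw [Fin.sum_univ_three]
    simp [N]
    ring
  have h3 : ∑ s, N (pure p * v s - v s * pure p) = 0 := by
    rw [h1, show conjAdjoint v (conjAct' v p) = 0 from hp]
    simp
  have hnn : ∀ x : Quat ℝ, 0 ≤ N x := fun x => by unfold N; positivity
  rw [Finset.sum_eq_zero_iff_of_nonneg fun s _ => hnn _] at h3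
  refine pure_eq_zero (hv.eq_zero_of_comm (re_pure p) fun s => sub_eq_zero.1 ?_)
  have h4 := h3 s (Finset.mem_univ s)
  set x := pure p * v s - v s * pure p
  unfold N at h4
  ext <;> simp <;> nlinarith [sq_nonneg x.re, sq_nonneg x.imI, sq_nonneg x.imJ, sq_nonneg x.imK]

theorem N_pos_of_ne_zero {x : Quat ℝ} (hx : x ≠ 0) : 0 < N x := by
  have h0 : 0 ≤ N x := by unfold N; positivity
  refine lt_of_le_of_ne h0 fun h => hx ?_
  unfold N at h
  ext <;> simp <;> nlinarith [sq_nonneg x.re, sq_nonneg x.imI, sq_nonneg x.imJ, sq_nonneg x.imK]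

theorem isOrientedManifold_rep_real {M : QuatModel ℝ G} {c : Fin n → ℝ} {R : Type*}
    [TopologicalSpace R] {proj : HomSpace g n G → R} {T : Set R} (h : M.IsGoodQuotient proj c T)
    [T2Space T] (hfib : ∀ ρ ∈ M.irreducible g c, ∀ σ, proj σ = proj ρ → ∃ a, σ = QuatModel.conjHom a ρ) :
    IsOrientedManifold (restrict (pushforward (M.regular g n) proj) T)
      (6 * (g : ℤ) - 6 + 2 * ((n : ℤ) - Nat.card {i // c i ^ 2 = 1})) := by
  let D := M.repLocalQuotient h
  have := M.secondCountableTopology_homSpace (g := g) (n := n)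
  have : SecondCountableTopology T :=
    (IsOpenQuotientMap.mk D.q_surj D.q_continuous D.q_open).isQuotientMap.secondCountableTopology D.q_open
  refine D.isOrientedManifold_real ?_ conjAdjoint continuous_conjAdjoint
    (fun z => injective_conjAdjoint z.2.2) _ (QuatModel.finrank_rep c)
  intro y
  obtain ⟨z, rfl⟩ := D.q_surj y
  rw [← D.isEmbedding.isInducing.isPreconnected_image]
  -- The fibre is the orbit under conjugation by all nonzero quaternions, and the complement of the
  -- origin in a four-dimensional real space is connected.
  have himage : D.ι '' (D.q ⁻¹' {D.q z}) =
      (fun (x : Quat ℝ) s => (N x)⁻¹ • (x * M.tuple z.1 s * conj x)) '' {0}ᶜ := by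
    ext v
    constructor
    · rintro ⟨w, hw, rfl⟩
      obtain ⟨a, ha⟩ := hfib z.1 z.2 w.1 (congrArg Subtype.val hw)
      refine ⟨M.Q a, ?_, ?_⟩
      · intro h0
        have := M.N_Q a
        rw [show M.Q a = 0 from h0] at this
        simp [N] at this
      · ext1 s
        change (N (M.Q a))⁻¹ • _ = M.tuple w.1 s
        rw [ha, M.tuple_conjHom, M.N_Q, inv_one, one_smul]
    · rintro ⟨x, hx, rfl⟩
      obtain ⟨a, ha⟩ := M.exists_conjHom_of_N_ne_zero z.1 (N_pos_of_ne_zero hx).ne'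
      exact ⟨⟨QuatModel.conjHom a z.1, M.conjHom_mem_rel a z.2.1, M.isIrred_conjHom a z.2.2⟩,
        Subtype.ext (h.invariant a z.1), funext ha⟩
  rw [himage]
  refine IsPreconnected.image ?_ _ ?_
  · refine (isConnected_compl_singleton_of_one_lt_rank ?_ 0).isPreconnected
    rw [← Module.finrank_eq_rank, finrank_eq_four]
    norm_num
  · refine continuousOn_pi.2 fun s => ?_
    have h1 : ContinuousOn (fun x : Quat ℝ => (N x)⁻¹) {0}ᶜ :=
      continuous_N.continuousOn.inv₀ fun x hx => (N_pos_of_ne_zero hx).ne'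
    have h2 : ContinuousOn (fun x : Quat ℝ => x * M.tuple z.1 s * conj x) {0}ᶜ :=
      Continuous.continuousOn (by fun_prop)
    exact h1.smul h2

end RepModel

/-! ### Commuting unit quaternions and one-parameter subgroups -/

section Coaxial

open Module Quat Topology

theorem exp_smul_of_mul_self_eq_zero {X : Matrix (Fin 2) (Fin 2) ℂ} (h : X * X = 0) (t : ℂ) :
    NormedSpace.exp (t • X) = 1 + t • X := by
  have h2 : ∀ m : ℕ, m ∉ Finset.range 2 → ((m.factorial : ℂ)⁻¹) • (t • X) ^ m = 0 := by
    intro m hm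
    obtain ⟨k, rfl⟩ : ∃ k, m = k + 2 := ⟨m - 2, by simp at hm; omega⟩
    rw [pow_add, pow_two, smul_mul_smul_comm, h, smul_zero, mul_zero, smul_zero]
  rw [NormedSpace.exp_eq_tsum ℂ]
  simp only
  rw [tsum_eq_sum h2, Finset.sum_range_succ, Finset.sum_range_one]
  simp

/-- The elements `(1 ∓ iX)/2` are complementary idempotents, so `X` acts as `i` and `-i` on two
lines. The exponential is computed in `ℂ × ℂ` and carried over by a continuous ring homomorphism. -/
theorem exp_smul_of_mul_self_eq_neg_one {X : Matrix (Fin 2) (Fin 2) ℂ} (h : X * X = -1) (t : ℂ) :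
    NormedSpace.exp (t • X) = Complex.cos t • 1 + Complex.sin t • X := by
  let P : Matrix (Fin 2) (Fin 2) ℂ := (1 / 2 : ℂ) • (1 - Complex.I • X)
  let P' : Matrix (Fin 2) (Fin 2) ℂ := (1 / 2 : ℂ) • (1 + Complex.I • X)
  have hPP : P * P = P := by
    simp only [P, smul_mul_smul_comm, sub_mul, mul_sub, one_mul, mul_one, h, Complex.I_mul_I]
    module
  have hPP' : P * P' = 0 := by
    simp only [P, P', smul_mul_smul_comm, sub_mul, mul_add, one_mul, mul_one, h, Complex.I_mul_I]
    module
  have hP'P : P' * P = 0 := by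
    simp only [P, P', smul_mul_smul_comm, add_mul, mul_sub, one_mul, mul_one, h, Complex.I_mul_I]
    module
  have hP'P' : P' * P' = P' := by
    simp only [P', smul_mul_smul_comm, add_mul, mul_add, one_mul, mul_one, h, Complex.I_mul_I]
    module
  let φ : ℂ × ℂ →+* Matrix (Fin 2) (Fin 2) ℂ :=
    { toFun := fun z => z.1 • P + z.2 • P'
      map_one' := by simp only [Prod.fst_one, Prod.snd_one, P, P']; module
      map_zero' := by simp
      map_add' := fun x y => by simp only [Prod.fst_add, Prod.snd_add]; module
      map_mul' := fun x y => by
        simp only [Prod.fst_mul, Prod.snd_mul, add_mul, mul_add, smul_mul_smul_comm, hPP, hPP',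
          hP'P, hP'P']
        module }
  have hφ : Continuous φ := by
    change Continuous fun z : ℂ × ℂ => z.1 • P + z.2 • P'
    fun_prop
  let := NormedAlgebra.restrictScalars ℚ ℂ (ℂ × ℂ)
  have h1 : φ (NormedSpace.exp (t * Complex.I, -(t * Complex.I))) =
      NormedSpace.exp (φ (t * Complex.I, -(t * Complex.I))) := by
    let : NormedRing (Matrix (Fin 2) (Fin 2) ℂ) := Matrix.linftyOpNormedRing
    exact NormedSpace.map_exp φ hφ _
  have h2 : φ (t * Complex.I, -(t * Complex.I)) = t • X := by
    change (t * Complex.I) • P + (-(t * Complex.I)) • P' = t • X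
    have hI : Complex.I * Complex.I = -1 := Complex.I_mul_I
    simp only [P, P']
    match_scalars
    · ring
    · linear_combination -t * hI
  rw [← h2, ← h1]
  have h3 : NormedSpace.exp ((t * Complex.I, -(t * Complex.I)) : ℂ × ℂ) =
      (Complex.exp (t * Complex.I), Complex.exp (-(t * Complex.I))) := by
    refine Prod.ext ?_ ?_
    · rw [Prod.fst_exp, Complex.exp_eq_exp_ℂ]
    · rw [Prod.snd_exp, Complex.exp_eq_exp_ℂ]
  rw [h3]
  change Complex.exp (t * Complex.I) • P + Complex.exp (-(t * Complex.I)) • P' = _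
  have hc : Complex.cos t = (Complex.exp (t * Complex.I) + Complex.exp (-(t * Complex.I))) / 2 := by
    rw [Complex.cos, neg_mul]
  have hs : Complex.sin t =
      (Complex.exp (-(t * Complex.I)) - Complex.exp (t * Complex.I)) * Complex.I / 2 := by
    rw [Complex.sin, neg_mul]
  rw [hc, hs]
  simp only [P, P']
  match_scalars <;> ring

/-! ### Centralizers of pure quaternions and common axes. -/

section Centralizer

variable {K : Type*} [RCLike K]

/-- The centralizer of a nonzero pure quaternion. -/
theorem Quat.eq_add_smul_of_comm {z x : Quat K} (hz : z ≠ 0) (hz0 : z.re = 0)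
    (h : z * x = x * z) : ∃ b : K, x = x.re • 1 + b • z := by
  have h2 : (2 : K) ≠ 0 := two_ne_zero
  have cx1 := congrArg Quat.imI h
  have cx2 := congrArg Quat.imJ h
  have cx3 := congrArg Quat.imK h
  simp only [imI_mul, imJ_mul, imK_mul, hz0, zero_mul, zero_add, mul_zero, add_zero]
    at cx1 cx2 cx3
  have e1 : x.imJ * z.imK = x.imK * z.imJ := by
    apply mul_left_cancel₀ h2; linear_combination -cx1
  have e2 : x.imK * z.imI = x.imI * z.imK := by
    apply mul_left_cancel₀ h2; linear_combination -cx2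
  have e3 : x.imI * z.imJ = x.imJ * z.imI := by
    apply mul_left_cancel₀ h2; linear_combination -cx3
  by_cases h1 : z.imI = 0
  · by_cases h3 : z.imJ = 0
    · have h4 : z.imK ≠ 0 := fun h4 => hz (Quat.ext hz0 h1 h3 h4)
      refine ⟨x.imK / z.imK, ?_⟩
      ext <;> simp [hz0] <;> field_simp <;> first | linear_combination e1 | linear_combination -e2
    · refine ⟨x.imJ / z.imJ, ?_⟩
      ext <;> simp [hz0] <;> field_simp <;> first | linear_combination e3 | linear_combination -e1
  · refine ⟨x.imI / z.imI, ?_⟩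
    ext <;> simp [hz0] <;> field_simp <;> first | linear_combination e2 | linear_combination -e3

/-- The imaginary part of a non-scalar entry serves as common axis; if all entries are scalar, any
axis does. -/
theorem exists_comm_pure {S : Type*} {v : S → Quat K} (h : ∀ s s', v s * v s' = v s' * v s) :
    ∃ z : Quat K, z ≠ 0 ∧ z.re = 0 ∧ ∀ s, z * v s = v s * z := by
  by_cases hc : ∀ s, v s = (v s).re • 1
  · refine ⟨mk 0 1 0 0, fun h0 => one_ne_zero (congrArg Quat.imI h0), rfl, fun s => ?_⟩
    rw [hc s]
    simp
  · push Not at hc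
    obtain ⟨s, hs⟩ := hc
    refine ⟨v s - (v s).re • 1, sub_ne_zero.2 hs, by simp, fun s' => ?_⟩
    rw [sub_mul, mul_sub, h s s']
    simp

/-- The axis of a commuting tuple can be normalised. -/
theorem Quat.N_smul (a : K) (x : Quat K) : N (a • x) = a ^ 2 * N x := by
  simp [N]; ring

theorem Quat.N_add_smul {z : Quat K} (hz0 : z.re = 0) (a b : K) :
    N (a • 1 + b • z) = a ^ 2 + b ^ 2 * N z := by
  simp [N, hz0]; ring

theorem Quat.mul_self_of_pure {z : Quat K} (hz0 : z.re = 0) : z * z = (-N z) • 1 := by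
  ext <;> simp [N, hz0] <;> ring

end Centralizer

namespace QuatModel

variable {K : Type*} [RCLike K] {G : Type*} [Group G] [TopologicalSpace G] {g n : ℕ}
variable (M : QuatModel K G)

/-- The stabilizer of a quaternion. -/
def stabilizer (z : Quat K) : Subgroup G where
  carrier := {a | z * M.Q a = M.Q a * z}
  mul_mem' {a b} ha hb := by
    change z * M.Q (a * b) = M.Q (a * b) * z
    rw [map_mul]
    exact (Commute.mul_right (ha : Commute z (M.Q a)) (hb : Commute z (M.Q b)))
  one_mem' := by change z * M.Q 1 = M.Q 1 * z; simp
  inv_mem' {a} ha := by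
    change z * M.Q a = M.Q a * z at ha
    change z * M.Q a⁻¹ = M.Q a⁻¹ * z
    have h1 : M.Q a⁻¹ * M.Q a = 1 := by rw [← map_mul, inv_mul_cancel, map_one]
    have h2 : M.Q a * M.Q a⁻¹ = 1 := by rw [← map_mul, mul_inv_cancel, map_one]
    calc z * M.Q a⁻¹ = M.Q a⁻¹ * M.Q a * z * M.Q a⁻¹ := by rw [h1, one_mul]
      _ = M.Q a⁻¹ * (z * M.Q a) * M.Q a⁻¹ := by rw [ha]; noncomm_ring
      _ = M.Q a⁻¹ * z * (M.Q a * M.Q a⁻¹) := by noncomm_ring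
      _ = M.Q a⁻¹ * z := by rw [h2, mul_one]

theorem comm_of_comm_tuple {z : Quat K} {ρ : HomSpace g n G}
    (h : ∀ s, z * M.tuple ρ s = M.tuple ρ s * z) (γ : SurfaceGroup g n) :
    z * M.Q ((show SurfaceGroup g n →* G from ρ) γ) =
      M.Q ((show SurfaceGroup g n →* G from ρ) γ) * z :=
  PresentedGroup.generated_by _ ((M.stabilizer z).comap (show SurfaceGroup g n →* G from ρ)) h γ

/-- The values of an abelian homomorphism lie in a common torus or in `±` a common unipotent
subgroup. -/
theorem IsAbelian.exists_axis {M : QuatModel K G} {ρ : HomSpace g n G} (h : M.IsAbelian ρ) :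
    ∃ z : Quat K, z ≠ 0 ∧ z.re = 0 ∧ (N z = 1 ∨ N z = 0) ∧
      ∀ γ, ∃ a b : K, a ^ 2 + b ^ 2 * N z = 1 ∧
        M.Q ((show SurfaceGroup g n →* G from ρ) γ) = a • 1 + b • z := by
  obtain ⟨z, hz, hz0, hs⟩ := exists_comm_pure h
  -- The axis is rescaled to norm one by a square root of its norm, unless it is isotropic.
  have key : ∃ z : Quat K, z ≠ 0 ∧ z.re = 0 ∧ (N z = 1 ∨ N z = 0) ∧
      ∀ s, z * M.tuple ρ s = M.tuple ρ s * z := by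
    by_cases hN : N z = 0
    · exact ⟨z, hz, hz0, Or.inr hN, hs⟩
    · obtain ⟨r, hr⟩ := M.exists_sqrt z hN
      have hr0 : r ≠ 0 := by
        rintro rfl
        exact hN (by rw [← hr]; simp)
      refine ⟨r⁻¹ • z, smul_ne_zero (inv_ne_zero hr0) hz, by simp [hz0], Or.inl ?_, fun s => ?_⟩
      · rw [Quat.N_smul, ← hr]; field_simp
      · rw [smul_mul_assoc, hs, mul_smul_comm]
  obtain ⟨z, hz, hz0, hN, hs⟩ := key
  refine ⟨z, hz, hz0, hN, fun γ => ?_⟩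
  obtain ⟨b, hb⟩ := Quat.eq_add_smul_of_comm hz hz0 (M.comm_of_comm_tuple hs γ)
  refine ⟨_, b, ?_, hb⟩
  rw [← Quat.N_add_smul hz0, ← hb, M.N_Q]

end QuatModel

/-! ### Quaternions and complex matrices -/

/-- The isomorphism of the complex quaternions with the complex matrices. -/
def matOfQuat : Quat ℂ ≃ₐ[ℂ] Matrix (Fin 2) (Fin 2) ℂ where
  toFun x := !![x.re + x.imI * Complex.I, x.imJ + x.imK * Complex.I;
    -x.imJ + x.imK * Complex.I, x.re - x.imI * Complex.I]
  invFun m := mk ((m 0 0 + m 1 1) / 2) (-Complex.I * (m 0 0 - m 1 1) / 2) ((m 0 1 - m 1 0) / 2)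
    (-Complex.I * (m 0 1 + m 1 0) / 2)
  left_inv x := by
    ext <;> simp <;> ring_nf <;> simp [Complex.I_sq]
  right_inv m := by
    ext i j
    fin_cases i <;> fin_cases j <;> simp <;> ring_nf <;> simp [Complex.I_sq] <;> ring
  map_mul' x y := by
    ext i j
    fin_cases i <;> fin_cases j <;> simp [Matrix.mul_apply] <;> ring_nf <;> simp [Complex.I_sq] <;>
      ring
  map_add' x y := by
    ext i j
    fin_cases i <;> fin_cases j <;> simp <;> ring
  commutes' r := by
    ext i j
    fin_cases i <;> fin_cases j <;> simp [Algebra.algebraMap_eq_smul_one]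

theorem matOfQuat_apply (x : Quat ℂ) : matOfQuat x =
    !![x.re + x.imI * Complex.I, x.imJ + x.imK * Complex.I;
      -x.imJ + x.imK * Complex.I, x.re - x.imI * Complex.I] := rfl

theorem det_matOfQuat (x : Quat ℂ) : (matOfQuat x).det = N x := by
  rw [matOfQuat_apply, Matrix.det_fin_two]
  simp [N]
  linear_combination (-x.imI ^ 2 - x.imK ^ 2) * Complex.I_sq

theorem trace_matOfQuat (x : Quat ℂ) : (matOfQuat x).trace = 2 * x.re := by
  rw [matOfQuat_apply, Matrix.trace_fin_two]
  simp
  ring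

theorem continuous_matOfQuat : Continuous matOfQuat := by
  refine continuous_pi fun i => continuous_pi fun j => ?_
  fin_cases i <;> fin_cases j <;> simp [matOfQuat_apply] <;> fun_prop

theorem continuous_matOfQuat_symm : Continuous matOfQuat.symm :=
  LinearMap.continuous_of_finiteDimensional matOfQuat.symm.toLinearMap

/-- The group `SL₂(ℂ)` as the group of complex quaternions of norm one. -/
def modelSL2 : QuatModel ℂ SL2C where
  Q := (matOfQuat.symm : Matrix (Fin 2) (Fin 2) ℂ →* Quat ℂ).comp
    Matrix.SpecialLinearGroup.coeMonoidHom
  isEmbedding := by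
    have h : IsEmbedding (matOfQuat.symm : Matrix (Fin 2) (Fin 2) ℂ → Quat ℂ) :=
      IsEmbedding.of_comp continuous_matOfQuat_symm continuous_matOfQuat (by
        convert IsEmbedding.id
        ext1 x
        exact matOfQuat.apply_symm_apply x)
    exact h.comp IsEmbedding.subtypeVal
  mem_range x := by
    constructor
    · rintro ⟨a, rfl⟩
      rw [← det_matOfQuat]
      change (matOfQuat (matOfQuat.symm a.1)).det = 1
      rw [AlgEquiv.apply_symm_apply]
      exact a.2
    · intro h
      refine ⟨⟨matOfQuat x, by rw [det_matOfQuat, h]⟩, ?_⟩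
      exact matOfQuat.symm_apply_apply x
  exists_sqrt x _ := IsAlgClosed.exists_pow_nat_eq _ two_pos

theorem modelSL2_Q (a : SL2C) : modelSL2.Q a = matOfQuat.symm a.1 := rfl

theorem matOfQuat_modelSL2 (a : SL2C) : matOfQuat (modelSL2.Q a) = a.1 := by
  rw [modelSL2_Q, AlgEquiv.apply_symm_apply]

/-- The complexification of the quaternions. -/
def complexify : Quat ℝ →+* Quat ℂ where
  toFun x := mk x.re x.imI x.imJ x.imK
  map_one' := by ext <;> simp
  map_zero' := by ext <;> simp
  map_add' x y := by ext <;> simp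
  map_mul' x y := by ext <;> simp

theorem complexify_apply (x : Quat ℝ) : complexify x = mk (x.re : ℂ) x.imI x.imJ x.imK := rfl

theorem complexify_smul (a : ℝ) (x : Quat ℝ) : complexify (a • x) = (a : ℂ) • complexify x := by
  ext <;> simp only [complexify_apply, re_smul, imI_smul, imJ_smul, imK_smul, re_mk, imI_mk, imJ_mk,
    imK_mk, Complex.ofReal_mul]

theorem complexify_injective : Function.Injective complexify := by
  intro x y h
  ext
  · exact Complex.ofReal_injective (congrArg Quat.re h)
  · exact Complex.ofReal_injective (congrArg Quat.imI h)
  · exact Complex.ofReal_injective (congrArg Quat.imJ h)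
  · exact Complex.ofReal_injective (congrArg Quat.imK h)

theorem N_complexify (x : Quat ℝ) : N (complexify x) = (N x : ℝ) := by
  simp [complexify_apply, N]

theorem continuous_complexify : Continuous complexify := by
  have h : (complexify : Quat ℝ → Quat ℂ) =
      fun x => toPi.symm ![(x.re : ℂ), x.imI, x.imJ, x.imK] := rfl
  rw [h]
  refine (LinearMap.continuous_of_finiteDimensional
    (toPi : Quat ℂ ≃ₗ[ℂ] (Fin 4 → ℂ)).symm.toLinearMap).comp (continuous_pi fun i => ?_)
  fin_cases i <;> simp <;> fun_prop

theorem matOfQuat_complexify_mem {x : Quat ℝ} (h : N x = 1) :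
    matOfQuat (complexify x) ∈ Matrix.specialUnitaryGroup (Fin 2) ℂ := by
  have h' : ((N x : ℝ) : ℂ) = 1 := by exact_mod_cast h
  simp only [N, Complex.ofReal_add, Complex.ofReal_pow] at h'
  rw [Matrix.mem_specialUnitaryGroup_iff, Matrix.mem_unitaryGroup_iff]
  refine ⟨?_, by rw [det_matOfQuat, N_complexify, h]; simp⟩
  ext i j
  fin_cases i <;> fin_cases j <;>
    simp [matOfQuat_apply, complexify_apply, Matrix.mul_apply, Matrix.star_eq_conjTranspose] <;>
    first
      | ring1
      | linear_combination h' - ((x.imI : ℂ) ^ 2 + (x.imK : ℂ) ^ 2) * Complex.I_sq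

/-- The quaternion of a special unitary matrix. -/
def quatOfSU2 (B : SU2) : Quat ℝ :=
  mk ((B : Matrix (Fin 2) (Fin 2) ℂ) 0 0).re ((B : Matrix (Fin 2) (Fin 2) ℂ) 0 0).im
    ((B : Matrix (Fin 2) (Fin 2) ℂ) 0 1).re ((B : Matrix (Fin 2) (Fin 2) ℂ) 0 1).im

/-- For a unitary matrix of determinant one the adjoint equals the adjugate, which determines the
second row from the first. -/
theorem matOfQuat_quatOfSU2 (B : SU2) : matOfQuat (complexify (quatOfSU2 B)) = B.1 := by
  obtain ⟨h1, h2⟩ := Matrix.mem_specialUnitaryGroup_iff.1 B.2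
  have h3 : star B.1 = B.1.adjugate := by
    calc star B.1 = star B.1 * (B.1 * B.1.adjugate) := by
          rw [Matrix.mul_adjugate, h2, one_smul, mul_one]
      _ = B.1.adjugate := by
          rw [← mul_assoc, Matrix.mem_unitaryGroup_iff'.1 h1, one_mul]
  have h00 : star (B.1 0 0) = B.1 1 1 := by
    simpa [Matrix.adjugate_fin_two, Matrix.star_apply] using congrFun (congrFun h3 0) 0
  have h01 : star (B.1 0 1) = -B.1 1 0 := by
    simpa [Matrix.adjugate_fin_two, Matrix.star_apply] using congrFun (congrFun h3 1) 0
  have h10 : B.1 1 0 = -star (B.1 0 1) := by rw [h01, neg_neg]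
  ext i j
  fin_cases i <;> fin_cases j
  · exact Complex.re_add_im _
  · exact Complex.re_add_im _
  · change -((B.1 0 1).re : ℂ) + ((B.1 0 1).im : ℂ) * Complex.I = B.1 1 0
    rw [h10]
    apply Complex.ext <;> simp
  · change ((B.1 0 0).re : ℂ) - ((B.1 0 0).im : ℂ) * Complex.I = B.1 1 1
    rw [← h00]
    apply Complex.ext <;> simp

/-- The group `SU₂` as the group of real quaternions of norm one. -/
def modelSU2 : QuatModel ℝ SU2 where
  Q :=
    { toFun := quatOfSU2
      map_one' := complexify_injective (matOfQuat.injective (by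
        rw [matOfQuat_quatOfSU2, map_one, map_one]; rfl))
      map_mul' := fun B B' => complexify_injective (matOfQuat.injective (by
        rw [matOfQuat_quatOfSU2, map_mul, map_mul, matOfQuat_quatOfSU2, matOfQuat_quatOfSU2]
        rfl)) }
  isEmbedding := by
    have hent : ∀ i j, Continuous fun B : SU2 => (B : Matrix (Fin 2) (Fin 2) ℂ) i j :=
      fun i j => continuous_subtype_val.matrix_elem i j
    refine IsEmbedding.of_comp (g := fun x => matOfQuat (complexify x)) ?_
      (continuous_matOfQuat.comp continuous_complexify) ?_
    · refine (LinearMap.continuous_of_finiteDimensional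
        (toPi : Quat ℝ ≃ₗ[ℝ] (Fin 4 → ℝ)).symm.toLinearMap).comp
        (f := fun B : SU2 => ![(B.1 0 0).re, (B.1 0 0).im, (B.1 0 1).re, (B.1 0 1).im]) ?_
      refine continuous_pi fun i => ?_
      fin_cases i
      · exact Complex.continuous_re.comp (hent 0 0)
      · exact Complex.continuous_im.comp (hent 0 0)
      · exact Complex.continuous_re.comp (hent 0 1)
      · exact Complex.continuous_im.comp (hent 0 1)
    · convert (IsEmbedding.subtypeVal : IsEmbedding (Subtype.val : SU2 → Matrix (Fin 2) (Fin 2) ℂ))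
      ext1 B
      exact matOfQuat_quatOfSU2 B
  mem_range x := by
    constructor
    · rintro ⟨B, rfl⟩
      have h1 := det_matOfQuat (complexify (quatOfSU2 B))
      rw [matOfQuat_quatOfSU2, (Matrix.mem_specialUnitaryGroup_iff.1 B.2).2, N_complexify] at h1
      exact_mod_cast h1.symm
    · intro h
      refine ⟨⟨_, matOfQuat_complexify_mem h⟩, complexify_injective (matOfQuat.injective ?_)⟩
      exact matOfQuat_quatOfSU2 _
  exists_sqrt x _ := ⟨√(N x), Real.sq_sqrt (by unfold N; positivity)⟩

theorem matOfQuat_complexify_Q (B : SU2) : matOfQuat (complexify (modelSU2.Q B)) = B.1 :=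
  matOfQuat_quatOfSU2 B

/-- Positive definiteness leaves no room for an imaginary part. This fails over `ℂ`, for instance at
unipotent elements, hence the extra clause in `cls`. -/
theorem eq_smul_one_of_N_eq_one {y : Quat ℝ} {c : ℝ} (hy : N y = 1) (hyc : y.re = c)
    (hc : c ^ 2 = 1) : y = c • 1 := by
  rw [N, hyc, hc] at hy
  ext <;> simp [hyc] <;> nlinarith [sq_nonneg y.imI, sq_nonneg y.imJ, sq_nonneg y.imK]

/-- Since `p` and `q` have the same scalar square, every `p y + y q` intertwines them. The norms of
these elements for `y = 1, i, j, k` add up to `4 (N p + N q) = 8 N p`, so one of them is nonzero. -/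
theorem Quat.exists_conj_of_N_eq {K : Type*} [RCLike K] {p q : Quat K} (hp : p.re = 0)
    (hq : q.re = 0) (hN : N p = N q) (h0 : N p ≠ 0) : ∃ h : Quat K, N h ≠ 0 ∧ p * h = h * q := by
  have key : ∀ y : Quat K, p * (p * y + y * q) = (p * y + y * q) * q := by
    intro y
    calc p * (p * y + y * q) = p * p * y + p * y * q := by noncomm_ring
      _ = p * y * q + y * (q * q) := by
        rw [Quat.mul_self_of_pure hp, Quat.mul_self_of_pure hq, hN, smul_mul_assoc, one_mul,
          mul_smul_comm, mul_one, add_comm]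
      _ = _ := by noncomm_ring
  by_contra! hall
  have hy : ∀ y : Quat K, N (p * y + y * q) = 0 := fun y => by
    by_contra h
    exact hall _ h (key y)
  refine h0 ?_
  have h1 := hy 1
  have h2 := hy (mk 0 1 0 0)
  have h3 := hy (mk 0 0 1 0)
  have h4 := hy (mk 0 0 0 1)
  have h8 : (8 : K) ≠ 0 := by norm_num
  apply mul_left_cancel₀ h8
  simp [N, hp, hq] at h1 h2 h3 h4 hN ⊢
  linear_combination (h1 + h2 + h3 + h4) / 8 + hN / 2

/-- Half the trace of the elements of the class `conjClassSU2 δ`. -/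
theorem mem_conjClassSU2_iff {δ : ℝ} {B : SU2} :
    B ∈ conjClassSU2 δ ↔ (B : Matrix (Fin 2) (Fin 2) ℂ).trace = 2 * Complex.cos (Real.pi * δ) := by
  have hdet : (B : Matrix (Fin 2) (Fin 2) ℂ).det = 1 := (Matrix.mem_specialUnitaryGroup_iff.1 B.2).2
  have h1 : Complex.exp (Real.pi * δ * Complex.I) * Complex.exp (-(Real.pi * δ * Complex.I)) = 1 := by
    rw [← Complex.exp_add, add_neg_cancel, Complex.exp_zero]
  have h2 : 2 * Complex.cos (Real.pi * δ) =
      Complex.exp (Real.pi * δ * Complex.I) + Complex.exp (-(Real.pi * δ * Complex.I)) := by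
    rw [Complex.cos, neg_mul]
    ring
  have h3 : (Polynomial.X - Polynomial.C (Complex.exp (Real.pi * δ * Complex.I))) *
      (Polynomial.X - Polynomial.C (Complex.exp (-(Real.pi * δ * Complex.I)))) =
      Polynomial.X ^ 2 - Polynomial.C (2 * Complex.cos (Real.pi * δ)) * Polynomial.X +
        Polynomial.C 1 := by
    rw [h2, ← h1, Polynomial.C_add, Polynomial.C_mul]
    ring
  change (B : Matrix (Fin 2) (Fin 2) ℂ).charpoly = _ ↔ _
  rw [h3, Matrix.charpoly_fin_two, hdet]
  constructor
  · intro h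
    have := congrArg (fun p => Polynomial.coeff p 1) h
    simpa [Polynomial.coeff_X, Polynomial.coeff_one] using this
  · intro h
    rw [h]

/-- Half the traces prescribed by the angles. -/
def cosAngle {n : ℕ} (θ : Fin n → ℝ) (i : Fin n) : ℝ := Real.cos (Real.pi * oddDist (θ i))

theorem mem_specialUnitaryGroup_matOfQuat {a b : ℝ} (h : a ^ 2 + b ^ 2 = 1) :
    matOfQuat (mk (a : ℂ) b 0 0) ∈ Matrix.specialUnitaryGroup (Fin 2) ℂ := by
  have := matOfQuat_complexify_mem (x := mk a b 0 0) (by simpa [N] using h)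
  rw [complexify_apply] at this
  simpa using this

theorem regularSL2_eq (g n : ℕ) : regularSL2 g n = modelSL2.regular g n := by
  apply le_antisymm
  · refine Algebra.adjoin_le ?_
    rintro _ ⟨s, i, j, rfl⟩
    let φ : Quat ℂ →ₗ[ℂ] ℂ := (Matrix.entryLinearMap ℂ ℂ i j).comp matOfQuat.toLinearMap
    have h1 : (fun ρ : HomSpace g n SL2C =>
        ((show SurfaceGroup g n →* SL2C from ρ) (gen s) : Matrix (Fin 2) (Fin 2) ℂ) i j) =
          fun ρ => φ (modelSL2.tuple ρ s) := by
      funext ρ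
      change _ = matOfQuat (modelSL2.Q _) i j
      rw [matOfQuat_modelSL2]
    have h2 := modelSL2.linear_mem_regular (g := g) (n := n) s φ
    rw [← h1] at h2
    exact h2
  · refine Algebra.adjoin_le ?_
    rintro _ ⟨⟨s, l⟩, rfl⟩
    let f : Fin 2 → Fin 2 → HomSpace g n SL2C → ℂ := fun i j ρ =>
      ((show SurfaceGroup g n →* SL2C from ρ) (gen s) : Matrix (Fin 2) (Fin 2) ℂ) i j
    have hent : ∀ i j : Fin 2, f i j ∈ regularSL2 g n :=
      fun i j => Algebra.subset_adjoin ⟨s, i, j, rfl⟩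
    let A := regularSL2 g n
    have e : ∀ l, (fun ρ : HomSpace g n SL2C => toPi (modelSL2.tuple ρ s) l) ∈ A := by
      intro l
      fin_cases l
      · have : (1 / 2 : ℂ) • (f 0 0 + f 1 1) ∈ A := A.smul_mem (A.add_mem (hent 0 0) (hent 1 1)) _
        convert this using 1
        funext ρ
        change (f 0 0 ρ + f 1 1 ρ) / 2 = (1 / 2) * (f 0 0 ρ + f 1 1 ρ)
        ring
      · have : (-Complex.I / 2) • (f 0 0 - f 1 1) ∈ A :=
          A.smul_mem (A.sub_mem (hent 0 0) (hent 1 1)) _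
        convert this using 1
        funext ρ
        change -Complex.I * (f 0 0 ρ - f 1 1 ρ) / 2 = (-Complex.I / 2) * (f 0 0 ρ - f 1 1 ρ)
        ring
      · have : (1 / 2 : ℂ) • (f 0 1 - f 1 0) ∈ A := A.smul_mem (A.sub_mem (hent 0 1) (hent 1 0)) _
        convert this using 1
        funext ρ
        change (f 0 1 ρ - f 1 0 ρ) / 2 = (1 / 2) * (f 0 1 ρ - f 1 0 ρ)
        ring
      · have : (-Complex.I / 2) • (f 0 1 + f 1 0) ∈ A :=
          A.smul_mem (A.add_mem (hent 0 1) (hent 1 0)) _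
        convert this using 1
        funext ρ
        change -Complex.I * (f 0 1 ρ + f 1 0 ρ) / 2 = (-Complex.I / 2) * (f 0 1 ρ + f 1 0 ρ)
        ring
    exact e l

theorem relHomSL2_eq (g : ℕ) {n : ℕ} (θ : Fin n → ℝ) :
    relHomSL2 g θ = modelSL2.rel g fun i => ((cosAngle θ i : ℝ) : ℂ) := by
  ext ρ
  refine forall_congr' fun i => ?_
  set c : ℂ := ((cosAngle θ i : ℝ) : ℂ) with hc
  have hcos : Complex.cos (Real.pi * oddDist (θ i)) = c := by
    rw [hc, cosAngle]; push_cast; rfl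
  set x := modelSL2.tuple ρ (.beta i) with hx
  have hxN : N x = 1 := modelSL2.N_tuple ρ _
  have hmx : matOfQuat x = ((show SurfaceGroup g n →* SL2C from ρ) (gen (.beta i)) :
    Matrix (Fin 2) (Fin 2) ℂ) := matOfQuat_modelSL2 _
  change (∃ B ∈ conjClassSU2 (oddDist (θ i)), ∃ a : SL2C,
    ((show SurfaceGroup g n →* SL2C from ρ) (gen (.beta i)) : Matrix (Fin 2) (Fin 2) ℂ) =
      a * B * ((a⁻¹ : SL2C) : Matrix (Fin 2) (Fin 2) ℂ)) ↔ _
  rw [← hmx]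
  constructor
  · rintro ⟨B, hB, a, h⟩
    rw [mem_conjClassSU2_iff, hcos] at hB
    have haa : (a : Matrix (Fin 2) (Fin 2) ℂ) * ((a⁻¹ : SL2C) : Matrix (Fin 2) (Fin 2) ℂ) = 1 := by
      rw [← Matrix.SpecialLinearGroup.coe_mul, mul_inv_cancel, Matrix.SpecialLinearGroup.coe_one]
    have haa' : ((a⁻¹ : SL2C) : Matrix (Fin 2) (Fin 2) ℂ) * (a : Matrix (Fin 2) (Fin 2) ℂ) = 1 := by
      rw [← Matrix.SpecialLinearGroup.coe_mul, inv_mul_cancel, Matrix.SpecialLinearGroup.coe_one]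
    refine ⟨hxN, ?_, fun hc2 => ?_⟩
    · have h2 : (2 : ℂ) ≠ 0 := two_ne_zero
      apply mul_left_cancel₀ h2
      rw [← trace_matOfQuat, h, Matrix.trace_mul_comm, ← mul_assoc, haa', one_mul, hB]
    -- At half trace `±1` the class in `SU2` is a single central element, so all its conjugates in
    -- `SL2C` equal it.
    · have hB' := matOfQuat_complexify_Q B
      set y := modelSU2.Q B
      have hy : N y = 1 := modelSU2.N_Q B
      have hyc : y.re = cosAngle θ i := by
        rw [← hB', trace_matOfQuat] at hB
        exact Complex.ofReal_injective (mul_left_cancel₀ two_ne_zero hB)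
      have hc2' : cosAngle θ i ^ 2 = 1 := by
        have : ((cosAngle θ i ^ 2 : ℝ) : ℂ) = 1 := by push_cast; exact hc2
        exact Complex.ofReal_eq_one.1 this
      have hyB : y = cosAngle θ i • 1 := eq_smul_one_of_N_eq_one hy hyc hc2'
      have hBc : (B : Matrix (Fin 2) (Fin 2) ℂ) = c • 1 := by
        rw [← hB', hyB, ← map_one matOfQuat, ← map_smul]
        rw [complexify_smul, map_one]
      have hxc : matOfQuat x = c • 1 := by
        rw [h, hBc, mul_smul_comm, mul_one, smul_mul_assoc, haa]
      apply matOfQuat.injective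
      rw [hxc, map_smul, map_one]
  · rintro ⟨-, h1, h2⟩
    replace h1 : x.re = c := h1
    replace h2 : c ^ 2 = 1 → x = c • 1 := h2
    by_cases hc2 : c ^ 2 = 1
    · have hr : cosAngle θ i ^ 2 + 0 ^ 2 = 1 := by
        have : ((cosAngle θ i ^ 2 : ℝ) : ℂ) = 1 := by push_cast; exact hc2
        rw [Complex.ofReal_eq_one] at this
        rw [this]; norm_num
      refine ⟨⟨_, mem_specialUnitaryGroup_matOfQuat hr⟩, ?_, 1, ?_⟩
      · rw [mem_conjClassSU2_iff, trace_matOfQuat, hcos]; rfl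
      · rw [h2 hc2]
        have : c • (1 : Quat ℂ) = mk c ((0 : ℝ) : ℂ) 0 0 := by ext <;> simp
        rw [this]
        simp [← hc]
    · set σ := Real.sin (Real.pi * oddDist (θ i)) with hσ
      have hr : cosAngle θ i ^ 2 + σ ^ 2 = 1 := Real.cos_sq_add_sin_sq _
      have hr' : c ^ 2 + (σ : ℂ) ^ 2 = 1 := by rw [hc]; exact_mod_cast hr
      have hxN' := hxN
      rw [N, h1] at hxN'
      -- Away from the central values the imaginary part of `x` has the same nonzero norm as that of
      -- a diagonal matrix in `SU2`, to which `x` is therefore conjugate.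
      obtain ⟨w, hw, hwx⟩ := Quat.exists_conj_of_N_eq (p := x - c • 1) (q := mk 0 (σ : ℂ) 0 0)
        (by simp [h1]) rfl (by simp [N, h1]; linear_combination hxN' - hr')
        (by
          simp [N, h1]
          intro h0
          exact hc2 (by linear_combination hxN' - h0))
      obtain ⟨r, hr2⟩ := modelSL2.exists_sqrt w hw
      have hr0 : r ≠ 0 := by
        rintro rfl
        exact hw (by rw [← hr2]; simp)
      have hwN : N (r⁻¹ • w) = 1 := by rw [Quat.N_smul, ← hr2]; field_simp
      obtain ⟨a, ha⟩ := (modelSL2.mem_range _).2 hwN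
      refine ⟨⟨_, mem_specialUnitaryGroup_matOfQuat hr⟩, ?_, a, ?_⟩
      · rw [mem_conjClassSU2_iff, trace_matOfQuat, hcos]; rfl
      · rw [← matOfQuat_modelSL2 a, ← matOfQuat_modelSL2 a⁻¹, ← map_mul, ← map_mul,
          modelSL2.Q_inv, ha]
        congr 1
        have h3 : x * (r⁻¹ • w) = r⁻¹ • w * mk c (σ : ℂ) 0 0 := by
          have : mk c (σ : ℂ) 0 0 = c • 1 + mk 0 (σ : ℂ) 0 0 := by ext <;> simp
          rw [this, mul_smul_comm, smul_mul_assoc, mul_add, ← hwx, sub_mul]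
          simp
        rw [← hc, ← h3, mul_assoc, mul_conj_of_N_eq_one hwN, mul_one]

/-- Elements `± exp (t X)` commute. Conversely, a common axis of norm one gives exponentials by the
cosine and the sine, and an isotropic axis gives `± (1 + b z) = ± exp (b z)`; these signs are why
coaxiality is tested in `PSL₂(ℂ)`. -/
theorem isCoaxialSL2_iff {g n : ℕ} (ρ : HomSpace g n SL2C) :
    IsCoaxialSL2 (show SurfaceGroup g n →* SL2C from ρ) ↔ modelSL2.IsAbelian ρ := by
  constructor
  · rintro ⟨X, -, -, h⟩ s s'
    apply matOfQuat.injective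
    have e : ∀ s, matOfQuat (modelSL2.tuple ρ s) =
      ((show SurfaceGroup g n →* SL2C from ρ) (gen s)).1 := fun s => matOfQuat_modelSL2 _
    rw [map_mul, map_mul, e, e]
    have hcomm : ∀ t t' : ℂ, NormedSpace.exp (t • X) * NormedSpace.exp (t' • X) =
        NormedSpace.exp (t' • X) * NormedSpace.exp (t • X) := by
      intro t t'
      have h1 : Commute (t • X) (t' • X) := ((Commute.refl X).smul_left t).smul_right t'
      rw [← Matrix.exp_add_of_commute _ _ h1, ← Matrix.exp_add_of_commute _ _ h1.symm, add_comm]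
    obtain ⟨t, h1 | h1⟩ := h (gen s) <;> obtain ⟨t', h2 | h2⟩ := h (gen s') <;> rw [h1, h2] <;>
      simp [hcomm t t']
  · intro h
    obtain ⟨z, hz, hz0, hN, hγ⟩ := h.exists_axis
    refine ⟨matOfQuat z, by rw [trace_matOfQuat, hz0, mul_zero],
      fun h0 => hz (matOfQuat.injective (by rw [h0, map_zero])), fun γ => ?_⟩
    obtain ⟨a, b, hab, hQ⟩ := hγ γ
    have e : ((show SurfaceGroup g n →* SL2C from ρ) γ).1 = a • 1 + b • matOfQuat z := by
      rw [← matOfQuat_modelSL2, hQ, map_add, map_smul, map_smul, map_one]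
    have hzz : matOfQuat z * matOfQuat z = (-N z) • 1 := by
      rw [← map_mul, Quat.mul_self_of_pure hz0, map_smul, map_one]
    rcases hN with hN | hN
    · rw [hN] at hzz hab
      obtain ⟨t, rfl, rfl⟩ := complexCircleParam.surj a b (by linear_combination hab)
      refine ⟨t, Or.inl ?_⟩
      rw [exp_smul_of_mul_self_eq_neg_one (by rw [hzz, neg_one_smul])]
      exact e
    · rw [hN] at hzz hab
      have ha : a ^ 2 = 1 := by linear_combination hab
      have hexp := exp_smul_of_mul_self_eq_zero (X := matOfQuat z) (by rw [hzz]; simp)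
      rcases sq_eq_one_iff.1 ha with rfl | rfl
      · refine ⟨b, Or.inl ?_⟩
        rw [hexp, ← one_smul ℂ (1 : Matrix (Fin 2) (Fin 2) ℂ)]
        exact e
      · refine ⟨-b, Or.inr ?_⟩
        rw [hexp]
        refine e.trans ?_
        simp [add_comm]

end Coaxial

/-! ### The group `SU₂` -/

section SU2

open Module Quat Topology

theorem exists_oddDist_eq (t : ℝ) : ∃ m : ℤ, oddDist t = |t - (2 * m + 1)| := by
  have hc : IsClosed {x : ℝ | ∃ m : ℤ, x = 2 * m + 1} := by
    have h1 : {x : ℝ | ∃ m : ℤ, x = 2 * m + 1} =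
        (fun x : ℝ => (x - 1) / 2) ⁻¹' Set.range ((↑) : ℤ → ℝ) := by
      ext x
      constructor
      · rintro ⟨m, rfl⟩
        exact ⟨m, by simp⟩
      · rintro ⟨m, hm⟩
        refine ⟨m, ?_⟩
        simp only at hm
        rw [hm]; ring
    rw [h1]
    exact Int.isClosedEmbedding_coe_real.isClosed_range.preimage (by fun_prop)
  obtain ⟨y, ⟨m, rfl⟩, hy⟩ := hc.exists_infDist_eq_dist ⟨1, 0, by simp⟩ t
  exact ⟨m, hy⟩

theorem cos_oddDist (t : ℝ) : Real.cos (Real.pi * oddDist t) = -Real.cos (Real.pi * t) := by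
  obtain ⟨m, hm⟩ := exists_oddDist_eq t
  have h1 : Real.pi * oddDist t = |Real.pi * (t - (2 * m + 1))| := by
    rw [hm, abs_mul, abs_of_pos Real.pi_pos]
  rw [h1, Real.cos_abs, show Real.pi * (t - (2 * m + 1)) = Real.pi * t - Real.pi - m * (2 * Real.pi)
    by ring, Real.cos_sub_int_mul_two_pi, Real.cos_sub_pi]

theorem cosAngle_sq_eq_one_iff {n : ℕ} (θ : Fin n → ℝ) (i : Fin n) :
    cosAngle θ i ^ 2 = 1 ↔ ∃ m : ℤ, θ i = m := by
  rw [cosAngle, cos_oddDist]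
  have h := Real.sin_sq_add_cos_sq (Real.pi * θ i)
  have h1 : (-Real.cos (Real.pi * θ i)) ^ 2 = 1 ↔ Real.sin (Real.pi * θ i) = 0 := by
    rw [← sq_eq_zero_iff]
    constructor <;> intro h2 <;> linarith [neg_sq (Real.cos (Real.pi * θ i))]
  rw [h1, Real.sin_eq_zero_iff]
  refine exists_congr fun m => ⟨fun h => ?_, fun h => by rw [h]; ring⟩
  apply mul_left_cancel₀ Real.pi_ne_zero
  linarith

theorem card_cosAngle {n : ℕ} (θ : Fin n → ℝ) :
    Nat.card {i // cosAngle θ i ^ 2 = 1} = numIntegral θ :=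
  Nat.card_congr (Equiv.subtypeEquivRight (cosAngle_sq_eq_one_iff θ))

theorem card_cosAngle_complex {n : ℕ} (θ : Fin n → ℝ) :
    Nat.card {i // ((cosAngle θ i : ℝ) : ℂ) ^ 2 = 1} = numIntegral θ := by
  rw [← card_cosAngle]
  refine Nat.card_congr (Equiv.subtypeEquivRight fun i => ?_)
  rw [← Complex.ofReal_pow, Complex.ofReal_eq_one]

theorem regularSU2_eq (g n : ℕ) : regularSU2 g n = modelSU2.regular g n := by
  apply le_antisymm
  · refine Algebra.adjoin_le ?_
    rintro _ (⟨s, i, j, rfl⟩ | ⟨s, i, j, rfl⟩)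
    · let φ : Quat ℝ →ₗ[ℝ] ℝ :=
        { toFun := fun x => (matOfQuat (complexify x) i j).re
          map_add' := fun x y => by simp
          map_smul' := fun a x => by rw [complexify_smul, map_smul]; simp }
      have h1 : (fun ρ : HomSpace g n SU2 =>
          ((show SurfaceGroup g n →* SU2 from ρ) (gen s) : Matrix (Fin 2) (Fin 2) ℂ) i j |>.re) =
            fun ρ => φ (modelSU2.tuple ρ s) := by
        funext ρ
        change _ = (matOfQuat (complexify (modelSU2.Q _)) i j).re
        rw [matOfQuat_complexify_Q]
      have h2 := modelSU2.linear_mem_regular (g := g) (n := n) s φ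
      rw [← h1] at h2
      exact h2
    · let φ : Quat ℝ →ₗ[ℝ] ℝ :=
        { toFun := fun x => (matOfQuat (complexify x) i j).im
          map_add' := fun x y => by simp
          map_smul' := fun a x => by rw [complexify_smul, map_smul]; simp }
      have h1 : (fun ρ : HomSpace g n SU2 =>
          ((show SurfaceGroup g n →* SU2 from ρ) (gen s) : Matrix (Fin 2) (Fin 2) ℂ) i j |>.im) =
            fun ρ => φ (modelSU2.tuple ρ s) := by
        funext ρ
        change _ = (matOfQuat (complexify (modelSU2.Q _)) i j).im
        rw [matOfQuat_complexify_Q]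
      have h2 := modelSU2.linear_mem_regular (g := g) (n := n) s φ
      rw [← h1] at h2
      exact h2
  · refine Algebra.adjoin_le ?_
    rintro _ ⟨⟨s, l⟩, rfl⟩
    have e : ∀ l, (fun ρ : HomSpace g n SU2 => toPi (modelSU2.tuple ρ s) l) ∈ regularSU2 g n := by
      intro l
      fin_cases l
      · exact Algebra.subset_adjoin (Or.inl ⟨s, 0, 0, rfl⟩)
      · exact Algebra.subset_adjoin (Or.inr ⟨s, 0, 0, rfl⟩)
      · exact Algebra.subset_adjoin (Or.inl ⟨s, 0, 1, rfl⟩)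
      · exact Algebra.subset_adjoin (Or.inr ⟨s, 0, 1, rfl⟩)
    exact e l

theorem mem_conjClassSU2_iff_re {δ : ℝ} {B : SU2} :
    B ∈ conjClassSU2 δ ↔ (modelSU2.Q B).re = Real.cos (Real.pi * δ) := by
  rw [mem_conjClassSU2_iff, ← matOfQuat_complexify_Q B, trace_matOfQuat]
  rw [mul_right_inj' (two_ne_zero' ℂ), ← Complex.ofReal_mul, ← Complex.ofReal_cos]
  exact Complex.ofReal_inj

theorem relHomSU2_eq (g : ℕ) {n : ℕ} (θ : Fin n → ℝ) :
    relHomSU2 g θ = modelSU2.rel g (cosAngle θ) := by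
  ext ρ
  refine forall_congr' fun i => ?_
  constructor
  · intro h
    have h1 := mem_conjClassSU2_iff_re.1 (h _ (IsConj.refl _))
    exact ⟨modelSU2.N_tuple ρ _, h1, eq_smul_one_of_N_eq_one (modelSU2.N_tuple ρ _) h1⟩
  · rintro ⟨-, h1, -⟩ γ hγ
    rw [mem_conjClassSU2_iff_re]
    obtain ⟨x, rfl⟩ := isConj_iff.1 hγ
    change (modelSU2.Q ((show SurfaceGroup g n →* SU2 from ρ) _)).re = _
    rw [map_mul, map_mul, map_inv, map_mul, map_mul, modelSU2.Q_inv, mul_assoc, re_mul_comm,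
      mul_assoc, conj_mul_of_N_eq_one (modelSU2.N_Q _), mul_one]
    exact h1

theorem isCoaxialSU2_iff {g n : ℕ} (ρ : HomSpace g n SU2) :
    IsCoaxialSU2 (show SurfaceGroup g n →* SU2 from ρ) ↔ modelSU2.IsAbelian ρ := by
  constructor
  · rintro ⟨X, -, -, -, h⟩ s s'
    apply complexify_injective
    apply matOfQuat.injective
    have e : ∀ s, matOfQuat (complexify (modelSU2.tuple ρ s)) =
      ((show SurfaceGroup g n →* SU2 from ρ) (gen s)).1 := fun s => matOfQuat_complexify_Q _
    rw [map_mul, map_mul, map_mul, map_mul, e, e]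
    obtain ⟨t, h1⟩ := h (gen s)
    obtain ⟨t', h2⟩ := h (gen s')
    have h3 : Commute (t • X) (t' • X) := ((Commute.refl X).smul_left t).smul_right t'
    rw [h1, h2, ← Matrix.exp_add_of_commute _ _ h3, ← Matrix.exp_add_of_commute _ _ h3.symm, add_comm]
  · intro h
    obtain ⟨z, hz, hz0, hN, hγ⟩ := h.exists_axis
    have hN1 : N z = 1 := hN.resolve_right (N_pos_of_ne_zero hz).ne'
    refine ⟨matOfQuat (complexify z), ?_, by rw [trace_matOfQuat, complexify_apply]; simp [hz0],
      fun h0 => hz (complexify_injective (matOfQuat.injective (by rw [h0, map_zero, map_zero]))),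
      fun γ => ?_⟩
    · ext i j
      fin_cases i <;> fin_cases j <;> simp [matOfQuat_apply, complexify_apply, hz0, add_comm]
    · obtain ⟨a, b, hab, hQ⟩ := hγ γ
      rw [hN1] at hab
      obtain ⟨t, rfl, rfl⟩ := realCircleParam.surj a b (by linear_combination hab)
      refine ⟨t, ?_⟩
      have hzz : matOfQuat (complexify z) * matOfQuat (complexify z) = -1 := by
        rw [← map_mul, ← map_mul, Quat.mul_self_of_pure hz0, hN1, neg_one_smul, map_neg, map_neg,
          map_one, map_one]
      rw [← matOfQuat_complexify_Q, hQ, map_add, complexify_smul, complexify_smul, map_add, map_smul,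
        map_smul, map_one, map_one, show t • matOfQuat (complexify z) =
          (t : ℂ) • matOfQuat (complexify z) from (Complex.coe_smul t _).symm,
        exp_smul_of_mul_self_eq_neg_one hzz, ← Complex.ofReal_cos, ← Complex.ofReal_sin]
      rfl

theorem coaxHomSU2_eq (g : ℕ) {n : ℕ} (θ : Fin n → ℝ) :
    coaxHomSU2 g θ = {ρ | ρ ∈ modelSU2.rel g (cosAngle θ) ∧ modelSU2.IsAbelian ρ} := by
  rw [← relHomSU2_eq]
  ext ρ
  exact and_congr_right fun _ => isCoaxialSU2_iff ρ

theorem noncoaxHomSU2_eq (g : ℕ) {n : ℕ} (θ : Fin n → ℝ) :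
    noncoaxHomSU2 g θ = modelSU2.nonabelian g (cosAngle θ) := by
  rw [QuatModel.nonabelian, ← relHomSU2_eq]
  ext ρ
  exact and_congr_right fun _ => not_congr (isCoaxialSU2_iff ρ)

theorem isOrientedManifold_noncoaxHomSU2 (g : ℕ) {n : ℕ} (θ : Fin n → ℝ) :
    IsOrientedManifold (restrict (regularSU2 g n) (noncoaxHomSU2 g θ))
      (6 * (g : ℤ) - 3 + 2 * ((n : ℤ) - numIntegral θ)) := by
  rw [noncoaxHomSU2_eq, regularSU2_eq, ← card_cosAngle]
  exact isOrientedManifold_nonabelian_real _ _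

theorem isOrientedManifold_noncoaxHomSL2 (g : ℕ) {n : ℕ} (θ : Fin n → ℝ) :
    IsOrientedManifold (restrict (regularSL2 g n) (noncoaxHomSL2 g θ))
      (6 * (g : ℤ) - 3 + 2 * ((n : ℤ) - numIntegral θ)) := by
  have h : noncoaxHomSL2 g θ = modelSL2.nonabelian g fun i => ((cosAngle θ i : ℝ) : ℂ) := by
    rw [QuatModel.nonabelian, ← relHomSL2_eq]
    ext ρ
    exact and_congr_right fun _ => not_congr (isCoaxialSL2_iff ρ)
  rw [h, regularSL2_eq, ← card_cosAngle_complex]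
  exact isOrientedManifold_nonabelian_complex _ _

/-- Two quaternions with anisotropic commutator generate. -/
theorem isIrred_of_N_commutator {K : Type*} [RCLike K] {S : Type*} [Fintype S] {v : S → Quat K}
    {s s' : S} (h : N (v s * v s' - v s' * v s) ≠ 0) : IsIrred v := by
  intro w
  set x := v s with hx
  set y := v s' with hy
  have hxe : evalTuple v (FreeAlgebra.ι K s) = x := evalTuple_ι v s
  have hye : evalTuple v (FreeAlgebra.ι K s') = y := evalTuple_ι v s'
  have key : ∃ a b c d : K, w = a • 1 + b • x + c • y + d • (x * y - y * x) := by
    -- The vector `(p, q, r)` is the cross product of the imaginary parts, half the commutator. As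
    -- its norm is nonzero, `1`, `x`, `y` and the commutator form a basis, and `b`, `c`, `d` below
    -- are given by Cramer's rule.
    set p := x.imJ * y.imK - x.imK * y.imJ with hp
    set q := x.imK * y.imI - x.imI * y.imK with hq
    set r := x.imI * y.imJ - x.imJ * y.imI with hr
    have hn : p ^ 2 + q ^ 2 + r ^ 2 ≠ 0 := by
      intro h0
      refine h ?_
      simp [N]
      linear_combination 4 * h0
    set b := (w.imI * (y.imJ * r - y.imK * q) + w.imJ * (y.imK * p - y.imI * r) +
      w.imK * (y.imI * q - y.imJ * p)) / (p ^ 2 + q ^ 2 + r ^ 2) with hb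
    set c := (w.imI * (q * x.imK - r * x.imJ) + w.imJ * (r * x.imI - p * x.imK) +
      w.imK * (p * x.imJ - q * x.imI)) / (p ^ 2 + q ^ 2 + r ^ 2) with hc
    set d := (w.imI * p + w.imJ * q + w.imK * r) / (p ^ 2 + q ^ 2 + r ^ 2) with hd
    refine ⟨w.re - b * x.re - c * y.re, b, c, d / 2, ?_⟩
    have e1 : ∀ X Y Z : K, X * Y - Y * X + Z = Z := fun X Y Z => by ring
    ext
    · simp; ring
    · simp
      rw [hb, hc, hd]
      field_simp
      rw [hp, hq, hr]
      ring
    · simp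
      rw [hb, hc, hd]
      field_simp
      rw [hp, hq, hr]
      ring
    · simp
      rw [hb, hc, hd]
      field_simp
      rw [hp, hq, hr]
      ring
  obtain ⟨a, b, c, d, rfl⟩ := key
  exact ⟨a • 1 + b • FreeAlgebra.ι K s + c • FreeAlgebra.ι K s' +
    d • (FreeAlgebra.ι K s * FreeAlgebra.ι K s' - FreeAlgebra.ι K s' * FreeAlgebra.ι K s), by
      simp only [map_add, map_smul, map_one, map_sub, map_mul, hxe, hye]⟩

/-- Over `ℝ` a nonzero commutator automatically has nonzero norm. -/
theorem nonabelian_eq_irreducible {G : Type*} [Group G] [TopologicalSpace G] (M : QuatModel ℝ G)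
    (g : ℕ) {n : ℕ} (c : Fin n → ℝ) : M.nonabelian g c = M.irreducible g c := by
  ext ρ
  refine and_congr_right fun _ => ?_
  constructor
  · intro h
    rw [QuatModel.IsAbelian] at h
    push Not at h
    obtain ⟨s, s', hs⟩ := h
    exact isIrred_of_N_commutator (N_pos_of_ne_zero (sub_ne_zero.2 hs)).ne'
  · intro h h'
    obtain ⟨s, s', hs⟩ := h.exists_not_comm
    exact hs (h' s s')

/-! ### The orbit space -/

section Orbit

variable {K : Type*} [RCLike K] {G : Type*} [Group G] [TopologicalSpace G] {g n : ℕ}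

theorem toOrbit_eq_iff {ρ σ : HomSpace g n G} :
    toOrbit σ = toOrbit ρ ↔ ∃ a, σ = QuatModel.conjHom a ρ := by
  constructor
  · intro h
    obtain ⟨a, ha⟩ := Quotient.exact h.symm
    exact ⟨a, MonoidHom.ext ha⟩
  · rintro ⟨a, rfl⟩
    exact QuatModel.toOrbit_conjHom a ρ

theorem continuous_toOrbit : Continuous (toOrbit : HomSpace g n G → OrbitSpace g n G) :=
  continuous_quotient_mk'

theorem surjective_toOrbit : Function.Surjective (toOrbit : HomSpace g n G → OrbitSpace g n G) :=
  Quotient.mk_surjective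

namespace QuatModel

variable (M : QuatModel K G)

theorem continuous_tuple : Continuous (M.tuple : HomSpace g n G → _) := M.isEmbedding_tuple.continuous

theorem continuous_conjHom (M : QuatModel K G) (a : G) :
    Continuous (conjHom a : HomSpace g n G → HomSpace g n G) := by
  rw [M.isEmbedding_tuple.isInducing.continuous_iff]
  refine continuous_pi fun s => ?_
  simp only [Function.comp_apply, M.tuple_conjHom]
  have := continuous_pi_iff.1 (M.continuous_tuple (g := g) (n := n)) s
  fun_prop

theorem isOpenMap_toOrbit (M : QuatModel K G) :
    IsOpenMap (toOrbit : HomSpace g n G → OrbitSpace g n G) := by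
  intro U hU
  have h : (toOrbit : HomSpace g n G → OrbitSpace g n G) ⁻¹' (toOrbit '' U) =
      ⋃ a : G, conjHom a ⁻¹' U := by
    ext ρ
    constructor
    · rintro ⟨σ, hσ, h⟩
      obtain ⟨a, rfl⟩ := toOrbit_eq_iff.1 h
      exact Set.mem_iUnion.2 ⟨a, hσ⟩
    · intro h
      obtain ⟨a, ha⟩ := Set.mem_iUnion.1 h
      exact ⟨_, ha, toOrbit_conjHom a ρ⟩
  have h2 : IsOpen ((toOrbit : HomSpace g n G → OrbitSpace g n G) ⁻¹' (toOrbit '' U)) := by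
    rw [h]
    exact isOpen_iUnion fun a => hU.preimage (M.continuous_conjHom a)
  exact h2

theorem isOpenQuotientMap_toOrbit (M : QuatModel K G) :
    IsOpenQuotientMap (toOrbit : HomSpace g n G → OrbitSpace g n G) :=
  ⟨surjective_toOrbit, continuous_toOrbit, M.isOpenMap_toOrbit⟩

/-- The orbit relation is the projection of a closed set along the compact group, hence closed, and
the quotient map is open. -/
theorem t2Space_orbitSpace [CompactSpace G] (M : QuatModel K G) : T2Space (OrbitSpace g n G) := by
  have := M.t2Space_homSpace (g := g) (n := n)
  rw [t2Space_iff_of_isOpenQuotientMap M.isOpenQuotientMap_toOrbit]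
  have hcl : IsClosed {x : G × (HomSpace g n G × HomSpace g n G) |
      M.tuple x.2.2 = fun s => M.Q x.1 * M.tuple x.2.1 s * conj (M.Q x.1)} := by
    have h1 := M.continuous_tuple (g := g) (n := n)
    have h2 := M.isEmbedding.continuous
    have h3 : ∀ s, Continuous fun ρ : HomSpace g n G => M.tuple ρ s := fun s =>
      continuous_pi_iff.1 h1 s
    refine isClosed_eq (by fun_prop) (continuous_pi fun s => ?_)
    have h4 := h3 s
    fun_prop
  have himage := isClosedMap_snd_of_compactSpace _ hcl
  convert himage using 1
  ext ⟨ρ, σ⟩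
  constructor
  · intro h
    obtain ⟨a, rfl⟩ := toOrbit_eq_iff.1 (show toOrbit σ = toOrbit ρ from Eq.symm h)
    exact ⟨(a, ρ, conjHom a ρ), funext fun s => M.tuple_conjHom a ρ s, rfl⟩
  · rintro ⟨⟨a, ρ', σ'⟩, h, h'⟩
    obtain ⟨rfl, rfl⟩ := Prod.mk.inj h'
    refine (toOrbit_eq_iff.2 ⟨a, M.isEmbedding_tuple.injective ?_⟩).symm
    rw [h]
    exact (funext fun s => M.tuple_conjHom a _ s).symm

/-- The image of the irreducible locus in the orbit space. -/
theorem isGoodQuotient_toOrbit (c : Fin n → K) :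
    M.IsGoodQuotient (toOrbit : HomSpace g n G → _) c (toOrbit '' M.irreducible g c) where
  continuous := continuous_toOrbit
  invariant := toOrbit_conjHom
  trace x := ⟨Quotient.lift (fun ρ => (evalTuple (M.tuple ρ) x).re) (by
    rintro ρ σ ⟨a, ha⟩
    have : σ = conjHom a ρ := MonoidHom.ext ha
    change (evalTuple (M.tuple ρ) x).re = (evalTuple (M.tuple σ) x).re
    rw [this, M.re_evalTuple_conjHom]), fun ρ => rfl⟩
  image := rfl
  open_image U hU := by
    refine ⟨toOrbit '' U, M.isOpenMap_toOrbit U hU, ?_⟩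
    ext y
    constructor
    · rintro ⟨⟨ρ, h1, rfl⟩, ⟨σ, h2, h⟩⟩
      obtain ⟨a, rfl⟩ := toOrbit_eq_iff.1 h
      exact ⟨_, ⟨⟨M.conjHom_mem_rel a h1.1, M.isIrred_conjHom a h1.2⟩, h2⟩, h⟩
    · rintro ⟨ρ, ⟨h1, h2⟩, rfl⟩
      exact ⟨⟨ρ, h1, rfl⟩, ⟨ρ, h2, rfl⟩⟩

end QuatModel

end Orbit

theorem compactSpace_SU2 : CompactSpace SU2 := by
  have := FiniteDimensional.proper ℝ (Quat ℝ)
  rw [← isCompact_univ_iff, modelSU2.isEmbedding.isCompact_iff, Set.image_univ]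
  have hrange : Set.range modelSU2.Q = {x | N x = 1} := by
    ext x
    exact modelSU2.mem_range x
  rw [hrange]
  refine Metric.isCompact_of_isClosed_isBounded (isClosed_eq continuous_N continuous_const) ?_
  refine isBounded_iff_forall_norm_le.2 ⟨4, fun x hx => ?_⟩
  have hx' : x.re ^ 2 + x.imI ^ 2 + x.imJ ^ 2 + x.imK ^ 2 = 1 := hx
  have h0 : |x.re| ≤ 1 := abs_le_of_sq_le_sq (by nlinarith [sq_nonneg x.imI, sq_nonneg x.imJ, sq_nonneg x.imK]) zero_le_one
  have h1 : |x.imI| ≤ 1 := abs_le_of_sq_le_sq (by nlinarith [sq_nonneg x.re, sq_nonneg x.imJ, sq_nonneg x.imK]) zero_le_one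
  have h2 : |x.imJ| ≤ 1 := abs_le_of_sq_le_sq (by nlinarith [sq_nonneg x.re, sq_nonneg x.imI, sq_nonneg x.imK]) zero_le_one
  have h3 : |x.imK| ≤ 1 := abs_le_of_sq_le_sq (by nlinarith [sq_nonneg x.re, sq_nonneg x.imI, sq_nonneg x.imJ]) zero_le_one
  rw [Quat.norm_def]
  simp only [Real.norm_eq_abs]
  linarith

theorem noncoaxRepSU2_eq (g : ℕ) {n : ℕ} (θ : Fin n → ℝ) :
    noncoaxRepSU2 g θ = projSU2 '' modelSU2.irreducible g (cosAngle θ) := by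
  rw [noncoaxRepSU2, relRepSU2, coaxRepSU2, coaxHomSU2_eq, relHomSU2_eq,
    ← nonabelian_eq_irreducible]
  ext y
  constructor
  · rintro ⟨⟨ρ, h1, rfl⟩, h2⟩
    exact ⟨ρ, ⟨h1, fun h => h2 ⟨ρ, ⟨h1, h⟩, rfl⟩⟩, rfl⟩
  · rintro ⟨ρ, ⟨h1, h2⟩, rfl⟩
    refine ⟨⟨ρ, h1, rfl⟩, ?_⟩
    rintro ⟨σ, ⟨-, h3⟩, h4⟩
    obtain ⟨a, rfl⟩ := toOrbit_eq_iff.1 h4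
    refine h2 fun s s' => ?_
    have h5 := h3 s s'
    rw [modelSU2.tuple_conjHom, modelSU2.tuple_conjHom] at h5
    set u := modelSU2.Q a
    have hu := conj_mul_of_N_eq_one (modelSU2.N_Q a)
    have e : ∀ x y : Quat ℝ, x * y = conj u * (u * x * conj u * (u * y * conj u)) * u := by
      intro x y
      calc x * y = (conj u * u) * x * (conj u * u) * y * (conj u * u) := by rw [hu]; noncomm_ring
        _ = _ := by noncomm_ring
    rw [e, h5, ← e]

theorem isOrientedManifold_noncoaxRepSU2 (g : ℕ) {n : ℕ} (θ : Fin n → ℝ) :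
    IsOrientedManifold (restrict (pushforward (regularSU2 g n) projSU2) (noncoaxRepSU2 g θ))
      (6 * (g : ℤ) - 6 + 2 * ((n : ℤ) - numIntegral θ)) := by
  rw [noncoaxRepSU2_eq, regularSU2_eq, ← card_cosAngle]
  have := compactSpace_SU2
  have := modelSU2.t2Space_orbitSpace (g := g) (n := n)
  exact isOrientedManifold_rep_real (modelSU2.isGoodQuotient_toOrbit _)
    fun ρ _ σ h => toOrbit_eq_iff.1 h

end SU2

/-! ### Tuples with the same traces -/

section Trace

open Module Quat

/-- If `x` vanishes at `w`, then the half traces of all `x y` vanish at `w`, hence at `v`; as the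
values at `v` exhaust the algebra, non-degeneracy of the trace form applies. -/
theorem eval_eq_zero_of_re_eq {K : Type*} [RCLike K] {S : Type*} [Fintype S] {v w : S → Quat K}
    (hv : IsIrred v) (h : ∀ x, (evalTuple v x).re = (evalTuple w x).re) {x : FreeAlgebra K S}
    (hx : evalTuple w x = 0) : evalTuple v x = 0 := by
  refine eq_zero_of_re_mul fun y => ?_
  obtain ⟨y, rfl⟩ := hv y
  rw [← map_mul, h, map_mul, hx, zero_mul, re_zero]

theorem IsIrred.of_re_eq {K : Type*} [RCLike K] {S : Type*} [Fintype S] {v w : S → Quat K}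
    (hv : IsIrred v) (h : ∀ x, (evalTuple v x).re = (evalTuple w x).re) : IsIrred w := by
  obtain ⟨σ, hσ⟩ := (evalTuple v).toLinearMap.exists_rightInverse_of_surjective
    (LinearMap.range_eq_top.2 hv)
  have hσ' : ∀ y, evalTuple v (σ y) = y := fun y => DFunLike.congr_fun hσ y
  have hinj : Function.Injective ((evalTuple w).toLinearMap.comp σ) := by
    rw [injective_iff_map_eq_zero]
    intro y hy
    rw [← hσ' y]
    exact eval_eq_zero_of_re_eq hv h hy
  intro y
  obtain ⟨x, hx⟩ := LinearMap.injective_iff_surjective.1 hinj y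
  exact ⟨σ x, hx⟩

/-- Automorphisms of the complex quaternions are inner. -/
theorem Quat.exists_inner (φ : Quat ℂ ≃ₐ[ℂ] Quat ℂ) :
    ∃ h : Quat ℂ, N h ≠ 0 ∧ ∀ x, φ x * h = h * x := by
  let e : Quat ℂ ≃ₐ[ℂ] End ℂ (Fin 2 → ℂ) := matOfQuat.trans Matrix.toLinAlgEquiv'
  obtain ⟨T, hT⟩ := AlgEquiv.eq_linearEquivConjAlgEquiv ((e.symm.trans φ).trans e)
  have hTe : e (e.symm T.toLinearMap) = T.toLinearMap := e.apply_symm_apply _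
  refine ⟨e.symm T.toLinearMap, ?_, fun x => e.injective ?_⟩
  · have h1 : e.symm T.toLinearMap * e.symm T.symm.toLinearMap = 1 := by
      rw [← map_mul]
      have : (T.toLinearMap * T.symm.toLinearMap : End ℂ (Fin 2 → ℂ)) = 1 := by
        exact LinearMap.ext fun v => T.apply_symm_apply v
      rw [this, map_one]
    have h2 := congrArg N h1
    rw [N_mul] at h2
    intro h0
    rw [h0, zero_mul] at h2
    simp [N] at h2
  · rw [map_mul, map_mul, hTe]
    have h3 := DFunLike.congr_fun hT (e x)
    simp only [AlgEquiv.trans_apply, AlgEquiv.symm_apply_apply] at h3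
    rw [h3, LinearEquiv.conjAlgEquiv_apply]
    refine LinearMap.ext fun v => ?_
    change T (e x (T.symm (T v))) = T (e x v)
    rw [T.symm_apply_apply]

/-- Complex tuples with the same traces, one of which is irreducible, are conjugate. -/
theorem IsIrred.exists_conj {S : Type*} [Fintype S] {v w : S → Quat ℂ} (hv : IsIrred v)
    (h : ∀ x, (evalTuple v x).re = (evalTuple w x).re) :
    ∃ u : Quat ℂ, N u ≠ 0 ∧ ∀ s, w s * u = u * v s := by
  have hw := hv.of_re_eq h
  obtain ⟨σ, hσ⟩ := (evalTuple v).toLinearMap.exists_rightInverse_of_surjective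
    (LinearMap.range_eq_top.2 hv)
  have hσ' : ∀ y, evalTuple v (σ y) = y := fun y => DFunLike.congr_fun hσ y
  -- The value at `w` depends only on the value at `v`. This yields an automorphism carrying `v` to
  -- `w`, which is inner.
  have hψ : ∀ x, evalTuple w (σ (evalTuple v x)) = evalTuple w x := by
    intro x
    rw [← sub_eq_zero, ← map_sub]
    refine eval_eq_zero_of_re_eq hw (fun x => (h x).symm) ?_
    rw [map_sub, hσ', sub_self]
  let φ : Quat ℂ →ₐ[ℂ] Quat ℂ := AlgHom.ofLinearMap ((evalTuple w).toLinearMap.comp σ)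
    (by
      have := hψ 1
      rw [map_one (evalTuple v), map_one (evalTuple w)] at this
      exact this)
    (by
      intro x y
      obtain ⟨x, rfl⟩ := hv x
      obtain ⟨y, rfl⟩ := hv y
      change evalTuple w (σ _) = evalTuple w (σ _) * evalTuple w (σ _)
      rw [← map_mul, hψ, hψ, hψ, map_mul])
  have hinj : Function.Injective φ := by
    rw [injective_iff_map_eq_zero]
    intro y hy
    rw [← hσ' y]
    exact eval_eq_zero_of_re_eq hv h hy
  obtain ⟨u, hu, hφ⟩ := Quat.exists_inner
    (AlgEquiv.ofBijective φ ⟨hinj, LinearMap.injective_iff_surjective (f := φ.toLinearMap).1 hinj⟩)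
  refine ⟨u, hu, fun s => ?_⟩
  have h1 := hφ (v s)
  have h2 : φ (v s) = w s := by
    have := hψ (FreeAlgebra.ι ℂ s)
    rw [evalTuple_ι, evalTuple_ι] at this
    exact this
  rw [← h2]
  exact h1

theorem QuatModel.exists_conjHom_of_re_eq {G : Type*} [Group G] [TopologicalSpace G] {g n : ℕ}
    (M : QuatModel ℂ G) {ρ σ : HomSpace g n G} (hρ : IsIrred (M.tuple ρ))
    (h : ∀ x, (evalTuple (M.tuple ρ) x).re = (evalTuple (M.tuple σ) x).re) :
    ∃ a, σ = QuatModel.conjHom a ρ := by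
  obtain ⟨u, hu, hs⟩ := hρ.exists_conj h
  obtain ⟨a, ha⟩ := M.exists_conjHom_of_N_ne_zero ρ hu
  refine ⟨a, M.isEmbedding_tuple.injective (funext fun s => ?_)⟩
  rw [ha, ← hs, mul_assoc, mul_conj, mul_smul_comm, mul_one, smul_smul, inv_mul_cancel₀ hu,
    one_smul]

end Trace

/-! ### Degeneration of reducible homomorphisms -/

section Degeneration

open Module Quat Topology Filter

theorem Quat.mul_mul_self_of_pure {K : Type*} [RCLike K] {z : Quat K} (hz : z.re = 0) (x : Quat K) :
    z * x * z = (2 * (z * x).re) • z - N z • conj x := by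
  ext <;> simp [N, hz, conj] <;> ring

/-- A proper subalgebra of the complex quaternions preserves an isotropic line. -/
theorem exists_isotropic (A : Subalgebra ℂ (Quat ℂ)) (hA : A ≠ ⊤) :
    ∃ z : Quat ℂ, z ≠ 0 ∧ z.re = 0 ∧ N z = 0 ∧ ∀ b ∈ A, z * b * z = 0 := by
  -- For an isotropic pure `z` the product `z b z` equals `2 re(z b) z`, so it is enough to be
  -- orthogonal to `A`.
  suffices h : ∃ z : Quat ℂ, z ≠ 0 ∧ z.re = 0 ∧ N z = 0 ∧ ∀ b ∈ A, (z * b).re = 0 by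
    obtain ⟨z, h1, h2, h3, h4⟩ := h
    refine ⟨z, h1, h2, h3, fun b hb => ?_⟩
    rw [Quat.mul_mul_self_of_pure h2, h4 b hb, h3]
    simp
  have hlt : Subalgebra.toSubmodule A < ⊤ := by
    rw [lt_top_iff_ne_top]
    intro h
    exact hA (Algebra.toSubmodule_eq_top.1 h)
  obtain ⟨f, hf, hfA⟩ := Submodule.exists_le_ker_of_lt_top _ hlt
  -- The quaternion representing `f` through the trace form; it is pure because `f` kills `1`.
  set z : Quat ℂ := mk (f 1) (-f (mk 0 1 0 0)) (-f (mk 0 0 1 0)) (-f (mk 0 0 0 1)) with hz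
  have hfz : ∀ x, f x = (z * x).re := by
    intro x
    have : x = x.re • 1 + x.imI • mk 0 1 0 0 + x.imJ • mk 0 0 1 0 + x.imK • mk 0 0 0 1 := by
      ext <;> simp
    conv_lhs => rw [this]
    simp [hz]
    ring
  have hzA : ∀ b ∈ A, (z * b).re = 0 := fun b hb => by rw [← hfz]; exact hfA hb
  have hz0 : z ≠ 0 := by
    rintro h0
    exact hf (LinearMap.ext fun x => by rw [hfz, h0]; simp)
  have hzre : z.re = 0 := by simpa using hzA 1 A.one_mem
  by_cases hN : N z = 0
  · exact ⟨z, hz0, hzre, hN, hzA⟩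
  by_cases hs : ∀ b ∈ A, b = b.re • 1
  · refine ⟨mk 0 1 Complex.I 0, fun h0 => one_ne_zero (congrArg Quat.imI h0), rfl, by simp [N],
      fun b hb => ?_⟩
    rw [hs b hb]
    simp
  · push Not at hs
    obtain ⟨b, hb, hb1⟩ := hs
    -- The number `b.re + r` is an eigenvalue of the non-scalar `b`, so `w` is a nonzero singular
    -- element of `A`. Then `z w` is isotropic and still orthogonal to `A`.
    obtain ⟨r, hr⟩ : ∃ r : ℂ, r ^ 2 = b.re ^ 2 - N b := IsAlgClosed.exists_pow_nat_eq _ two_pos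
    set w := b - (b.re + r) • (1 : Quat ℂ) with hw
    have hwA : w ∈ A := A.sub_mem hb (A.smul_mem A.one_mem _)
    have hNw : N w = 0 := by
      simp [N, hw] at hr ⊢
      linear_combination hr
    have hw0 : w ≠ 0 := by
      intro h0
      have h1 : b = (b.re + r) • 1 := sub_eq_zero.1 h0
      have h2 : b.re = b.re + r := by conv_lhs => rw [h1]
                                      simp
      refine hb1 ?_
      rw [← h2] at h1
      exact h1
    refine ⟨z * w, fun h0 => hw0 ?_, hzA w hwA, by rw [N_mul, hNw, mul_zero], fun b' hb' => ?_⟩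
    · have h1 : conj z * (z * w) = N z • w := by
        rw [← mul_assoc, conj_mul_self, smul_mul_assoc, one_mul]
      rw [h0, mul_zero] at h1
      exact (smul_eq_zero.1 h1.symm).resolve_left hN
    · rw [mul_assoc]
      exact hzA _ (A.mul_mem hwA hb')

/-- A pair of complementary idempotents interchanged by conjugation, such that the subalgebra is
triangular with respect to them. -/
theorem exists_idempotents (A : Subalgebra ℂ (Quat ℂ)) (hA : A ≠ ⊤) :
    ∃ p q : Quat ℂ, p * p = p ∧ q * q = q ∧ p * q = 0 ∧ q * p = 0 ∧ p + q = 1 ∧ conj p = q ∧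
      ∀ b ∈ A, q * b * p = 0 := by
  obtain ⟨z, hz, hz0, hN, hb⟩ := exists_isotropic A hA
  -- The complex conjugate of `z` is isotropic too and pairs with `z` to a nonzero number, minus
  -- twice its squared length. The normalised products `z z'` and `z' z` are the two idempotents.
  let z' : Quat ℂ := mk 0 (star z.imI) (star z.imJ) (star z.imK)
  have hz'0 : z'.re = 0 := rfl
  have hN' : N z' = 0 := by
    have := congrArg star hN
    simp only [N, hz0, star_add, star_pow, star_zero] at this
    simpa [N, z'] using this
  set κ : ℂ := 2 * (z * z').re with hκ
  have hκ' : κ = -2 * ((‖z.imI‖ ^ 2 + ‖z.imJ‖ ^ 2 + ‖z.imK‖ ^ 2 : ℝ) : ℂ) := by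
    have e : ∀ x : ℂ, x * star x = ((‖x‖ ^ 2 : ℝ) : ℂ) := fun x => by
      rw [Complex.star_def, Complex.mul_conj, Complex.normSq_eq_norm_sq]
    push_cast [← e]
    simp only [hκ, re_mul, hz0, z', re_mk, imI_mk, imJ_mk, imK_mk, e]
    push_cast
    ring
  have hκ0 : κ ≠ 0 := by
    intro h0
    have h1 : ‖z.imI‖ ^ 2 + ‖z.imJ‖ ^ 2 + ‖z.imK‖ ^ 2 = 0 := by
      rw [hκ'] at h0
      exact_mod_cast (mul_eq_zero.1 h0).resolve_left (by norm_num)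
    refine hz ?_
    ext
    · exact hz0
    all_goals
      refine norm_eq_zero.1 ?_
      nlinarith [sq_nonneg ‖z.imI‖, sq_nonneg ‖z.imJ‖, sq_nonneg ‖z.imK‖]
  have hzz : z * z = 0 := by rw [Quat.mul_self_of_pure hz0, hN]; simp
  have hzz' : z' * z' = 0 := by rw [Quat.mul_self_of_pure hz'0, hN']; simp
  have h1 : z * z' * z = κ • z := by rw [Quat.mul_mul_self_of_pure hz0, hN, zero_smul, sub_zero]
  have h2 : z' * z * z' = κ • z' := by
    rw [Quat.mul_mul_self_of_pure hz'0, hN', zero_smul, sub_zero, re_mul_comm]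
  have h3 : z * z' + z' * z = κ • 1 := by
    ext <;> simp [hκ, hz0, hz'0] <;> ring
  have hcz : conj z = -z := by ext <;> simp [conj, hz0]
  have hcz' : conj z' = -z' := by ext <;> simp [conj, hz'0]
  refine ⟨κ⁻¹ • (z * z'), κ⁻¹ • (z' * z), ?_, ?_, ?_, ?_, ?_, ?_, fun b hbA => ?_⟩
  · rw [smul_mul_smul_comm, ← mul_assoc, h1, smul_mul_assoc, smul_smul, mul_assoc,
      inv_mul_cancel₀ hκ0, mul_one]
  · rw [smul_mul_smul_comm, ← mul_assoc, h2, smul_mul_assoc, smul_smul, mul_assoc,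
      inv_mul_cancel₀ hκ0, mul_one]
  · rw [smul_mul_smul_comm, mul_assoc, ← mul_assoc z', hzz', zero_mul, mul_zero, smul_zero]
  · rw [smul_mul_smul_comm, mul_assoc, ← mul_assoc z, hzz, zero_mul, mul_zero, smul_zero]
  · rw [← smul_add, h3, smul_smul, inv_mul_cancel₀ hκ0, one_smul]
  · rw [map_smul, Quat.conj_mul, hcz, hcz', neg_mul_neg]
  · rw [smul_mul_assoc, smul_mul_smul_comm]
    have : z' * z * b * (z * z') = z' * (z * b * z) * z' := by noncomm_ring
    rw [this, hb b hbA]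
    simp

theorem isClosed_cls {K : Type*} [RCLike K] (c : K) : IsClosed (cls c) := by
  have : cls c = {x | N x = 1} ∩ ({x | x.re = c} ∩ {x | c ^ 2 = 1 → x = c • 1}) := rfl
  rw [this]
  refine (isClosed_eq continuous_N continuous_const).inter
    ((isClosed_eq (by fun_prop) continuous_const).inter ?_)
  by_cases hc : c ^ 2 = 1
  · simp only [hc, true_imp_iff]
    exact isClosed_eq continuous_id continuous_const
  · simp [hc]

theorem isClosed_relTuples {K : Type*} [RCLike K] (g : ℕ) {n : ℕ} (c : Fin n → K) :
    IsClosed (relTuples g c) := by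
  have : relTuples g c = {v | ∀ s, N (v s) = 1} ∩
      ({v | ∀ i, v (.beta i) ∈ cls (c i)} ∩ {v | relator v = 1}) := rfl
  rw [this]
  refine IsClosed.inter ?_ (IsClosed.inter ?_ ?_)
  · simp only [Set.ofPred_forall]
    exact isClosed_iInter fun s => isClosed_eq (by fun_prop) continuous_const
  · simp only [Set.ofPred_forall]
    exact isClosed_iInter fun i => (isClosed_cls (c i)).preimage (continuous_apply _)
  · exact isClosed_eq (contDiff_relator (m := 1)).continuous continuous_const

/-- A reducible homomorphism degenerates to an abelian one. -/
theorem QuatModel.exists_isAbelian_of_not_isIrred {G : Type*} [Group G] [TopologicalSpace G]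
    {g n : ℕ} (M : QuatModel ℂ G) {c : Fin n → ℂ} {R : Type*} [TopologicalSpace R] [T2Space R]
    {proj : HomSpace g n G → R} (hproj : Continuous proj)
    (hinv : ∀ a ρ, proj (QuatModel.conjHom a ρ) = proj ρ) {ρ : HomSpace g n G}
    (hρ : ρ ∈ M.rel g c) (hirr : ¬ IsIrred (M.tuple ρ)) :
    ∃ σ ∈ M.rel g c, M.IsAbelian σ ∧ proj σ = proj ρ := by
  obtain ⟨p, q, hpp, hqq, hpq, hqp, hadd, hconj, hA⟩ :=
    exists_idempotents (evalTuple (M.tuple ρ)).range fun h => hirr (AlgHom.range_eq_top _ |>.1 h)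
  have hconj' : conj q = p := by rw [← hconj, Quat.conj_conj]
  have hA' : ∀ s, q * M.tuple ρ s * p = 0 := fun s =>
    hA _ ⟨FreeAlgebra.ι ℂ s, evalTuple_ι _ s⟩
  have hch : ∀ t : ℂ, conj (t • p + t⁻¹ • q) = t • q + t⁻¹ • p := fun t => by
    rw [map_add, map_smul, map_smul, hconj, hconj']
  -- Conjugation by the diagonal element `t p + t⁻¹ q` fixes the diagonal part of a triangular `b`
  -- and multiplies the off-diagonal part by `t ^ 2`, so `t → 0` leaves the diagonal part.
  have hmul : ∀ t : ℂ, t ≠ 0 → ∀ b, q * b * p = 0 → (t • p + t⁻¹ • q) * b * (t • q + t⁻¹ • p) =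
      p * b * p + q * b * q + t ^ 2 • (p * b * q) := by
    intro t ht b hb
    simp only [add_mul, mul_add, smul_mul_assoc, mul_smul_comm, smul_smul, hb, smul_zero, smul_add,
      mul_inv_cancel₀ ht, inv_mul_cancel₀ ht, one_smul, add_zero]
    rw [pow_two]
    abel
  have hNt : ∀ t : ℂ, t ≠ 0 → N (t • p + t⁻¹ • q) = 1 := by
    intro t ht
    have h1 := mul_conj (t • p + t⁻¹ • q)
    have h2 := hmul t ht 1 (by rw [mul_one, hqp])
    rw [mul_one, mul_one, hpp, mul_one, hqq, hpq, smul_zero, add_zero, hadd] at h2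
    rw [hch, h2] at h1
    have := congrArg Quat.re h1
    simpa using this.symm
  have hex : ∀ t : ℂ, ∃ a : G, t ≠ 0 → M.Q a = t • p + t⁻¹ • q := by
    intro t
    by_cases ht : t = 0
    · exact ⟨1, fun h => absurd ht h⟩
    · obtain ⟨a, ha⟩ := (M.mem_range _).2 (hNt t ht)
      exact ⟨a, fun _ => ha⟩
  choose a ha using hex
  let W : ℂ → SurfaceGen g n → Quat ℂ := fun t s =>
    p * M.tuple ρ s * p + q * M.tuple ρ s * q + t ^ 2 • (p * M.tuple ρ s * q)
  have hW : ∀ t, t ≠ 0 → M.tuple (QuatModel.conjHom (a t) ρ) = W t := by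
    intro t ht
    ext1 s
    rw [M.tuple_conjHom, ha t ht, hch, hmul t ht _ (hA' s)]
  have hWc : Continuous W := continuous_pi fun s => by
    simp only [W]
    fun_prop
  have hlim : Tendsto W (𝓝[≠] 0) (𝓝 (W 0)) := hWc.continuousAt.tendsto.mono_left nhdsWithin_le_nhds
  have hev : ∀ᶠ t in 𝓝[≠] (0 : ℂ), t ≠ 0 := eventually_mem_nhdsWithin
  have hW0 : W 0 ∈ relTuples g c := by
    refine (isClosed_relTuples g c).mem_of_tendsto hlim ?_
    filter_upwards [hev] with t ht
    rw [← hW t ht, M.tuple_mem_relTuples]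
    exact M.conjHom_mem_rel _ hρ
  obtain ⟨σ, hσ, hσW⟩ := M.exists_tuple_eq hW0
  refine ⟨σ, hσ, fun s s' => ?_, ?_⟩
  · have hw0 : (p - q).re = 0 := by
      rw [← hconj]
      simp [conj]
    have hw : p - q ≠ 0 := by
      intro h0
      have hp0 : p = 0 := by rw [← hpp]; nth_rw 2 [sub_eq_zero.1 h0]; exact hpq
      have hq0 : q = 0 := by rw [← sub_eq_zero.1 h0, hp0]
      rw [hp0, hq0, add_zero] at hadd
      exact zero_ne_one (congrArg Quat.re hadd)
    have hcomm : ∀ s, (p - q) * M.tuple σ s = M.tuple σ s * (p - q) := by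
      intro s
      rw [hσW]
      simp only [W, zero_pow two_ne_zero, zero_smul, add_zero]
      set b := M.tuple ρ s
      calc (p - q) * (p * b * p + q * b * q)
          = (p * p) * b * p + (p * q) * b * q - (q * p) * b * p - (q * q) * b * q := by noncomm_ring
        _ = p * b * (p * p) - p * b * (p * q) + q * b * (q * p) - q * b * (q * q) := by
          rw [hpp, hpq, hqp, hqq]; noncomm_ring
        _ = _ := by noncomm_ring
    exact comm_of_comm_pure hw hw0 (hcomm s) (hcomm s')
  · have h1 : Tendsto (fun t => QuatModel.conjHom (a t) ρ) (𝓝[≠] 0) (𝓝 σ) := by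
      rw [M.isEmbedding_tuple.isInducing.tendsto_nhds_iff, hσW]
      refine hlim.congr' ?_
      filter_upwards [hev] with t ht
      exact (hW t ht).symm
    -- The projection is constant along the conjugates and continuous at the limit; uniqueness of
    -- limits in the Hausdorff target identifies the two classes.
    have h2 : Tendsto (fun t => proj (QuatModel.conjHom (a t) ρ)) (𝓝[≠] 0) (𝓝 (proj σ)) :=
      (hproj.tendsto σ).comp h1
    simp only [hinv] at h2
    exact tendsto_nhds_unique h2 tendsto_const_nhds

end Degeneration

/-! ### The group `SL₂(ℂ)` -/

section SL2

open Module Quat Topology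

variable {g n : ℕ}

theorem continuous_projSL2 : Continuous (projSL2 : HomSpace g n SL2C → RepSL2 g n) :=
  (T2Quotient.continuous_mk _).comp continuous_toOrbit

theorem projSL2_conjHom (a : SL2C) (ρ : HomSpace g n SL2C) :
    projSL2 (QuatModel.conjHom a ρ) = projSL2 ρ :=
  congrArg T2Quotient.mk (QuatModel.toOrbit_conjHom a ρ)

/-- Traces are functions on the representation space. -/
theorem exists_trace_projSL2 (x : FreeAlgebra ℂ (SurfaceGen g n)) :
    ∃ h : RepSL2 g n → ℂ, ∀ ρ, h (projSL2 ρ) = (evalTuple (modelSL2.tuple ρ) x).re := by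
  let f : OrbitSpace g n SL2C → ℂ := Quotient.lift (fun ρ => (evalTuple (modelSL2.tuple ρ) x).re) (by
    rintro ρ σ ⟨a, ha⟩
    have : σ = QuatModel.conjHom a ρ := MonoidHom.ext ha
    change (evalTuple (modelSL2.tuple ρ) x).re = (evalTuple (modelSL2.tuple σ) x).re
    rw [this, modelSL2.re_evalTuple_conjHom])
  have hf : Continuous f := by
    refine continuous_coinduced_dom.2 ?_
    have h1 := (contDiff_evalTuple (m := 1) x).continuous.comp
      (modelSL2.continuous_tuple (g := g) (n := n))
    change Continuous fun ρ => (evalTuple (modelSL2.tuple ρ) x).re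
    exact (show Continuous (Quat.re : Quat ℂ → ℂ) by fun_prop).comp h1
  exact ⟨T2Quotient.lift hf, fun ρ => T2Quotient.lift_mk hf _⟩

/-- Traces are continuous functions to a Hausdorff space, so they descend to the Hausdorff quotient,
and they determine irreducible tuples up to conjugation. -/
theorem exists_conjHom_of_projSL2_eq {ρ σ : HomSpace g n SL2C} (hρ : IsIrred (modelSL2.tuple ρ))
    (h : projSL2 σ = projSL2 ρ) : ∃ a, σ = QuatModel.conjHom a ρ := by
  refine modelSL2.exists_conjHom_of_re_eq hρ fun x => ?_
  obtain ⟨f, hf⟩ := exists_trace_projSL2 x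
  rw [← hf, ← hf, h]

theorem coaxHomSL2_eq (g : ℕ) {n : ℕ} (θ : Fin n → ℝ) : coaxHomSL2 g θ =
    {ρ | ρ ∈ modelSL2.rel g (fun i => ((cosAngle θ i : ℝ) : ℂ)) ∧ modelSL2.IsAbelian ρ} := by
  rw [← relHomSL2_eq]
  ext ρ
  exact and_congr_right fun _ => isCoaxialSL2_iff ρ

/-- A reducible homomorphism has the same image as an abelian one, so it is excluded. The fibre
through an irreducible homomorphism is a single orbit and contains nothing abelian. -/
theorem noncoaxRepSL2_eq (g : ℕ) {n : ℕ} (θ : Fin n → ℝ) : noncoaxRepSL2 g θ =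
    projSL2 '' modelSL2.irreducible g fun i => ((cosAngle θ i : ℝ) : ℂ) := by
  rw [noncoaxRepSL2, relRepSL2, coaxRepSL2, coaxHomSL2_eq, relHomSL2_eq]
  ext y
  constructor
  · rintro ⟨⟨ρ, h1, rfl⟩, h2⟩
    refine ⟨ρ, ⟨h1, ?_⟩, rfl⟩
    by_contra h3
    obtain ⟨σ, hσ, hab, hp⟩ := modelSL2.exists_isAbelian_of_not_isIrred continuous_projSL2
      projSL2_conjHom h1 h3
    exact h2 ⟨σ, ⟨hσ, hab⟩, hp⟩
  · rintro ⟨ρ, ⟨h1, h2⟩, rfl⟩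
    refine ⟨⟨ρ, h1, rfl⟩, ?_⟩
    rintro ⟨σ, ⟨-, h3⟩, h4⟩
    obtain ⟨a, rfl⟩ := exists_conjHom_of_projSL2_eq h2 h4
    obtain ⟨s, s', h5⟩ := (modelSL2.isIrred_conjHom a h2).exists_not_comm
    exact h5 (h3 s s')

theorem isGoodQuotient_projSL2 (c : Fin n → ℂ) :
    modelSL2.IsGoodQuotient (projSL2 : HomSpace g n SL2C → _) c
      (projSL2 '' modelSL2.irreducible g c) where
  continuous := continuous_projSL2
  invariant := projSL2_conjHom
  trace := exists_trace_projSL2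
  image := rfl
  open_image U hU := by
    -- On the irreducible part fibres are orbits, so the preimage of the image in the orbit space is
    -- again the image of `U₁`, which is open.
    set U₁ := U ∩ modelSL2.tuple ⁻¹' {v | IsIrred v} with hU₁
    have hopen : IsOpen U₁ := hU.inter (isOpen_isIrred.preimage modelSL2.continuous_tuple)
    refine ⟨projSL2 '' U₁, ?_, ?_⟩
    · have h1 : (T2Quotient.mk : OrbitSpace g n SL2C → RepSL2 g n) ⁻¹' (projSL2 '' U₁) =
          toOrbit '' U₁ := by
        ext y
        obtain ⟨σ, rfl⟩ := surjective_toOrbit y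
        constructor
        · rintro ⟨ρ, h2, h3⟩
          obtain ⟨a, rfl⟩ := exists_conjHom_of_projSL2_eq (σ := σ) h2.2 h3.symm
          exact ⟨ρ, h2, (QuatModel.toOrbit_conjHom a ρ).symm⟩
        · rintro ⟨ρ, h2, h3⟩
          exact ⟨ρ, h2, congrArg T2Quotient.mk h3⟩
      have h2 := modelSL2.isOpenMap_toOrbit U₁ hopen
      rw [← h1] at h2
      exact h2
    · ext y
      constructor
      · rintro ⟨⟨ρ, h1, rfl⟩, ⟨σ, h2, h⟩⟩
        obtain ⟨a, rfl⟩ := exists_conjHom_of_projSL2_eq h1.2 h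
        exact ⟨_, ⟨⟨modelSL2.conjHom_mem_rel a h1.1, h2.2⟩, h2.1⟩, h⟩
      · rintro ⟨ρ, ⟨h1, h2⟩, rfl⟩
        exact ⟨⟨ρ, h1, rfl⟩, ⟨ρ, ⟨h2, h1.2⟩, rfl⟩⟩

theorem isOrientedManifold_noncoaxRepSL2 (g : ℕ) {n : ℕ} (θ : Fin n → ℝ) :
    IsOrientedManifold (restrict (pushforward (regularSL2 g n) projSL2) (noncoaxRepSL2 g θ))
      (6 * (g : ℤ) - 6 + 2 * ((n : ℤ) - numIntegral θ)) := by
  rw [noncoaxRepSL2_eq, regularSL2_eq, ← card_cosAngle_complex]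
  exact isOrientedManifold_rep_complex (isGoodQuotient_projSL2 _)

end SL2

/-! ### Homomorphisms to a torus -/

section Torus

open Module Quat Topology Filter

variable {K : Type*} [RCLike K] {g n : ℕ}

/-- The half traces of the rotations with angles `φ`. -/
def halfTraces (K : Type*) [RCLike K] (φ : Fin n → ℝ) (i : Fin n) : K := (Real.cos (φ i) : K)

/-- The rotation by a real angle about the axis `u`. -/
def rotation (x : ℝ) (u : Quat K) : Quat K := (Real.cos x : K) • 1 + (Real.sin x : K) • u

/-- The choices of signs for which the signed angles sum to a multiple of a full turn. -/
def balancedSigns (φ : Fin n → ℝ) : Set (Fin n → ℤˣ) :=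
  {ε | ∃ m : ℤ, m * (2 * Real.pi) = ∑ i, ((ε i : ℤ) : ℝ) * φ i}

/-- The tuple of elements of the torus with axis `u`, given the coordinates `a`, `b` of the values
at `μ_j`, `ν_j`, and with the values at `β_i` determined by the signed angles. -/
def torusTuple (φ : Fin n → ℝ) (ε : Fin n → ℤˣ) (u : Quat K) (a b : Fin g ⊕ Fin g → K) :
    SurfaceGen g n → Quat K
  | .mu j => a (.inl j) • 1 + b (.inl j) • u
  | .nu j => a (.inr j) • 1 + b (.inr j) • u
  | .beta i => rotation (((ε i : ℤ) : ℝ) * φ i) u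

theorem cos_sign_mul (e : ℤˣ) (x : ℝ) : Real.cos (((e : ℤ) : ℝ) * x) = Real.cos x := by
  rcases Int.units_eq_one_or e with rfl | rfl <;> simp

theorem sin_sign_mul (e : ℤˣ) (x : ℝ) : Real.sin (((e : ℤ) : ℝ) * x) = ((e : ℤ) : ℝ) * Real.sin x := by
  rcases Int.units_eq_one_or e with rfl | rfl <;> simp

theorem ofReal_cos_sq_add_sin_sq (x : ℝ) :
    ((Real.cos x : ℝ) : K) ^ 2 + ((Real.sin x : ℝ) : K) ^ 2 = 1 := by
  exact_mod_cast congrArg (RCLike.ofReal (K := K)) (Real.cos_sq_add_sin_sq x)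

theorem prod_rotation {u : Quat K} (hu0 : u.re = 0) (hu : N u = 1) {m : ℕ} (x : Fin m → ℝ) :
    (List.ofFn fun i => rotation (x i) u).prod = rotation (∑ i, x i) u := by
  have huu : u * u = (-1 : K) • 1 := by rw [Quat.mul_self_of_pure hu0, hu]
  induction m with
  | zero => simp [rotation]
  | succ m ih =>
    rw [List.ofFn_succ, List.prod_cons, ih, Fin.sum_univ_succ]
    simp only [rotation, Real.cos_add, Real.sin_add, RCLike.ofReal_add, RCLike.ofReal_sub,
      RCLike.ofReal_mul, add_mul, mul_add, smul_mul_smul_comm, huu, one_mul, mul_one]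
    module

theorem rotation_eq_one_iff {u : Quat K} (hu0 : u.re = 0) (x : ℝ) :
    rotation x u = 1 ↔ Real.cos x = 1 := by
  constructor
  · intro h
    have h1 := congrArg Quat.re h
    simp only [rotation, re_add, re_smul, re_one, hu0, mul_one, mul_zero, add_zero] at h1
    exact_mod_cast h1
  · intro h
    have h2 : Real.sin x = 0 := by
      have := Real.sin_sq_add_cos_sq x
      rw [h] at this
      nlinarith
    rw [rotation, h, h2]
    simp

theorem prod_rotation_eq_one_iff {u : Quat K} (hu0 : u.re = 0) (hu : N u = 1) {φ : Fin n → ℝ}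
    {ε : Fin n → ℤˣ} : (List.ofFn fun i => rotation (((ε i : ℤ) : ℝ) * φ i) u).prod = 1 ↔
      ε ∈ balancedSigns φ := by
  rw [prod_rotation hu0 hu, rotation_eq_one_iff hu0, Real.cos_eq_one_iff]
  rfl

theorem relator_of_comm {v : SurfaceGen g n → Quat K} (hN : ∀ s, N (v s) = 1)
    (h : ∀ s s', v s * v s' = v s' * v s) :
    relator v = (List.ofFn fun i => v (.beta i)).prod := by
  rw [relator, blocks, List.map_append, List.prod_append, List.map_map, List.map_map,
    List.ofFn_eq_map]
  have h1 : ((List.finRange g).map (block v ∘ Sum.inl)).prod = 1 := by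
    refine List.prod_eq_one fun x hx => ?_
    obtain ⟨j, -, rfl⟩ := List.mem_map.1 hx
    change v (.mu j) * v (.nu j) * conj (v (.mu j)) * conj (v (.nu j)) = 1
    rw [h, mul_assoc (v (.nu j)), mul_conj_of_N_eq_one (hN _), mul_one,
      mul_conj_of_N_eq_one (hN _)]
  rw [h1, one_mul]
  rfl

theorem rotation_mem_cls {u : Quat K} (hu0 : u.re = 0) (hu : N u = 1) (e : ℤˣ) (x : ℝ) :
    rotation (((e : ℤ) : ℝ) * x) u ∈ cls (Real.cos x : K) := by
  refine ⟨?_, ?_, fun hc => ?_⟩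
  · rw [rotation, Quat.N_add_smul hu0, hu, mul_one, ofReal_cos_sq_add_sin_sq]
  · simp [rotation, hu0, cos_sign_mul]
  · have h1 : Real.cos x ^ 2 = 1 := by exact_mod_cast hc
    have h2 : Real.sin x = 0 := by nlinarith [Real.sin_sq_add_cos_sq x]
    rw [rotation, sin_sign_mul, cos_sign_mul, h2]
    simp

theorem torusTuple_comm (φ : Fin n → ℝ) (ε : Fin n → ℤˣ) (u : Quat K) (a b : Fin g ⊕ Fin g → K)
    (s s' : SurfaceGen g n) : torusTuple φ ε u a b s * torusTuple φ ε u a b s' =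
      torusTuple φ ε u a b s' * torusTuple φ ε u a b s := by
  have key : ∀ s : SurfaceGen g n, ∃ x y : K, torusTuple φ ε u a b s = x • 1 + y • u := by
    rintro (j | j | i)
    exacts [⟨_, _, rfl⟩, ⟨_, _, rfl⟩, ⟨_, _, rfl⟩]
  obtain ⟨x, y, h⟩ := key s
  obtain ⟨x', y', h'⟩ := key s'
  rw [h, h']
  simp only [add_mul, mul_add, smul_mul_smul_comm, one_mul, mul_one]
  module

theorem torusTuple_mem_relTuples {φ : Fin n → ℝ} {ε : Fin n → ℤˣ} (hε : ε ∈ balancedSigns φ)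
    {u : Quat K} (hu0 : u.re = 0) (hu : N u = 1) {a b : Fin g ⊕ Fin g → K}
    (hab : ∀ j, a j ^ 2 + b j ^ 2 = 1) :
    torusTuple φ ε u a b ∈ relTuples g (halfTraces K φ) := by
  have hN : ∀ s, N (torusTuple φ ε u a b s) = 1 := by
    rintro (j | j | i)
    · exact (Quat.N_add_smul hu0 _ _).trans (by rw [hu, mul_one, hab])
    · exact (Quat.N_add_smul hu0 _ _).trans (by rw [hu, mul_one, hab])
    · exact (rotation_mem_cls hu0 hu _ _).1
  refine ⟨hN, fun i => rotation_mem_cls hu0 hu _ _, ?_⟩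
  rw [relator_of_comm hN (torusTuple_comm φ ε u a b)]
  exact (prod_rotation_eq_one_iff hu0 hu).2 hε

/-- Some two cyclically consecutive coordinates of a nonzero vector span a nonzero norm. -/
theorem exists_sq_add_sq_ne_zero {p : Fin 3 → K} (hp : p ≠ 0) :
    ∃ l, p l ^ 2 + p (l + 1) ^ 2 ≠ 0 := by
  by_contra! h
  have h0 := h 0
  have h1 := h 1
  have h2 := h 2
  simp only [zero_add, show (1 : Fin 3) + 1 = 2 from rfl, show (2 : Fin 3) + 1 = 0 from rfl] at h0 h1 h2
  refine hp (funext fun i => ?_)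
  have h3 : (2 : K) ≠ 0 := two_ne_zero
  fin_cases i
  · have : 2 * p 0 ^ 2 = 0 := by linear_combination h0 + h2 - h1
    simpa using this
  · have : 2 * p 1 ^ 2 = 0 := by linear_combination h0 + h1 - h2
    simpa using this
  · have : 2 * p 2 ^ 2 = 0 := by linear_combination h1 + h2 - h0
    simpa using this

theorem N_pure (p : Fin 3 → K) : N (pure p) = p 0 ^ 2 + p 1 ^ 2 + p 2 ^ 2 := by
  simp [N]

namespace QuatModel

variable {G : Type*} [Group G] [TopologicalSpace G] (M : QuatModel K G)

/-- The homomorphisms to the tori with a generic axis. -/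
def torusHoms (g : ℕ) (φ : Fin n → ℝ) (ε : Fin n → ℤˣ) (l : Fin 3) : Set (HomSpace g n G) :=
  {ρ | ∃ (p : Fin 3 → K) (a b : Fin g ⊕ Fin g → K), N (pure p) = 1 ∧
    p l ^ 2 + p (l + 1) ^ 2 ≠ 0 ∧ (∀ j, a j ^ 2 + b j ^ 2 = 1) ∧
    M.tuple ρ = torusTuple φ ε (pure p) a b}

/-- The homomorphisms with given values in a torus exist. -/
theorem exists_tuple_eq_torusTuple {φ : Fin n → ℝ} {ε : Fin n → ℤˣ} (hε : ε ∈ balancedSigns φ)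
    {u : Quat K} (hu0 : u.re = 0) (hu : N u = 1) {a b : Fin g ⊕ Fin g → K}
    (hab : ∀ j, a j ^ 2 + b j ^ 2 = 1) :
    ∃ ρ, (ρ ∈ M.rel g (halfTraces K φ) ∧ M.IsAbelian ρ) ∧ M.tuple ρ = torusTuple φ ε u a b := by
  obtain ⟨ρ, hρ, h⟩ := M.exists_tuple_eq (torusTuple_mem_relTuples hε hu0 hu hab)
  exact ⟨ρ, ⟨hρ, fun s s' => by rw [h]; exact torusTuple_comm _ _ _ _ _ s s'⟩, h⟩

/-- The half trace fixes the cosine of the value at `β_i` and hence its sine up to sign, which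
defines `ε`. As the commutators are trivial, the relator says that the rotations multiply to one. -/
theorem mem_torusHoms_of_axis {φ : Fin n → ℝ} {ρ : HomSpace g n G}
    (hρ : ρ ∈ M.rel g (halfTraces K φ)) (hab : M.IsAbelian ρ) {p : Fin 3 → K} {l : Fin 3}
    (hl : p l ^ 2 + p (l + 1) ^ 2 ≠ 0) (hN : N (pure p) = 1) {a b : SurfaceGen g n → K}
    (h1 : ∀ s, a s ^ 2 + b s ^ 2 = 1) (h2 : ∀ s, M.tuple ρ s = a s • 1 + b s • pure p) :
    ∃ ε ∈ balancedSigns φ, ρ ∈ M.torusHoms g φ ε l := by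
  have hp0 : (pure p).re = 0 := rfl
  have hε : ∀ i, ∃ e : ℤˣ, M.tuple ρ (.beta i) = rotation (((e : ℤ) : ℝ) * φ i) (pure p) := by
    intro i
    have h3 : a (.beta i) = (Real.cos (φ i) : K) := by
      have := (hρ i).2.1
      rw [h2] at this
      simpa [halfTraces] using this
    have h4 : (b (.beta i) - (Real.sin (φ i) : K)) * (b (.beta i) + (Real.sin (φ i) : K)) = 0 := by
      have h5 := h1 (.beta i)
      rw [h3] at h5
      linear_combination h5 - ofReal_cos_sq_add_sin_sq (K := K) (φ i)
    rcases mul_eq_zero.1 h4 with h5 | h5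
    · refine ⟨1, ?_⟩
      rw [h2, h3, sub_eq_zero.1 h5]
      simp [rotation]
    · refine ⟨-1, ?_⟩
      rw [h2, h3, eq_neg_of_add_eq_zero_left h5]
      simp [rotation]
  choose ε hε using hε
  refine ⟨ε, ?_, p, fun j => Sum.elim (fun j => a (.mu j)) (fun j => a (.nu j)) j,
    fun j => Sum.elim (fun j => b (.mu j)) (fun j => b (.nu j)) j, hN, hl, ?_, ?_⟩
  · rw [← prod_rotation_eq_one_iff hp0 hN]
    simp only [← hε]
    rw [← relator_of_comm (M.N_tuple ρ) hab]
    exact (M.tuple_mem_relTuples.2 hρ).2.2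
  · rintro (j | j) <;> exact h1 _
  · funext s
    rcases s with j | j | i
    exacts [h2 _, h2 _, hε i]

/-- Here every value has half trace `±1`, so the values at `β_i` are central and the signs do not
matter. The isotropic axis is deformed to axes of nonzero norm, and the values at `μ_j`, `ν_j`
follow it in norm one. -/
theorem mem_closure_torusHoms_of_isotropic {φ : Fin n → ℝ} {ρ : HomSpace g n G}
    (hρ : ρ ∈ M.rel g (halfTraces K φ)) (hab : M.IsAbelian ρ) {p : Fin 3 → K} {l : Fin 3}
    (hl : p l ^ 2 + p (l + 1) ^ 2 ≠ 0) (hN : N (pure p) = 0) {a b : SurfaceGen g n → K}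
    (h1 : ∀ s, a s ^ 2 = 1) (h2 : ∀ s, M.tuple ρ s = a s • 1 + b s • pure p) :
    ∃ ε ∈ balancedSigns φ, ρ ∈ closure (M.torusHoms g φ ε l) := by
  have hβ : ∀ i (u : Quat K), M.tuple ρ (.beta i) = rotation ((((1 : ℤˣ) : ℤ) : ℝ) * φ i) u := by
    intro i u
    have h3 : a (.beta i) = (Real.cos (φ i) : K) := by
      have := (hρ i).2.1
      rw [h2] at this
      simpa [halfTraces] using this
    have h4 := h1 (.beta i)
    rw [h3] at h4
    have h5 : Real.cos (φ i) ^ 2 = 1 := by exact_mod_cast h4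
    have h6 : Real.sin (φ i) = 0 := by nlinarith [Real.sin_sq_add_cos_sq (φ i)]
    have h7 : M.tuple ρ (.beta i) = (Real.cos (φ i) : K) • 1 := (hρ i).2.2 h4
    rw [h7]
    simp [rotation, h6]
  have hε : (fun _ => 1) ∈ balancedSigns φ := by
    rw [← prod_rotation_eq_one_iff (K := K) (u := Quat.mk 0 1 0 0) rfl (by simp [N])]
    simp only [← hβ]
    rw [← relator_of_comm (M.N_tuple ρ) hab]
    exact (M.tuple_mem_relTuples.2 hρ).2.2
  refine ⟨_, hε, ?_⟩
  -- Adding a multiple of the complex conjugate makes the norm equal to `t κ`, nonzero for `t ≠ 0`: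
  -- both squared terms vanish and only the pairing survives.
  let p' : K → Fin 3 → K := fun t i => p i + t * star (p i)
  have hp'c : Continuous p' := continuous_pi fun i => by simp only [p']; fun_prop
  have hp'0 : p' 0 = p := by simp [p']
  set κ : ℝ := 2 * (‖p 0‖ ^ 2 + ‖p 1‖ ^ 2 + ‖p 2‖ ^ 2) with hκ
  have hκ0 : κ ≠ 0 := by
    intro h0
    have h3 : ‖p 0‖ ^ 2 + ‖p 1‖ ^ 2 + ‖p 2‖ ^ 2 = 0 := by linarith
    have h4 : ∀ i, p i = 0 := by
      intro i
      refine norm_eq_zero.1 ((pow_eq_zero_iff two_ne_zero).1 ?_)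
      have e0 := sq_nonneg ‖p 0‖
      have e1 := sq_nonneg ‖p 1‖
      have e2 := sq_nonneg ‖p 2‖
      fin_cases i <;> simp only [Fin.zero_eta, Fin.mk_one, Fin.reduceFinMk] <;> linarith
    exact hl (by rw [h4, h4]; simp)
  have hNp : p 0 ^ 2 + p 1 ^ 2 + p 2 ^ 2 = 0 := by rw [← N_pure, hN]
  have hν : ∀ t, N (pure (p' t)) = t * (κ : K) := by
    intro t
    have e : ∀ x : K, x * star x = ((‖x‖ ^ 2 : ℝ) : K) := fun x => by
      rw [RCLike.star_def, RCLike.mul_conj]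
      simp
    have h3 := congrArg star hNp
    simp only [star_add, star_pow, star_zero] at h3
    rw [N_pure]
    simp only [p', hκ]
    push_cast [← e]
    linear_combination hNp + t ^ 2 * h3
  let ν : K → K := fun t => t * (κ : K)
  -- The half-angle parametrization of the conic `A ^ 2 + B ^ 2 ν = 1`, adjusted to pass through `(a
  -- s, b s)` at `t = 0`.
  let A : K → SurfaceGen g n → K := fun t s => a s * (1 - (a s * b s / 2) ^ 2 * ν t) /
    (1 + (a s * b s / 2) ^ 2 * ν t)
  let B : K → SurfaceGen g n → K := fun t s => b s / (1 + (a s * b s / 2) ^ 2 * ν t)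
  have hden : ∀ᶠ t in 𝓝 (0 : K), ∀ s, 1 + (a s * b s / 2) ^ 2 * ν t ≠ 0 := by
    rw [eventually_all]
    intro s
    refine ContinuousAt.eventually_ne (g := fun t => 1 + (a s * b s / 2) ^ 2 * ν t) ?_ (by simp [ν])
    simp only [ν]
    fun_prop
  have hAB : ∀ t, (∀ s, 1 + (a s * b s / 2) ^ 2 * ν t ≠ 0) →
      ∀ s, A t s ^ 2 + B t s ^ 2 * ν t = 1 := by
    intro t ht s
    have h3 := ht s
    simp only [A, B]
    obtain ⟨q, hq⟩ : ∃ q, q = (a s * b s / 2) ^ 2 * ν t := ⟨_, rfl⟩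
    rw [← hq] at h3 ⊢
    rw [div_pow, div_pow, div_mul_eq_mul_div, ← add_div, div_eq_one_iff_eq (pow_ne_zero 2 h3)]
    linear_combination ((1 - q) ^ 2 - b s ^ 2 * ν t) * h1 s - 4 * hq
  have hA0 : ∀ s, A 0 s = a s := fun s => by simp [A, ν]
  have hB0 : ∀ s, B 0 s = b s := fun s => by simp [B, ν]
  let V : K → SurfaceGen g n → Quat K := fun t s =>
    SurfaceGen.casesOn s (fun j => A t (.mu j) • 1 + B t (.mu j) • pure (p' t))
      (fun j => A t (.nu j) • 1 + B t (.nu j) • pure (p' t)) (fun i => M.tuple ρ (.beta i))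
  have hV0 : V 0 = M.tuple ρ := by
    funext s
    rcases s with j | j | i
    · simp only [V, hA0, hB0, hp'0, h2]
    · simp only [V, hA0, hB0, hp'0, h2]
    · rfl
  have hVc : ContinuousAt V 0 := by
    have h3 : ∀ s, ContinuousAt (fun t => A t s • (1 : Quat K) + B t s • pure (p' t)) 0 := by
      intro s
      have h4 : ContinuousAt (fun t => A t s) 0 := by
        simp only [A, ν]
        refine ContinuousAt.div (by fun_prop) (by fun_prop) (by simp)
      have h5 : ContinuousAt (fun t => B t s) 0 := by
        simp only [B, ν]
        refine ContinuousAt.div (by fun_prop) (by fun_prop) (by simp)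
      have h6 : ContinuousAt (fun t => pure (p' t)) 0 :=
        ((pure (K := K)).continuous.comp hp'c).continuousAt
      exact (h4.smul continuousAt_const).add (h5.smul h6)
    refine continuousAt_pi.2 fun s => ?_
    rcases s with j | j | i
    exacts [h3 _, h3 _, continuousAt_const]
  have hgen : ∀ᶠ t in 𝓝 (0 : K), (p' t) l ^ 2 + (p' t) (l + 1) ^ 2 ≠ 0 := by
    refine ContinuousAt.eventually_ne (g := fun t => (p' t) l ^ 2 + (p' t) (l + 1) ^ 2) ?_
      (by rw [hp'0]; exact hl)
    simp only [p']
    fun_prop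
  have hne : ∀ᶠ t in 𝓝[≠] (0 : K), t ≠ 0 := eventually_mem_nhdsWithin
  have key : ∀ᶠ t in 𝓝[≠] (0 : K), ∃ σ ∈ M.torusHoms g φ (fun _ => 1) l, M.tuple σ = V t := by
    filter_upwards [hne, hden.filter_mono nhdsWithin_le_nhds, hgen.filter_mono nhdsWithin_le_nhds]
      with t ht hd hg
    have hNt : N (pure (p' t)) ≠ 0 := by
      rw [hν]
      exact mul_ne_zero ht (by exact_mod_cast hκ0)
    obtain ⟨r, hr⟩ := M.exists_sqrt _ hNt
    have hr0 : r ≠ 0 := by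
      rintro rfl
      exact hNt (by rw [← hr]; simp)
    have hrν : r ^ 2 = ν t := by rw [hr, hν]
    have hpu : pure (r⁻¹ • p' t) = r⁻¹ • pure (p' t) := map_smul _ _ _
    have hNu : N (pure (r⁻¹ • p' t)) = 1 := by
      rw [hpu, Quat.N_smul, ← hr]
      field_simp
    -- The axis is rescaled to norm one and the factor `r` is absorbed into the sine coordinates.
    have hVt : V t = torusTuple φ (fun _ => 1) (pure (r⁻¹ • p' t))
        (fun j => Sum.elim (fun j => A t (.mu j)) (fun j => A t (.nu j)) j)
        (fun j => r * Sum.elim (fun j => B t (.mu j)) (fun j => B t (.nu j)) j) := by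
      funext s
      rcases s with j | j | i
      · simp only [V, torusTuple, hpu, smul_smul, Sum.elim_inl]
        rw [mul_right_comm, mul_inv_cancel₀ hr0, one_mul]
      · simp only [V, torusTuple, hpu, smul_smul, Sum.elim_inr]
        rw [mul_right_comm, mul_inv_cancel₀ hr0, one_mul]
      · exact hβ i _
    have hab' : ∀ j : Fin g ⊕ Fin g, (Sum.elim (fun j => A t (.mu j)) (fun j => A t (.nu j)) j) ^ 2 +
        (r * Sum.elim (fun j => B t (.mu j)) (fun j => B t (.nu j)) j) ^ 2 = 1 := by
      rintro (j | j)
      · rw [mul_pow, hrν, mul_comm]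
        exact hAB t hd _
      · rw [mul_pow, hrν, mul_comm]
        exact hAB t hd _
    obtain ⟨σ, -, hσ⟩ := M.exists_tuple_eq_torusTuple hε (re_pure _) hNu hab'
    refine ⟨σ, ⟨r⁻¹ • p' t, _, _, hNu, ?_, hab', hσ⟩, by rw [hσ, hVt]⟩
    simp only [Pi.smul_apply, smul_eq_mul, mul_pow, ← mul_add]
    exact mul_ne_zero (pow_ne_zero 2 (inv_ne_zero hr0)) hg
  rw [M.isEmbedding_tuple.isInducing.closure_eq_preimage_closure_image, Set.mem_preimage, ← hV0]
  refine mem_closure_of_tendsto (hVc.tendsto.mono_left nhdsWithin_le_nhds) (b := 𝓝[≠] 0) ?_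
  filter_upwards [key] with t ht
  exact ht

/-- The abelian homomorphisms are limits of homomorphisms to tori with a generic axis. -/
theorem exists_mem_closure_torusHoms {φ : Fin n → ℝ} {ρ : HomSpace g n G}
    (hρ : ρ ∈ M.rel g (halfTraces K φ)) (hab : M.IsAbelian ρ) :
    ∃ ε ∈ balancedSigns φ, ∃ l, ρ ∈ closure (M.torusHoms g φ ε l) := by
  obtain ⟨z, hz, hz0, hN, h⟩ := hab.exists_axis
  obtain ⟨p, rfl⟩ := exists_pure_eq hz0
  obtain ⟨l, hl⟩ := exists_sq_add_sq_ne_zero (p := p) (by rintro rfl; exact hz (map_zero _))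
  choose a b h1 h2 using fun s : SurfaceGen g n => h (gen s)
  rcases hN with hN | hN
  · obtain ⟨ε, hε, h3⟩ := M.mem_torusHoms_of_axis hρ hab hl hN
      (fun s => by simpa [hN] using h1 s) h2
    exact ⟨ε, hε, l, subset_closure h3⟩
  · obtain ⟨ε, hε, h3⟩ := M.mem_closure_torusHoms_of_isotropic hρ hab hl hN
      (fun s => by simpa [hN] using h1 s) h2
    exact ⟨ε, hε, l, h3⟩

theorem exists_isAbelian_iff (φ : Fin n → ℝ) :
    (∃ ρ, ρ ∈ M.rel g (halfTraces K φ) ∧ M.IsAbelian ρ) ↔ (balancedSigns φ).Nonempty := by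
  constructor
  · rintro ⟨ρ, hρ, hab⟩
    obtain ⟨ε, hε, -⟩ := M.exists_mem_closure_torusHoms hρ hab
    exact ⟨ε, hε⟩
  · rintro ⟨ε, hε⟩
    obtain ⟨ρ, h, -⟩ := M.exists_tuple_eq_torusTuple (g := g) hε (u := Quat.mk 0 1 0 0) rfl
      (by simp [N]) (a := fun _ => 1) (b := fun _ => 0) (by simp)
    exact ⟨ρ, h⟩

end QuatModel

end Torus

/-! ### The dimension of the coaxial locus -/

section CoaxialDimension

open Module Quat Topology

variable {K : Type*} [RCLike K] (P : CircleParam K) {g n : ℕ}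

/-- Spherical coordinates on the unit quadric, with the polar axis in direction `l + 2`. -/
def spherical (l : Fin 3) (x y : K) : Fin 3 → K := fun j =>
  (![P.sin x * P.cos y, P.sin x * P.sin y, P.cos x] : Fin 3 → K) (j - l)

theorem spherical_apply (l : Fin 3) (x y : K) :
    spherical P l x y l = P.sin x * P.cos y ∧ spherical P l x y (l + 1) = P.sin x * P.sin y ∧
      spherical P l x y (l + 2) = P.cos x := by
  simp only [spherical, sub_self, add_sub_cancel_left]
  exact ⟨rfl, rfl, rfl⟩

theorem N_pure_eq (p : Fin 3 → K) (l : Fin 3) :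
    N (pure p) = p l ^ 2 + p (l + 1) ^ 2 + p (l + 2) ^ 2 := by
  rw [N_pure]
  fin_cases l
  · rfl
  · change _ = p 1 ^ 2 + p 2 ^ 2 + p 0 ^ 2
    ring
  · change _ = p 2 ^ 2 + p 0 ^ 2 + p 1 ^ 2
    ring

theorem cyclic_cases (l j : Fin 3) : j = l ∨ j = l + 1 ∨ j = l + 2 := by
  decide +revert

theorem toPi_add_smul_pure (x y : K) (q : Fin 3 → K) : toPi (x • (1 : Quat K) + y • pure q) =
    ![x, y * q 0, y * q 1, y * q 2] := by
  change ![(x • (1 : Quat K) + y • pure q).re, (x • (1 : Quat K) + y • pure q).imI,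
    (x • (1 : Quat K) + y • pure q).imJ, (x • (1 : Quat K) + y • pure q).imK] = _
  simp

theorem ext_cyclic {p q : Fin 3 → K} (l : Fin 3) (h0 : p l = q l) (h1 : p (l + 1) = q (l + 1))
    (h2 : p (l + 2) = q (l + 2)) : p = q := by
  funext j
  rcases cyclic_cases l j with rfl | rfl | rfl
  exacts [h0, h1, h2]

theorem N_pure_spherical (l : Fin 3) (x y : K) : N (pure (spherical P l x y)) = 1 := by
  obtain ⟨h0, h1, h2⟩ := spherical_apply P l x y
  rw [N_pure_eq _ l, h0, h1, h2]
  linear_combination P.cos_sq_add_sin_sq x + P.sin x ^ 2 * P.cos_sq_add_sin_sq y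

/-- A square root of `p l ^ 2 + p (l + 1) ^ 2` is the sine of the polar angle; the azimuth exists
because it can be divided out. -/
theorem exists_spherical_eq {G : Type*} [Group G] [TopologicalSpace G] (M : QuatModel K G)
    {p : Fin 3 → K} {l : Fin 3} (hp : N (pure p) = 1) (hl : p l ^ 2 + p (l + 1) ^ 2 ≠ 0) :
    ∃ x y, spherical P l x y = p := by
  have hN : N (Quat.mk (p l) (p (l + 1)) 0 0) = p l ^ 2 + p (l + 1) ^ 2 := by simp [N]
  obtain ⟨r, hr⟩ := M.exists_sqrt (Quat.mk (p l) (p (l + 1)) 0 0) (by rwa [hN])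
  rw [hN] at hr
  have hr0 : r ≠ 0 := by
    rintro rfl
    exact hl (by rw [← hr]; simp)
  rw [N_pure_eq p l, ← hr] at hp
  obtain ⟨x, hx, hx'⟩ := P.surj (p (l + 2)) r (by linear_combination hp)
  obtain ⟨y, hy, hy'⟩ := P.surj (p l / r) (p (l + 1) / r) (by
    rw [div_pow, div_pow, ← add_div, ← hr, div_self (pow_ne_zero 2 hr0)])
  refine ⟨x, y, ?_⟩
  obtain ⟨h0, h1, h2⟩ := spherical_apply P l x y
  refine ext_cyclic l ?_ ?_ ?_
  · rw [h0, hx', hy, mul_div_cancel₀ _ hr0]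
  · rw [h1, hx', hy', mul_div_cancel₀ _ hr0]
  · rw [h2, hx]

theorem conj_torusTuple {φ : Fin n → ℝ} {ε : Fin n → ℤˣ} {u u' h : Quat K} (hh : N h ≠ 0)
    (hu : u * h = h * u') (a b : Fin g ⊕ Fin g → K) (s : SurfaceGen g n) :
    (N h)⁻¹ • (h * torusTuple φ ε u' a b s * conj h) = torusTuple φ ε u a b s := by
  have key : ∀ x y : K, (N h)⁻¹ • (h * (x • 1 + y • u') * conj h) = x • 1 + y • u := by
    intro x y
    have e : h * (x • 1 + y • u') = (x • 1 + y • u) * h := by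
      rw [mul_add, add_mul, mul_smul_comm, mul_smul_comm, smul_mul_assoc, smul_mul_assoc, hu,
        mul_one, one_mul]
    rw [e, mul_assoc, mul_conj, mul_smul_comm, mul_one, smul_smul, inv_mul_cancel₀ hh, one_smul]
  rcases s with j | j | i
  exacts [key _ _, key _ _, key _ _]

namespace QuatModel

variable {G : Type*} [Group G] [TopologicalSpace G] (M : QuatModel K G)

/-- The abelian homomorphisms with given half traces. -/
def abelian (g : ℕ) (c : Fin n → K) : Set (HomSpace g n G) := {ρ | ρ ∈ M.rel g c ∧ M.IsAbelian ρ}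

variable {φ : Fin n → ℝ}

/-- The homomorphism to the torus with axis `p` given by the angles of the values at `μ_j`, `ν_j`
and the signs of the angles of the values at `β_i`. -/
def torusHom (ε : balancedSigns φ) {p : Fin 3 → K} (hp : N (pure p) = 1)
    (t : Fin g ⊕ Fin g → K) : M.abelian g (halfTraces K φ) :=
  ⟨_, (M.exists_tuple_eq_torusTuple ε.2 (re_pure p) hp (a := fun j => P.cos (t j))
    (b := fun j => P.sin (t j)) fun _ => P.cos_sq_add_sin_sq _).choose_spec.1⟩

theorem tuple_torusHom (ε : balancedSigns φ) {p : Fin 3 → K} (hp : N (pure p) = 1)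
    (t : Fin g ⊕ Fin g → K) : M.tuple (M.torusHom P ε hp t).1 =
      torusTuple φ ε.1 (pure p) (fun j => P.cos (t j)) (fun j => P.sin (t j)) :=
  (M.exists_tuple_eq_torusTuple ε.2 (re_pure p) hp (a := fun j => P.cos (t j))
    (b := fun j => P.sin (t j)) fun _ => P.cos_sq_add_sin_sq _).choose_spec.2

theorem eq_torusHom (ε : balancedSigns φ) {p : Fin 3 → K} (hp : N (pure p) = 1)
    {a b : Fin g ⊕ Fin g → K} (hab : ∀ j, a j ^ 2 + b j ^ 2 = 1) {ρ : HomSpace g n G}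
    (hρ : M.tuple ρ = torusTuple φ ε.1 (pure p) a b) : ∃ t, ρ = (M.torusHom P ε hp t).1 := by
  choose t ht ht' using fun j => P.surj (a j) (b j) (hab j)
  refine ⟨t, M.isEmbedding_tuple.injective ?_⟩
  rw [hρ, M.tuple_torusHom]
  simp only [ht, ht']

variable {τ : Type*}

theorem map_regular_le_trigPoly (Φ : (τ → K) → HomSpace g n G) (ε : balancedSigns φ)
    {p : (τ → K) → Fin 3 → K} (hp : ∀ t, N (pure (p t)) = 1) (j : Fin g ⊕ Fin g → τ)
    (hΦ : ∀ t, Φ t = (M.torusHom P ε (hp t) fun i => t (j i)).1)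
    (hpT : ∀ i, (fun t => p t i) ∈ trigPoly P τ) :
    (M.regular g n).map (pullback K Φ) ≤ trigPoly P τ := by
  rw [regular, AlgHom.map_adjoin, Algebra.adjoin_le_iff]
  rintro _ ⟨_, ⟨⟨s, k⟩, rfl⟩, rfl⟩
  change (fun t => toPi (M.tuple (Φ t) s) k) ∈ trigPoly P τ
  have hT : ∀ t, M.tuple (Φ t) = torusTuple φ ε.1 (pure (p t)) (fun i => P.cos (t (j i)))
      (fun i => P.sin (t (j i))) := fun t => by rw [hΦ, M.tuple_torusHom]
  simp only [hT]
  have key : ∀ x y : (τ → K) → K, x ∈ trigPoly P τ → y ∈ trigPoly P τ →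
      (fun t => toPi (x t • (1 : Quat K) + y t • pure (p t)) k) ∈ trigPoly P τ := by
    intro x y hx hy
    have h0 := fun i => (trigPoly P τ).mul_mem hy (hpT i)
    simp only [toPi_add_smul_pure]
    fin_cases k
    exacts [hx, h0 0, h0 1, h0 2]
  rcases s with i | i | i
  · exact key _ _ (cos_mem_trigPoly P _) (sin_mem_trigPoly P _)
  · exact key _ _ (cos_mem_trigPoly P _) (sin_mem_trigPoly P _)
  · exact key (fun _ => _) (fun _ => _) ((trigPoly P τ).algebraMap_mem _)
      ((trigPoly P τ).algebraMap_mem _)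

theorem continuous_of_mem_regular {f : HomSpace g n G → K} (hf : f ∈ M.regular g n) :
    Continuous f := by
  obtain ⟨H, hH, h⟩ := M.exists_contDiff_of_mem_regular hf
  rw [funext h]
  exact hH.continuous.comp M.continuous_tuple

theorem map_pullback_restrict {X T : Type*} (A : Subalgebra K (X → K)) (Z : Set X) (Φ : T → Z) :
    (restrict A Z).map (pullback K Φ) = A.map (pullback K fun t => (Φ t).1) := by
  rw [restrict, Subalgebra.map_map]
  rfl

/-- The parametrization of a family of homomorphisms to tori by angles. -/
def torusChart (j : balancedSigns φ × Fin 3) (t : (Fin g ⊕ Fin g) ⊕ Fin 2 → K) :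
    M.abelian g (halfTraces K φ) :=
  M.torusHom P j.1 (N_pure_spherical P j.2 (t (.inr 0)) (t (.inr 1))) fun i => t (.inl i)

theorem map_torusChart_le (j : balancedSigns φ × Fin 3) :
    (restrict (M.regular g n) (M.abelian g (halfTraces K φ))).map (pullback K (M.torusChart P j)) ≤
      trigPoly P ((Fin g ⊕ Fin g) ⊕ Fin 2) := by
  rw [map_pullback_restrict]
  refine M.map_regular_le_trigPoly P _ j.1 (fun t => N_pure_spherical P j.2 _ _) .inl
    (fun t => rfl) fun i => ?_
  have h1 : ∀ k : Fin 3, (fun t : (Fin g ⊕ Fin g) ⊕ Fin 2 → K =>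
      (![P.sin (t (.inr 0)) * P.cos (t (.inr 1)), P.sin (t (.inr 0)) * P.sin (t (.inr 1)),
        P.cos (t (.inr 0))] : Fin 3 → K) k) ∈ trigPoly P ((Fin g ⊕ Fin g) ⊕ Fin 2) := by
    intro k
    fin_cases k
    · exact (trigPoly P _).mul_mem (sin_mem_trigPoly P _) (cos_mem_trigPoly P _)
    · exact (trigPoly P _).mul_mem (sin_mem_trigPoly P _) (sin_mem_trigPoly P _)
    · exact cos_mem_trigPoly P _
  exact h1 (i - j.2)

/-- The cosines of the torus angles are real parts of values. The imaginary parts are the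
coordinates of the axis times a sine; dividing by a nonzero sine makes the axis, and then its two
spherical angles, algebraic over the algebra. If all values were central the axis would be
invisible, hence the hypothesis. -/
theorem ringKrullDim_torusChart (h : 0 < g ∨ ∃ i, Real.cos (φ i) ^ 2 ≠ 1)
    (j : balancedSigns φ × Fin 3) :
    ringKrullDim ((restrict (M.regular g n) (M.abelian g (halfTraces K φ))).map
      (pullback K (M.torusChart P j))) = ((2 * g + 2 : ℕ) : WithBot ℕ∞) := by
  have hle := M.map_torusChart_le (g := g) P j
  set A := (restrict (M.regular g n) (M.abelian g (halfTraces K φ))).map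
    (pullback K (M.torusChart P j)) with hA
  have hAeq : A = (M.regular g n).map (pullback K fun t => (M.torusChart P j t).1) :=
    map_pullback_restrict _ _ _
  have hfg : A.FG := by
    rw [hAeq]
    exact (M.regular_fg).map _
  have hcoord : ∀ s k, (fun t => toPi (M.tuple (M.torusChart P j t).1 s) k) ∈ A := by
    intro s k
    rw [hAeq]
    exact ⟨_, M.toPi_mem_regular s k, rfl⟩
  let p : ((Fin g ⊕ Fin g) ⊕ Fin 2 → K) → Fin 3 → K := fun t =>
    spherical P j.2 (t (.inr 0)) (t (.inr 1))
  have htuple : ∀ t, M.tuple (M.torusChart P j t).1 = torusTuple φ j.1.1 (pure (p t))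
      (fun i => P.cos (t (.inl i))) (fun i => P.sin (t (.inl i))) := fun t =>
    M.tuple_torusHom P _ _ _
  simp only [htuple] at hcoord
  have hcos : ∀ i, AlgOver P A fun t => P.cos (t (.inl i)) := by
    rintro (i | i)
    · refine AlgOver.of_mem hle ?_
      have := hcoord (.mu i) 0
      simp only [torusTuple, toPi_add_smul_pure] at this
      exact this
    · refine AlgOver.of_mem hle ?_
      have := hcoord (.nu i) 0
      simp only [torusTuple, toPi_add_smul_pure] at this
      exact this
  have hpT : ∀ i, (fun t => p t i) ∈ trigPoly P ((Fin g ⊕ Fin g) ⊕ Fin 2) := by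
    obtain ⟨e0, e1, e2⟩ : (fun t => p t j.2) ∈ trigPoly P ((Fin g ⊕ Fin g) ⊕ Fin 2) ∧
        (fun t => p t (j.2 + 1)) ∈ trigPoly P ((Fin g ⊕ Fin g) ⊕ Fin 2) ∧
        (fun t => p t (j.2 + 2)) ∈ trigPoly P ((Fin g ⊕ Fin g) ⊕ Fin 2) := by
      simp only [p, (spherical_apply P j.2 _ _).1, (spherical_apply P j.2 _ _).2.1,
        (spherical_apply P j.2 _ _).2.2]
      exact ⟨(trigPoly P _).mul_mem (sin_mem_trigPoly P _) (cos_mem_trigPoly P _),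
        (trigPoly P _).mul_mem (sin_mem_trigPoly P _) (sin_mem_trigPoly P _),
        cos_mem_trigPoly P _⟩
    intro i
    rcases cyclic_cases j.2 i with rfl | rfl | rfl
    exacts [e0, e1, e2]
  have hp : ∀ i, AlgOver P A fun t => p t i := by
    -- The factor `y` is the sine of the angle at `μ_0` if the genus is positive, and otherwise the
    -- constant sine of a non-central `β_i`.
    suffices hy : ∃ y : ((Fin g ⊕ Fin g) ⊕ Fin 2 → K) → K, AlgOver P A y ∧ (∃ t, y t ≠ 0) ∧
        ∀ i, (fun t => y t * p t i) ∈ A by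
      obtain ⟨y, hy, hy0, hyp⟩ := hy
      exact fun i => hy.of_mul hy0 (hpT i) (AlgOver.of_mem hle (hyp i))
    rcases h with h | ⟨i, hi⟩
    · refine ⟨fun t => P.sin (t (.inl (.inl ⟨0, h⟩))), (hcos _).sin_of_cos, ?_, fun i => ?_⟩
      · obtain ⟨t, ht⟩ := P.exists_sin_ne_zero
        exact ⟨fun _ => t, ht⟩
      · have := hcoord (.mu ⟨0, h⟩)
        simp only [torusTuple, toPi_add_smul_pure] at this
        fin_cases i
        exacts [this 1, this 2, this 3]
    · refine ⟨fun _ => (Real.sin ((((j.1.1 i : ℤˣ) : ℤ) : ℝ) * φ i) : K),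
        AlgOver.of_mem hle (A.algebraMap_mem _), ⟨0, ?_⟩, fun l => ?_⟩
      · have h1 := Real.sin_sq_add_cos_sq ((((j.1.1 i : ℤˣ) : ℤ) : ℝ) * φ i)
        rw [cos_sign_mul] at h1
        intro h0
        replace h0 : (Real.sin ((((j.1.1 i : ℤˣ) : ℤ) : ℝ) * φ i) : K) = 0 := h0
        have h2 : Real.sin ((((j.1.1 i : ℤˣ) : ℤ) : ℝ) * φ i) = 0 := by exact_mod_cast h0
        rw [h2] at h1
        exact hi (by linarith)
      · have := hcoord (.beta i)
        simp only [torusTuple, rotation, toPi_add_smul_pure] at this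
        fin_cases l
        exacts [this 1, this 2, this 3]
  have hx : AlgOver P A fun t => P.cos (t (.inr 0)) := by
    have := hp (j.2 + 2)
    simp only [p, (spherical_apply P j.2 _ _).2.2] at this
    exact this
  have hy : AlgOver P A fun t => P.cos (t (.inr 1)) := by
    have h1 := hp j.2
    simp only [p, (spherical_apply P j.2 _ _).1] at h1
    obtain ⟨t, ht⟩ := P.exists_sin_ne_zero
    exact hx.sin_of_cos.of_mul ⟨fun _ => t, ht⟩ (cos_mem_trigPoly P _) h1
  have hfinal : ∀ i, AlgOver P A fun t => P.cos (t i) := by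
    rintro (i | i)
    · exact hcos i
    · fin_cases i
      exacts [hx, hy]
  rw [ringKrullDim_eq_card_of_algOver hle hfg hfinal]
  congr 2
  simp
  ring

/-- The dimension of the space of abelian homomorphisms with a movable axis. -/
theorem hasPureDim_abelian (P : CircleParam K) (h : 0 < g ∨ ∃ i, Real.cos (φ i) ^ 2 ≠ 1) :
    HasPureDim (restrict (M.regular g n) (M.abelian g (halfTraces K φ))) (2 * g + 2) := by
  refine hasPureDim_of_cover _ _ (M.torusChart P) (fun j f hf f' hf' h0 => ?_) ?_
    (M.ringKrullDim_torusChart P h)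
  · have hle := M.map_torusChart_le (g := g) P j
    exact trigPoly_eq_zero_or P (hle ⟨f, hf, rfl⟩) (hle ⟨f', hf', rfl⟩) h0
  · rintro ⟨ρ, hρ, hab⟩
    obtain ⟨ε, hε, l, hmem⟩ := M.exists_mem_closure_torusHoms hρ hab
    refine ⟨(⟨ε, hε⟩, l), ?_⟩
    rintro _ ⟨F, hF, rfl⟩ h0
    -- Regular functions are continuous, so those vanishing on the tori with generic axis vanish on
    -- the limits, in particular on unipotent homomorphisms.
    refine closure_minimal (t := {ρ | F ρ = 0}) ?_
      (isClosed_eq (M.continuous_of_mem_regular hF) continuous_const) hmem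
    rintro σ ⟨p, a, b, hp, hl, hab', hσ⟩
    obtain ⟨x, y, rfl⟩ := exists_spherical_eq P M hp hl
    obtain ⟨t, rfl⟩ := M.eq_torusHom P ⟨ε, hε⟩ hp hab' hσ
    exact h0 (Sum.elim t ![x, y])

/-- The space of abelian homomorphisms is at most a point if all values are central. -/
theorem hasPureDim_abelian_zero (P : CircleParam K) (hg : g = 0) (h : ∀ i, Real.cos (φ i) ^ 2 = 1) :
    HasPureDim (restrict (M.regular g n) (M.abelian g (halfTraces K φ))) 0 := by
  subst hg
  have hsub : Subsingleton (M.abelian 0 (halfTraces K φ)) := by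
    refine ⟨fun ρ σ => Subtype.ext (M.isEmbedding_tuple.injective (funext fun s => ?_))⟩
    rcases s with j | j | i
    · exact j.elim0
    · exact j.elim0
    · have hc : halfTraces K φ i ^ 2 = 1 := by
        rw [halfTraces]
        exact_mod_cast congrArg (RCLike.ofReal (K := K)) (h i)
      rw [(ρ.2.1 i).2.2 hc, (σ.2.1 i).2.2 hc]
  have := Finite.of_subsingleton (α := M.abelian 0 (halfTraces K φ))
  -- Each point is a family with no angles; the space, having at most one point, serves as the index
  -- set.
  refine hasPureDim_of_cover _ _ (M := Empty → K) (fun x (_ : Empty → K) => x)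
    (fun j f _ f' _ h0 => ?_) (fun x => ⟨x, fun f _ h0 => h0 0⟩) fun j => ?_
  · rcases mul_eq_zero.1 (h0 0) with h1 | h1
    exacts [Or.inl fun _ => h1, Or.inr fun _ => h1]
  · rw [ringKrullDim_eq_card_of_cos_mem (P := P) ?_ (fun i : Empty => i.elim)]
    · simp
    · rintro _ ⟨f, _, rfl⟩
      exact (trigPoly P Empty).algebraMap_mem (f j)

/-! ### The abelian locus in the representation space -/

variable {R : Type*} {proj : HomSpace g n G → R}

theorem N_pure_standard : N (pure (![1, 0, 0] : Fin 3 → K)) = 1 := by simp [N]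

/-- The parametrization of the abelian representations by angles. -/
def torusRep (proj : HomSpace g n G → R) (ε : balancedSigns φ) (t : Fin g ⊕ Fin g → K) :
    proj '' M.abelian g (halfTraces K φ) :=
  ⟨proj (M.torusHom P ε N_pure_standard t).1, _, (M.torusHom P ε N_pure_standard t).2, rfl⟩

theorem map_torusRep_le (ε : balancedSigns φ) :
    (restrict (pushforward (M.regular g n) proj) (proj '' M.abelian g (halfTraces K φ))).map
      (pullback K (M.torusRep P proj ε)) ≤ trigPoly P (Fin g ⊕ Fin g) := by
  have h1 := M.map_regular_le_trigPoly (g := g) P (fun t => (M.torusHom P ε N_pure_standard t).1) ε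
    (fun _ => N_pure_standard) id (fun t => rfl) fun i => (trigPoly P _).algebraMap_mem _
  rintro _ ⟨_, ⟨F, hF, rfl⟩, rfl⟩
  exact h1 ⟨_, hF, rfl⟩

/-- Conjugation moves every axis of norm one to the standard one, so only the angles at `μ_j`, `ν_j`
remain. Their cosines are half traces, hence lie in the algebra of invariants, and its finite
generation need not be known. -/
theorem hasPureDim_abelian_rep (P : CircleParam K) (hinv : ∀ a ρ, proj (conjHom a ρ) = proj ρ)
    (htr : ∀ x, ∃ h : R → K, ∀ ρ, h (proj ρ) = (evalTuple (M.tuple ρ) x).re) :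
    HasPureDim (restrict (pushforward (M.regular g n) proj)
      (proj '' M.abelian g (halfTraces K φ))) (2 * g) := by
  refine hasPureDim_of_cover _ _ (M.torusRep P proj) (fun j f hf f' hf' h0 => ?_) ?_ fun ε => ?_
  · have hle := M.map_torusRep_le (proj := proj) P j
    exact trigPoly_eq_zero_or P (hle ⟨f, hf, rfl⟩) (hle ⟨f', hf', rfl⟩) h0
  · rintro ⟨_, ρ, ⟨hρ, hab⟩, rfl⟩
    obtain ⟨ε, hε, l, hmem⟩ := M.exists_mem_closure_torusHoms hρ hab
    refine ⟨⟨ε, hε⟩, ?_⟩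
    rintro _ ⟨F, hF, rfl⟩ h0
    refine closure_minimal (t := {ρ | F (proj ρ) = 0}) ?_
      (isClosed_eq (M.continuous_of_mem_regular hF) continuous_const) hmem
    rintro σ ⟨p, a, b, hp, hl, hab', hσ⟩
    obtain ⟨u, hu, hup⟩ := Quat.exists_conj_of_N_eq (re_pure ![1, 0, 0]) (re_pure p)
      (by rw [N_pure_standard, hp]) (by rw [N_pure_standard]; exact one_ne_zero)
    obtain ⟨c, hc⟩ := M.exists_conjHom_of_N_ne_zero σ hu
    obtain ⟨t, ht⟩ := M.eq_torusHom P ⟨ε, hε⟩ N_pure_standard hab' (ρ := conjHom c σ)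
      (funext fun s => by rw [hc, hσ, conj_torusTuple hu hup])
    change F (proj σ) = 0
    rw [← hinv c, ht]
    exact h0 t
  · rw [ringKrullDim_eq_card_of_cos_mem (M.map_torusRep_le P ε)]
    · congr 2
      simp
      ring
    · intro i
      obtain ⟨s, hs⟩ : ∃ s : SurfaceGen g n, ∀ t,
          (M.tuple (M.torusHom P ε (N_pure_standard (K := K)) t).1 s).re = P.cos (t i) := by
        rcases i with i | i
        · refine ⟨.mu i, fun t => ?_⟩
          rw [M.tuple_torusHom]
          simp [torusTuple]
        · refine ⟨.nu i, fun t => ?_⟩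
          rw [M.tuple_torusHom]
          simp [torusTuple]
      obtain ⟨F, hF⟩ := htr (FreeAlgebra.ι K s)
      refine ⟨_, ⟨F, ?_, rfl⟩, funext fun t => (hF _).trans ?_⟩
      · have h1 := M.evalTuple_mem_regular (FreeAlgebra.ι K s)
        rw [← funext hF] at h1
        exact h1
      · rw [evalTuple_ι, hs]

end QuatModel

end CoaxialDimension

/-! ### The coaxial loci -/

section CoaxialLoci

open Module Quat Topology

variable (g : ℕ) {n : ℕ} (θ : Fin n → ℝ)

/-- The angles of the rotations in the conjugacy classes. -/
def angles (i : Fin n) : ℝ := Real.pi * oddDist (θ i)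

theorem exists_unit_oddDist_eq (t : ℝ) :
    ∃ (e : ℤˣ) (m : ℤ), oddDist t = ((e : ℤ) : ℝ) * (t - 1) + 2 * m := by
  obtain ⟨m, hm⟩ := exists_oddDist_eq t
  rcases abs_choice (t - (2 * m + 1)) with h | h
  · refine ⟨1, -m, ?_⟩
    rw [hm, h]; push_cast; ring
  · refine ⟨-1, m, ?_⟩
    rw [hm, h]; push_cast; ring

theorem mem_balancedSigns_angles_iff (ε : Fin n → ℤˣ) : ε ∈ balancedSigns (angles θ) ↔
    ∃ m : ℤ, ∑ i, ((ε i : ℤ) : ℝ) * oddDist (θ i) = 2 * m := by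
  refine exists_congr fun m => ?_
  have h : ∑ i, ((ε i : ℤ) : ℝ) * angles θ i =
      Real.pi * ∑ i, ((ε i : ℤ) : ℝ) * oddDist (θ i) := by
    rw [Finset.mul_sum]
    exact Finset.sum_congr rfl fun i _ => by rw [angles]; ring
  rw [h, show (m : ℝ) * (2 * Real.pi) = Real.pi * (2 * m) by ring,
    mul_right_inj' Real.pi_ne_zero, eq_comm]

/-- Modulo even integers the distance to the odd integers is `± (t - 1)`. The sign is absorbed into
`ε` and the even integer into the number of turns. -/
theorem balancedSigns_nonempty_iff : (balancedSigns (angles θ)).Nonempty ↔ SignCondition θ := by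
  choose e m h using fun i => exists_unit_oddDist_eq (θ i)
  have key : ∀ ε : Fin n → ℤˣ, ∑ i, ((ε i : ℤ) : ℝ) * oddDist (θ i) =
      ∑ i, (((ε i * e i : ℤˣ) : ℤ) : ℝ) * (θ i - 1) + 2 * ((∑ i, (ε i : ℤ) * m i : ℤ) : ℝ) := by
    intro ε
    push_cast
    rw [Finset.mul_sum, ← Finset.sum_add_distrib]
    exact Finset.sum_congr rfl fun i _ => by rw [h]; ring
  constructor
  · rintro ⟨ε, hε⟩
    obtain ⟨k, hk⟩ := (mem_balancedSigns_angles_iff θ ε).1 hε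
    rw [key] at hk
    refine ⟨fun i => ε i * e i, k - ∑ i, (ε i : ℤ) * m i, ?_⟩
    rw [Int.cast_sub]
    linarith
  · rintro ⟨ε, k, hk⟩
    refine ⟨fun i => ε i * e i, (mem_balancedSigns_angles_iff θ _).2
      ⟨k + ∑ i, ((ε i * e i : ℤˣ) : ℤ) * m i, ?_⟩⟩
    rw [key]
    simp only [mul_assoc, Int.units_mul_self, mul_one]
    rw [Int.cast_add, hk]
    ring

theorem numIntegral_lt_iff : numIntegral θ < n ↔ ∃ i, Real.cos (angles θ i) ^ 2 ≠ 1 := by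
  rw [← card_cosAngle]
  change Nat.card {i // Real.cos (angles θ i) ^ 2 = 1} < n ↔ _
  classical
  rw [Nat.card_eq_fintype_card]
  constructor
  · intro h
    by_contra! hall
    rw [Fintype.card_of_subtype Finset.univ (by simpa using hall)] at h
    simp at h
  · rintro ⟨i, hi⟩
    exact (Fintype.card_subtype_lt (p := fun i => Real.cos (angles θ i) ^ 2 = 1) hi).trans_eq (Fintype.card_fin n)

theorem coaxHomSU2_eq_abelian :
    coaxHomSU2 g θ = modelSU2.abelian g (halfTraces ℝ (angles θ)) := coaxHomSU2_eq g θ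

theorem coaxHomSL2_eq_abelian :
    coaxHomSL2 g θ = modelSL2.abelian g (halfTraces ℂ (angles θ)) := coaxHomSL2_eq g θ

theorem nonempty_coaxHomSU2_iff : (coaxHomSU2 g θ).Nonempty ↔ SignCondition θ := by
  rw [← balancedSigns_nonempty_iff, coaxHomSU2_eq_abelian]
  exact modelSU2.exists_isAbelian_iff _

theorem nonempty_coaxHomSL2_iff : (coaxHomSL2 g θ).Nonempty ↔ SignCondition θ := by
  rw [← balancedSigns_nonempty_iff, coaxHomSL2_eq_abelian]
  exact modelSL2.exists_isAbelian_iff _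

theorem hasPureDim_coaxHomSU2 (h : 0 < g ∨ numIntegral θ < n) :
    HasPureDim (restrict (regularSU2 g n) (coaxHomSU2 g θ)) (2 * g + 2) := by
  rw [coaxHomSU2_eq_abelian, regularSU2_eq]
  exact modelSU2.hasPureDim_abelian realCircleParam (h.imp_right (numIntegral_lt_iff θ).1)

theorem hasPureDim_coaxHomSL2 (h : 0 < g ∨ numIntegral θ < n) :
    HasPureDim (restrict (regularSL2 g n) (coaxHomSL2 g θ)) (2 * g + 2) := by
  rw [coaxHomSL2_eq_abelian, regularSL2_eq]
  exact modelSL2.hasPureDim_abelian complexCircleParam (h.imp_right (numIntegral_lt_iff θ).1)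

theorem cos_angles_sq_of_numIntegral_eq (h : numIntegral θ = n) (i : Fin n) :
    Real.cos (angles θ i) ^ 2 = 1 := by
  by_contra hi
  exact absurd ((numIntegral_lt_iff θ).2 ⟨i, hi⟩) (by omega)

theorem hasPureDim_coaxHomSU2_zero (hg : g = 0) (h : numIntegral θ = n) :
    HasPureDim (restrict (regularSU2 g n) (coaxHomSU2 g θ)) 0 := by
  rw [coaxHomSU2_eq_abelian, regularSU2_eq]
  exact modelSU2.hasPureDim_abelian_zero realCircleParam hg (cos_angles_sq_of_numIntegral_eq θ h)

theorem hasPureDim_coaxHomSL2_zero (hg : g = 0) (h : numIntegral θ = n) :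
    HasPureDim (restrict (regularSL2 g n) (coaxHomSL2 g θ)) 0 := by
  rw [coaxHomSL2_eq_abelian, regularSL2_eq]
  exact modelSL2.hasPureDim_abelian_zero complexCircleParam hg
    (cos_angles_sq_of_numIntegral_eq θ h)

theorem hasPureDim_coaxRepSU2 :
    HasPureDim (restrict (pushforward (regularSU2 g n) projSU2) (coaxRepSU2 g θ)) (2 * g) := by
  rw [coaxRepSU2, coaxHomSU2_eq_abelian, regularSU2_eq]
  exact modelSU2.hasPureDim_abelian_rep realCircleParam QuatModel.toOrbit_conjHom
    (modelSU2.isGoodQuotient_toOrbit (cosAngle θ)).trace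

theorem hasPureDim_coaxRepSL2 :
    HasPureDim (restrict (pushforward (regularSL2 g n) projSL2) (coaxRepSL2 g θ)) (2 * g) := by
  rw [coaxRepSL2, coaxHomSL2_eq_abelian, regularSL2_eq]
  exact modelSL2.hasPureDim_abelian_rep complexCircleParam projSL2_conjHom exists_trace_projSL2

end CoaxialLoci

end SurfaceRep
end

theorem mainTheorem5 (g n : ℕ) (θ : Fin n → ℝ) (hθ : ∀ i, 0 < θ i) (k : ℕ)
    (hk : k = SurfaceRep.numIntegral θ) :
    -- the group `SU₂`
    ((0 < g ∨ k < n → SurfaceRep.HasPureDim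
        (SurfaceRep.restrict (SurfaceRep.regularSU2 g n) (SurfaceRep.coaxHomSU2 g θ))
        (2 * g + 2)) ∧
      (g = 0 ∧ k = n → SurfaceRep.HasPureDim
        (SurfaceRep.restrict (SurfaceRep.regularSU2 g n) (SurfaceRep.coaxHomSU2 g θ)) 0) ∧
      ((SurfaceRep.coaxHomSU2 g θ).Nonempty ↔ SurfaceRep.SignCondition θ) ∧
      SurfaceRep.IsOrientedManifold
        (SurfaceRep.restrict (SurfaceRep.regularSU2 g n) (SurfaceRep.noncoaxHomSU2 g θ))
        (6 * (g : ℤ) - 3 + 2 * ((n : ℤ) - k)) ∧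
      SurfaceRep.HasPureDim
        (SurfaceRep.restrict
          (SurfaceRep.pushforward (SurfaceRep.regularSU2 g n) SurfaceRep.projSU2)
          (SurfaceRep.coaxRepSU2 g θ))
        (2 * g) ∧
      SurfaceRep.IsOrientedManifold
        (SurfaceRep.restrict
          (SurfaceRep.pushforward (SurfaceRep.regularSU2 g n) SurfaceRep.projSU2)
          (SurfaceRep.noncoaxRepSU2 g θ))
        (6 * (g : ℤ) - 6 + 2 * ((n : ℤ) - k))) ∧
    -- the group `SL₂(ℂ)`, with complex dimensions
    ((0 < g ∨ k < n → SurfaceRep.HasPureDim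
        (SurfaceRep.restrict (SurfaceRep.regularSL2 g n) (SurfaceRep.coaxHomSL2 g θ))
        (2 * g + 2)) ∧
      (g = 0 ∧ k = n → SurfaceRep.HasPureDim
        (SurfaceRep.restrict (SurfaceRep.regularSL2 g n) (SurfaceRep.coaxHomSL2 g θ)) 0) ∧
      ((SurfaceRep.coaxHomSL2 g θ).Nonempty ↔ SurfaceRep.SignCondition θ) ∧
      SurfaceRep.IsOrientedManifold
        (SurfaceRep.restrict (SurfaceRep.regularSL2 g n) (SurfaceRep.noncoaxHomSL2 g θ))
        (6 * (g : ℤ) - 3 + 2 * ((n : ℤ) - k)) ∧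
      SurfaceRep.HasPureDim
        (SurfaceRep.restrict
          (SurfaceRep.pushforward (SurfaceRep.regularSL2 g n) SurfaceRep.projSL2)
          (SurfaceRep.coaxRepSL2 g θ))
        (2 * g) ∧
      SurfaceRep.IsOrientedManifold
        (SurfaceRep.restrict
          (SurfaceRep.pushforward (SurfaceRep.regularSL2 g n) SurfaceRep.projSL2)
          (SurfaceRep.noncoaxRepSL2 g θ))
        (6 * (g : ℤ) - 6 + 2 * ((n : ℤ) - k))) := by
  subst hk
  open SurfaceRep in
  exact ⟨⟨hasPureDim_coaxHomSU2 g θ, fun h => hasPureDim_coaxHomSU2_zero g θ h.1 h.2,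
      nonempty_coaxHomSU2_iff g θ, isOrientedManifold_noncoaxHomSU2 g θ, hasPureDim_coaxRepSU2 g θ,
      isOrientedManifold_noncoaxRepSU2 g θ⟩,
    hasPureDim_coaxHomSL2 g θ, fun h => hasPureDim_coaxHomSL2_zero g θ h.1 h.2,
    nonempty_coaxHomSL2_iff g θ, isOrientedManifold_noncoaxHomSL2 g θ, hasPureDim_coaxRepSL2 g θ,
    isOrientedManifold_noncoaxRepSL2 g θ⟩
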